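/- Let $\mathcal P_{\mathbb K}$ be the set of $8$-tuples $\mathbf p=(p_1,\dots,p_8)$ of distinct points of $\mathbb P^2_{\mathbb K}$, and put $\mathcal P=\mathcal P_{\mathbb C}$. A \emph{pair} $\mathcal Q=(\mathcal I,\mathcal J)$ consists of a set $\mathcal I$ of $3$-subsets and a set $\mathcal J$ of $6$-subsets of $\{1,\dots,8\}$; the symmetric group $\mathfrak S_8$ acts on pairs by relabelling. A \emph{conic} is the zero locus of an irreducible ternary quadratic form. The pair $\mathcal Q$ is \emph{represented} by $\mathbf p\in\mathcal P_{\mathbb K}$ if the triples of points of $\mathbf p$ lying on a line are exactly those indexed by $\mathcal I$ and the sextuples of points of $\mathbf p$ lying on a conic are exactly those indexed by $\mathcal J$; it is \emph{representable over $\mathbb K$} if some $\mathbf p\in\mathcal P_{\mathbb K}$ represents it. Pairs representable over $\mathbb C$ are called \emph{quatroids}. The pair $\mathcal Q$ satisfies the \emph{weak criteria} if 1. $|I\cap J|\le 2$ for all $I\in\mathcal I$, $J\in\mathcal J$; 2. whenever $I_1,I_2\in\mathcal I$ and $|I_1\cap I_2|>1$, every $3$-subset of $I_1\cup I_2$ is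 in $\mathcal I$; 3. whenever $J_1,J_2\in\mathcal J$ and $|J_1\cap J_2|>4$, every $6$-subset of $J_1\cup J_2$ is in $\mathcal J$. It is \emph{Bézoutian} if, in addition, $|I_1\cap I_2|\le 1$ for all distinct $I_1,I_2\in\mathcal I$ and $|J_1\cap J_2|\le 4$ for all distinct $J_1,J_2\in\mathcal J$. It is a \emph{candidate} if it satisfies the weak criteria and there is $\mathbf p\in\mathcal P$ whose collinear triples are exactly those indexed by $\mathcal I$. For a pair $\mathcal Q$ let $\mathcal Z_{\mathcal Q}\subseteq\mathcal P$ be the set of all $\mathbf p$ such that the points indexed by each $I\in\mathcal I$ lie on a line and the points indexed by each $J\in\mathcal J$ lie on a conic, and let $\mathcal S_{\mathcal Q}=\mathcal Z_{\mathcal Q}\setminus\bigcup_{\mathcal Q'}\mathcal Z_{\mathcal Q'}$, the union being over the pairs $\mathcal Q'$ with $\mathcal Z_{\mathcal Q'}\subsetneq\mathcal Z_{\mathcal Q}$. The \emph{strata} are the nonempty sets $\mathcal S_{\mathcal Q}$; a stratum is \emph{Bézoutian} if it equals $\mathcal S_{\mathcal Q}$ for a Bézoutian quatroid $\mathcal Q$.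 The group $\mathfrak S_8$ acts on the strata by permuting the points. **Corollary.** There are exactly $780617$ candidates, forming $126$ orbits under $\mathfrak S_8$. Of these, exactly $779777$ ($125$ orbits) are representable over $\mathbb C$, exactly $778937$ ($124$ orbits) are representable over $\mathbb R$, and exactly $778937$ ($124$ orbits) are representable over $\mathbb Q$. The stratification of $\mathcal P$ consists of exactly $779777$ strata, of which exactly $544748$ ($76$ orbits) are Bézoutian; likewise, exactly $544748$ quatroids ($76$ orbits) are Bézoutian. -/

import Mathlib

open scoped Pointwise LinearAlgebra.Projectivization

namespace Quatroid

/-- The projective plane over `K`. -/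
abbrev Plane (K : Type) [Field K] : Type := ℙ K (Fin 3 → K)

/-- Configurations of eight distinct points of the projective plane over `K`
(the labels `1, …, 8` are the elements of `Fin 8`). -/
abbrev Config (K : Type) [Field K] : Type := Fin 8 ↪ Plane K

/-- A set of points lies on a conic: some irreducible ternary quadratic form vanishes at all of
them. (Vanishing does not depend on the representative vector, the form being homogeneous.) -/
def OnConic {K : Type} [Field K] (S : Set (Plane K)) : Prop :=
  ∃ F : MvPolynomial (Fin 3) K, F.IsHomogeneous 2 ∧ Irreducible F ∧
    ∀ P ∈ S, MvPolynomial.eval P.rep F = 0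

/-- The points of `p` with label in `I` lie on a line. -/
def LineThrough {K : Type} [Field K] (p : Config K) (I : Finset (Fin 8)) : Prop :=
  Projectivization.IsCollinear (p '' (I : Set (Fin 8)))

/-- The points of `p` with label in `J` lie on an irreducible conic. -/
def ConicThrough {K : Type} [Field K] (p : Config K) (J : Finset (Fin 8)) : Prop :=
  OnConic (p '' (J : Set (Fin 8)))

/-- Two collections of subsets of the label set. The symmetric group `Equiv.Perm (Fin 8)` acts on
these by relabelling (the pointwise action). -/
abbrev Pair : Type := Finset (Finset (Fin 8)) × Finset (Finset (Fin 8))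

/-- The first collection consists of triples, the second one of sextuples. -/
def IsPair (Q : Pair) : Prop :=
  (∀ I ∈ Q.1, I.card = 3) ∧ (∀ J ∈ Q.2, J.card = 6)

/-- `p` represents `Q`: the triples of points of `p` on a line are exactly those in `Q.1`, and the
sextuples on an irreducible conic are exactly those in `Q.2`. -/
def Represents {K : Type} [Field K] (p : Config K) (Q : Pair) : Prop :=
  IsPair Q ∧
  (∀ I : Finset (Fin 8), I.card = 3 → (I ∈ Q.1 ↔ LineThrough p I)) ∧
  (∀ J : Finset (Fin 8), J.card = 6 → (J ∈ Q.2 ↔ ConicThrough p J))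

/-- `Q` is a `K`-representable quatroid. -/
def Representable (K : Type) [Field K] (Q : Pair) : Prop :=
  ∃ p : Config K, Represents p Q

/-- The underlying rank-at-most-three matroid, whose nonbases of size three are the triples
in `Q.1`, is represented by eight distinct points of the complex projective plane. -/
def Matroidal (Q : Pair) : Prop :=
  ∃ p : Config ℂ, ∀ I : Finset (Fin 8), I.card = 3 → (I ∈ Q.1 ↔ LineThrough p I)

/-- Bézout's weak criteria. -/
def WeakCriteria (Q : Pair) : Prop :=
  (∀ I ∈ Q.1, ∀ J ∈ Q.2, (I ∩ J).card ≤ 2) ∧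
  (∀ I₁ ∈ Q.1, ∀ I₂ ∈ Q.1, 1 < (I₁ ∩ I₂).card →
    ∀ I : Finset (Fin 8), I ⊆ I₁ ∪ I₂ → I.card = 3 → I ∈ Q.1) ∧
  (∀ J₁ ∈ Q.2, ∀ J₂ ∈ Q.2, 4 < (J₁ ∩ J₂).card →
    ∀ J : Finset (Fin 8), J ⊆ J₁ ∪ J₂ → J.card = 6 → J ∈ Q.2)

/-- Bézout's strong criteria. -/
def StrongCriteria (Q : Pair) : Prop :=
  (∀ I₁ ∈ Q.1, ∀ I₂ ∈ Q.1, I₁ ≠ I₂ → (I₁ ∩ I₂).card ≤ 1) ∧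
  (∀ J₁ ∈ Q.2, ∀ J₂ ∈ Q.2, J₁ ≠ J₂ → (J₁ ∩ J₂).card ≤ 4)

/-- Bézoutian pairs. -/
def Bezoutian (Q : Pair) : Prop :=
  IsPair Q ∧ WeakCriteria Q ∧ StrongCriteria Q

/-- The set of candidate quatroids. -/
def candidates : Set Pair := {Q | IsPair Q ∧ Matroidal Q ∧ WeakCriteria Q}

/-- The number of orbits of the symmetric group that meet `X`, i.e. the number of orbits on `X`
when `X` is stable under relabelling. -/
noncomputable def orbitCount (X : Set Pair) : ℕ :=
  ((fun Q : Pair => MulAction.orbit (Equiv.Perm (Fin 8)) Q) '' X).ncard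

/-- The locus of complex configurations satisfying at least the line and conic conditions
indexed by `Q`. -/
def locus (Q : Pair) : Set (Config ℂ) :=
  {p | (∀ I ∈ Q.1, LineThrough p I) ∧ (∀ J ∈ Q.2, ConicThrough p J)}

/-- The locus of `Q` minus all loci of pairs that are properly contained in it. -/
def stratum (Q : Pair) : Set (Config ℂ) :=
  locus Q \ ⋃ Q' ∈ {Q' : Pair | IsPair Q' ∧ locus Q' ⊂ locus Q}, locus Q'

/-- The stratification of the space of complex configurations: all nonempty strata. -/
def strata : Set (Set (Config ℂ)) :=
  {S | S.Nonempty ∧ ∃ Q, IsPair Q ∧ S = stratum Q}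

/-- The strata of Bézoutian quatroids. -/
def bezoutianStrata : Set (Set (Config ℂ)) :=
  {S ∈ strata | ∃ Q, Representable ℂ Q ∧ Bezoutian Q ∧ S = stratum Q}

/-- Relabelling the points of all configurations in `S`. -/
def relabel (σ : Equiv.Perm (Fin 8)) (S : Set (Config ℂ)) : Set (Config ℂ) :=
  {p | σ.toEmbedding.trans p ∈ S}

/-- The number of orbits, under relabelling the points, of the strata in `A`. -/
noncomputable def strataOrbitCount (A : Set (Set (Config ℂ))) : ℕ :=
  ((fun S => Set.range fun σ : Equiv.Perm (Fin 8) => relabel σ S) '' A).ncard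

end Quatroid

/-! Bézout's theorem makes the combinatorics rigid. In a pair satisfying the weak criteria, the
triples are exactly those contained in certain maximal label sets ("lines"), the sextuples those
contained in certain maximal label sets ("conics"), and two of these blocks share at most one, two
or four labels according to their types. Conversely, every family of blocks obeying these bounds (a
clique) comes from such a pair. This correspondence is bijective and compatible with relabelling
(`exists_clique_toPair`, `IsClique.weakCriteria`, `toPair_injOn`), so the pairs are counted by
classifying cliques. A clique belongs to a Bézoutian pair exactly if all its blocks have the minimal
size 3 or 6 (`IsClique.strongCriteria_iff`).

The cliques are generated block by block, larger lines before smaller ones and lines before conics.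
A table holds 128 representatives. It is complete because every admissible extension of a
representative is carried to a representative by a recorded permutation (`exists_smul_of_isClique`),
and free of repetitions because a numerical invariant separates its entries
(`classFamily_injective`). Orbit sizes follow from double counting the pairs of cliques that differ
by one block of the largest rank (`card_orbitFinset_mul_card_topBlocks`), with no enumeration of
permutations.

Representability is a matter of determinants. Three points are collinear if and only if their
bracket vanishes. In coordinates whose basis consists of three of the points, the quadrics through
these three are linear in the image under the Cremona involution; hence six points, no three of them
collinear, lie on an irreducible conic if and only if a bracket of Cremona images vanishes
(`exists_conic_iff`). For 124 representatives integer coordinates are checked, which serve every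
field of characteristic zero. Four remain. Two contain a Fano plane and are not even matroids over
the complex numbers. One is a complete quadrilateral with three conics: its lines are realizable,
its conics are contradictory (`not_quadrilateral_of_conics`). The last is the Möbius–Kantor
configuration, which forces a root of `r ^ 2 - r + 1`; it exists over the complex numbers but not
over the reals or the rationals. This accounts for 126, 125 and 124 orbits.

Finally, the stratum of a quatroid consists of the configurations that represent it, and every
nonempty stratum is of this form, so strata and complex quatroids correspond bijectively
(`mem_stratum_iff`, `strata_eq_image`). -/

namespace Quatroid

/-! ### Brackets and the determinantal conic condition -/

/-- The determinant of three vectors. -/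
def bracket {R : Type*} [CommRing R] (u v w : Fin 3 → R) : R :=
  u 0 * (v 1 * w 2 - v 2 * w 1) - u 1 * (v 0 * w 2 - v 2 * w 0) + u 2 * (v 0 * w 1 - v 1 * w 0)

/-- The coordinates of `x`, up to a common factor, in the basis `u, v, w`. -/
def dualCoord {R : Type*} [CommRing R] (u v w x : Fin 3 → R) : Fin 3 → R :=
  ![bracket v w x, bracket w u x, bracket u v x]

/-- The image of a vector under the quadratic Cremona involution. -/
def cremona {R : Type*} [CommRing R] (x : Fin 3 → R) : Fin 3 → R :=
  ![x 1 * x 2, x 2 * x 0, x 0 * x 1]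

/-- The determinant whose vanishing says that six points, no three of them collinear, lie on a
conic. -/
def conicBracket {R : Type*} [CommRing R] (u v w x y z : Fin 3 → R) : R :=
  bracket (cremona (dualCoord u v w x)) (cremona (dualCoord u v w y))
    (cremona (dualCoord u v w z))

theorem bracket_eq_det {R : Type*} [CommRing R] (u v w : Fin 3 → R) :
    bracket u v w = Matrix.det (Matrix.of ![u, v, w]) := by
  simp [Matrix.det_fin_three, bracket]; ring

section Field
variable {K : Type} [Field K]

theorem bracket_ne_zero_iff (u v w : Fin 3 → K) :
    bracket u v w ≠ 0 ↔ LinearIndependent K ![u, v, w] := by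
  rw [bracket_eq_det]
  have := Matrix.linearIndependent_rows_iff_isUnit (A := Matrix.of ![u, v, w])
  rw [Matrix.isUnit_iff_isUnit_det, isUnit_iff_ne_zero] at this
  exact this.symm

/-- Three vectors are linearly dependent exactly if a nonzero linear form kills them. -/
theorem bracket_eq_zero_iff_exists (u v w : Fin 3 → K) :
    bracket u v w = 0 ↔ ∃ c : Fin 3 → K, c ≠ 0 ∧ ∀ x ∈ ({u, v, w} : Set (Fin 3 → K)),
      c 0 * x 0 + c 1 * x 1 + c 2 * x 2 = 0 := by
  rw [bracket_eq_det, ← Matrix.exists_mulVec_eq_zero_iff]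
  refine exists_congr fun c => and_congr Iff.rfl ?_
  simp only [Set.mem_insert_iff, Set.mem_singleton_iff, forall_eq_or_imp, forall_eq]
  simp only [funext_iff, Matrix.mulVec, dotProduct, Fin.sum_univ_three, Fin.forall_fin_succ,
    Matrix.of_apply]
  simp [mul_comm]

/-- The span of the three representatives is the smallest subspace that could serve as the line, so
the only question is whether its dimension reaches three. -/
theorem collinear_iff_bracket (P Q R : Plane K) :
    Projectivization.IsCollinear {P, Q, R} ↔ bracket P.rep Q.rep R.rep = 0 := by
  rw [← not_iff_not, ← ne_eq (bracket _ _ _), bracket_ne_zero_iff]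
  constructor
  · intro h
    by_contra hli
    refine h ⟨(Submodule.span K (Set.range ![P.rep, Q.rep, R.rep])).projectivization, ?_, ?_, ?_⟩
    · rw [Projectivization.Subspace.submodule.apply_symm_apply]
      exact Module.Finite.span_of_finite _ (Set.toFinite _)
    · rw [Projectivization.Subspace.submodule.apply_symm_apply]
      rw [linearIndependent_iff_card_eq_finrank_span] at hli
      have := finrank_range_le_card (R := K) ![P.rep, Q.rep, R.rep]
      simp only [Set.finrank, Fintype.card_fin] at hli this
      omega
    · have key : ∀ i, (![P, Q, R] i) ∈
          (Submodule.span K (Set.range ![P.rep, Q.rep, R.rep])).projectivization := by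
        intro i
        rw [← (![P, Q, R] i).mk_rep, Submodule.mk_mem_projectivization_iff]
        have : (![P, Q, R] i).rep = ![P.rep, Q.rep, R.rep] i := by fin_cases i <;> rfl
        rw [this]
        exact Submodule.subset_span ⟨i, rfl⟩
      rintro X (rfl | rfl | rfl)
      · exact key 0
      · exact key 1
      · exact key 2
  · rintro hli ⟨M, hM, h2, hs⟩
    have key : ∀ X ∈ ({P, Q, R} : Set (Plane K)), X.rep ∈ M.submodule := by
      intro X hX
      have h1 := hs hX
      rw [← X.mk_rep, ← Projectivization.Subspace.submodule.symm_apply_apply M] at h1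
      exact (Submodule.mk_mem_projectivization_iff _ _).1 h1
    have hle : Submodule.span K (Set.range ![P.rep, Q.rep, R.rep]) ≤ M.submodule := by
      rw [Submodule.span_le]
      rintro _ ⟨i, rfl⟩
      fin_cases i
      · exact key P (by simp)
      · exact key Q (by simp)
      · exact key R (by simp)
    have h3 := finrank_span_eq_card hli
    have h4 := Submodule.finrank_mono hle
    rw [h3] at h4
    simp at h4
    omega

theorem bracket_smul (a b c : K) (u v w : Fin 3 → K) :
    bracket (a • u) (b • v) (c • w) = a * b * c * bracket u v w := by
  simp [bracket]; ring

theorem dualCoord_smul (a b c d : K) (u v w x : Fin 3 → K) :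
    dualCoord (a • u) (b • v) (c • w) (d • x) =
      ![b * c * d * bracket v w x, c * a * d * bracket w u x, a * b * d * bracket u v x] := by
  simp [dualCoord, bracket_smul]

theorem conicBracket_smul (a b c d e f : K) (u v w x y z : Fin 3 → K) :
    conicBracket (a • u) (b • v) (c • w) (d • x) (e • y) (f • z) =
      (a * b * c) ^ 4 * (d * e * f) ^ 2 * conicBracket u v w x y z := by
  simp only [conicBracket, dualCoord_smul]
  simp only [dualCoord]
  -- Both sides are polynomials in the scalars and these nine brackets; no expansion down to
  -- coordinates is needed.
  generalize bracket v w x = x0, bracket w u x = x1, bracket u v x = x2,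
    bracket v w y = y0, bracket w u y = y1, bracket u v y = y2,
    bracket v w z = z0, bracket w u z = z1, bracket u v z = z2
  simp [bracket, cremona]
  ring

end Field

/-! ### Quadratic forms and irreducible conics -/

section Conic
variable {K : Type} [Field K] 

theorem exists_linear_coeff {F : MvPolynomial (Fin 3) K} (hF : F.IsHomogeneous 1) :
    ∃ c : Fin 3 → K, ∀ x, MvPolynomial.eval x F = c 0 * x 0 + c 1 * x 1 + c 2 * x 2 := by
  rw [← MvPolynomial.mem_homogeneousSubmodule, MvPolynomial.homogeneousSubmodule_one_eq_span_X,
    Submodule.mem_span_range_iff_exists_fun] at hF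
  obtain ⟨c, rfl⟩ := hF
  exact ⟨c, fun x => by simp [Fin.sum_univ_three, MvPolynomial.smul_eval]⟩

/-- The value at `x` of the quadratic form with the given coefficients. -/
def quad (c : Fin 6 → K) (x : Fin 3 → K) : K :=
  c 0 * x 0 ^ 2 + c 1 * x 1 ^ 2 + c 2 * x 2 ^ 2 + c 3 * (x 1 * x 2) + c 4 * (x 2 * x 0) +
    c 5 * (x 0 * x 1)

/-- Forms of degree two are sums of products of two linear forms, and both operations can be
followed on coefficients. -/
theorem exists_quad_coeff {F : MvPolynomial (Fin 3) K} (hF : F.IsHomogeneous 2) :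
    ∃ c : Fin 6 → K, ∀ x, MvPolynomial.eval x F = quad c x := by
  rw [← MvPolynomial.mem_homogeneousSubmodule, ← MvPolynomial.homogeneousSubmodule_one_pow,
    pow_two] at hF
  induction hF using Submodule.mul_induction_on' with
  | mem_mul_mem m hm n hn =>
    obtain ⟨a, ha⟩ := exists_linear_coeff hm
    obtain ⟨b, hb⟩ := exists_linear_coeff hn
    refine ⟨![a 0 * b 0, a 1 * b 1, a 2 * b 2, a 1 * b 2 + a 2 * b 1, a 2 * b 0 + a 0 * b 2,
      a 0 * b 1 + a 1 * b 0], fun x => ?_⟩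
    simp [quad, ha, hb]; ring
  | add m _ n _ hm hn =>
    obtain ⟨a, ha⟩ := hm
    obtain ⟨b, hb⟩ := hn
    exact ⟨a + b, fun x => by simp [quad, ha, hb]; ring⟩

end Conic
end Quatroid

namespace Quatroid
open MvPolynomial

section
variable {K : Type} [Field K]

/-- The polar form of a quadratic form. -/
def polarForm (c : Fin 6 → K) (x y : Fin 3 → K) : K := quad c (x + y) - quad c x - quad c y

theorem quad_combination (c : Fin 6 → K) (u v w : Fin 3 → K) (x : Fin 3 → K) :
    quad c (x 0 • u + x 1 • v + x 2 • w) =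
      x 0 ^ 2 * quad c u + x 1 ^ 2 * quad c v + x 2 ^ 2 * quad c w +
      (x 1 * x 2 * polarForm c v w + x 2 * x 0 * polarForm c w u +
        x 0 * x 1 * polarForm c u v) := by
  simp [quad, polarForm]; ring

theorem quad_smul (c : Fin 6 → K) (a : K) (x : Fin 3 → K) : quad c (a • x) = a ^ 2 * quad c x := by
  simp [quad]; ring

/-- Cramer's rule, cleared of denominators. -/
theorem bracket_smul_eq {R : Type*} [CommRing R] (u v w x : Fin 3 → R) :
    bracket u v w • x =
      dualCoord u v w x 0 • u + dualCoord u v w x 1 • v + dualCoord u v w x 2 • w := by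
  ext i
  fin_cases i <;> simp [dualCoord, bracket] <;> ring

/-- Cramer's rule substituted into the form. If the form vanishes at `u`, `v`, `w`, only the mixed
terms survive, and these are linear in the Cremona image of the coordinates. This is the source of
`conicBracket`. -/
theorem bracket_sq_mul_quad (c : Fin 6 → K) (u v w x : Fin 3 → K) :
    bracket u v w ^ 2 * quad c x =
      dualCoord u v w x 0 ^ 2 * quad c u + dualCoord u v w x 1 ^ 2 * quad c v +
        dualCoord u v w x 2 ^ 2 * quad c w +
      (cremona (dualCoord u v w x) 0 * polarForm c v w +
        cremona (dualCoord u v w x) 1 * polarForm c w u +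
        cremona (dualCoord u v w x) 2 * polarForm c u v) := by
  rw [← quad_smul, bracket_smul_eq, quad_combination]
  simp [cremona]

/-- The coordinates of the generic vector in the basis `u, v, w`, as linear forms. -/
noncomputable def coordForm (u v w : Fin 3 → K) : Fin 3 → MvPolynomial (Fin 3) K :=
  dualCoord (fun i => C (u i)) (fun i => C (v i)) (fun i => C (w i)) X

theorem eval_coordForm (u v w x : Fin 3 → K) (i : Fin 3) :
    eval x (coordForm u v w i) = dualCoord u v w x i := by
  fin_cases i <;> simp [coordForm, dualCoord, bracket]

theorem isHomogeneous_coordForm (u v w : Fin 3 → K) (i : Fin 3) :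
    (coordForm u v w i).IsHomogeneous 1 := by
  have key : ∀ a b : Fin 3 → K, (bracket (fun i => C (a i)) (fun i => C (b i))
      (X : Fin 3 → MvPolynomial (Fin 3) K)).IsHomogeneous 1 := by
    intro a b
    have : bracket (fun i => C (a i)) (fun i => C (b i)) (X : Fin 3 → MvPolynomial (Fin 3) K) =
        C (a 1 * b 2 - a 2 * b 1) * X 0 + C (a 2 * b 0 - a 0 * b 2) * X 1 +
          C (a 0 * b 1 - a 1 * b 0) * X 2 := by
      simp [bracket]; ring
    rw [this]
    exact ((isHomogeneous_C_mul_X _ _).add (isHomogeneous_C_mul_X _ _)).add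
      (isHomogeneous_C_mul_X _ _)
  fin_cases i
  · exact key v w
  · exact key w u
  · exact key u v

theorem exists_bracket_ne_zero {u v : Fin 3 → K} (h : LinearIndependent K ![u, v]) :
    ∃ w, bracket u v w ≠ 0 := by
  by_contra! h0
  have h1 := h0 ![1, 0, 0]
  have h2 := h0 ![0, 1, 0]
  have h3 := h0 ![0, 0, 1]
  simp [bracket] at h1 h2 h3
  rw [LinearIndependent.pair_iff] at h
  have hv : v = 0 := by
    ext i
    -- The relation `v i • u - u i • v = 0` holds because all minors of the pair vanish;
    -- independence then gives `v i = 0`.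
    have := h (v i) (-u i) (by ext j; fin_cases i <;> fin_cases j <;> simp <;> grind)
    exact this.1
  have := h 0 1 (by simp [hv])
  simp at this

theorem exists_affine_coeff {G : MvPolynomial (Fin 3) K} (hG : G.totalDegree = 1) :
    ∃ (a : K) (c : Fin 3 → K), ∀ x, eval x G = a + (c 0 * x 0 + c 1 * x 1 + c 2 * x 2) := by
  obtain ⟨c, hc⟩ := exists_linear_coeff (homogeneousComponent_isHomogeneous 1 G)
  refine ⟨coeff 0 G, c, fun x => ?_⟩
  conv_lhs => rw [← sum_homogeneousComponent G, hG]
  simp [Finset.sum_range_succ, hc, homogeneousComponent_zero]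

theorem one_le_totalDegree_of_not_isUnit {G : MvPolynomial (Fin 3) K} (h0 : G ≠ 0)
    (h : ¬ IsUnit G) : 1 ≤ G.totalDegree := by
  by_contra hd
  have := totalDegree_eq_zero_iff_eq_C.1 (by omega : G.totalDegree = 0)
  rw [this] at h h0
  refine h ((isUnit_iff_ne_zero.2 fun hc => h0 ?_).map C)
  rw [hc, C_0]

variable [CharZero K]

/-- A quadratic form with three zeros on a line vanishes on the line: its restriction to the line is
a multiple of the product of the coordinates with respect to `u`, `v`, and the third zero kills the
factor `polarForm c u v`. After completing `u`, `v` to a basis, the linear form of the line splits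
off. -/
theorem not_collinear_of_irreducible {F : MvPolynomial (Fin 3) K} (hF : F.IsHomogeneous 2)
    (hI : Irreducible F) {u v w : Fin 3 → K} (huv : LinearIndependent K ![u, v])
    (huw : LinearIndependent K ![u, w]) (hvw : LinearIndependent K ![v, w])
    (hu : eval u F = 0) (hv : eval v F = 0) (hw : eval w F = 0) : bracket u v w ≠ 0 := by
  intro h0
  obtain ⟨c, hc⟩ := exists_quad_coeff hF
  have hdep : ¬ LinearIndependent K ![u, v, w] := fun h => (bracket_ne_zero_iff u v w).2 h h0
  obtain ⟨g, hg, hne⟩ := Fintype.not_linearIndependent_iff.1 hdep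
  rw [Fin.sum_univ_three] at hg
  simp only [Matrix.cons_val] at hg
  rw [LinearIndependent.pair_iff] at huw hvw
  have hg0 : g 0 ≠ 0 := by
    intro h
    have := hvw (g 1) (g 2) (by simpa [h] using hg)
    obtain ⟨i, hi⟩ := hne
    exact hi (by fin_cases i; exacts [h, this.1, this.2])
  have hg1 : g 1 ≠ 0 := by
    intro h
    have := huw (g 0) (g 2) (by simpa [h] using hg)
    exact hg0 this.1
  have hpol : polarForm c u v = 0 := by
    have h1 : quad c (g 0 • u + g 1 • v + (0 : K) • w) = 0 := by
      have : g 0 • u + g 1 • v + (0 : K) • w = (-g 2) • w := by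
        rw [zero_smul, add_zero, neg_smul]
        exact eq_neg_of_add_eq_zero_left hg
      rw [this, quad_smul, ← hc, hw, mul_zero]
    have h2 := quad_combination c u v w ![g 0, g 1, 0]
    simp only [Matrix.cons_val] at h2
    rw [h1, ← hc u, ← hc v, hu, hv] at h2
    simpa [hg0, hg1] using h2
  obtain ⟨t, ht⟩ := exists_bracket_ne_zero huv
  have hfac : C (bracket u v t ^ 2) * F = coordForm u v t 2 *
      (C (quad c t) * coordForm u v t 2 + C (polarForm c v t) * coordForm u v t 1 +
        C (polarForm c t u) * coordForm u v t 0) := by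
    refine MvPolynomial.funext fun x => ?_
    have := bracket_sq_mul_quad c u v t x
    rw [← hc u, ← hc v, hu, hv, hpol] at this
    simp only [map_mul, map_add, eval_C, eval_coordForm, hc x, this, cremona, Matrix.cons_val]
    ring
  have hunit : IsUnit (C (bracket u v t ^ 2) : MvPolynomial (Fin 3) K) :=
    (isUnit_iff_ne_zero.2 (pow_ne_zero 2 ht)).map C
  have hI' : Irreducible (C (bracket u v t ^ 2) * F) := (irreducible_isUnit_mul hunit).2 hI
  rcases hI'.isUnit_or_isUnit hfac with h | h
  -- Neither factor is a unit: the first vanishes at `u`, the second at the origin.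
  · have := h.map (eval u)
    rw [eval_coordForm] at this
    simp [dualCoord, bracket] at this
    apply this; ring
  · have := h.map (eval 0)
    simp only [map_mul, map_add, eval_C, eval_coordForm] at this
    simp [dualCoord, bracket] at this

/-- A reducible quadratic form is a product of two linear forms, and one of the two lines would
contain three of the six points. -/
theorem irreducible_of_not_collinear {F : MvPolynomial (Fin 3) K} (hF : F.IsHomogeneous 2)
    (h0 : F ≠ 0) {v : Fin 6 → Fin 3 → K} (hv : ∀ i, eval (v i) F = 0)
    (hb : ∀ i j k, i < j → j < k → bracket (v i) (v j) (v k) ≠ 0) : Irreducible F := by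
  obtain ⟨c, hc⟩ := exists_quad_coeff hF
  constructor
  · intro h
    have := h.map (eval 0)
    rw [hc] at this
    simp [quad] at this
  · intro G H hGH
    by_contra! hn
    have hG0 : G ≠ 0 := by rintro rfl; simp_all
    have hH0 : H ≠ 0 := by rintro rfl; simp_all
    have hd := hF.totalDegree h0
    rw [hGH, totalDegree_mul_of_isDomain hG0 hH0] at hd
    have hG1 := one_le_totalDegree_of_not_isUnit hG0 hn.1
    have hH1 := one_le_totalDegree_of_not_isUnit hH0 hn.2
    obtain ⟨a, g, hg⟩ := exists_affine_coeff (by omega : G.totalDegree = 1)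
    obtain ⟨b, h, hh⟩ := exists_affine_coeff (by omega : H.totalDegree = 1)
    -- The factors of `F` are a priori only affine. Since `F` is even and vanishes at the origin,
    -- adding its values at `x` and `-x` removes the constant terms.
    have key : ∀ x, eval x F =
        (g 0 * x 0 + g 1 * x 1 + g 2 * x 2) * (h 0 * x 0 + h 1 * x 1 + h 2 * x 2) := by
      intro x
      have e1 : quad c x = eval x G * eval x H := by rw [← hc, hGH, map_mul]
      have e2 : quad c (-x) = eval (-x) G * eval (-x) H := by rw [← hc, hGH, map_mul]
      have e3 : quad c 0 = eval 0 G * eval 0 H := by rw [← hc, hGH, map_mul]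
      rw [hg, hh] at e1 e2 e3
      have e4 : quad c (-x) = quad c x := by simp [quad]
      rw [e4] at e2
      simp [quad] at e2 e3
      rw [hc]
      have : (2 : K) ≠ 0 := two_ne_zero
      apply mul_left_cancel₀ this
      have e3' : a * b = 0 := by simpa using e3
      simp only [quad] at e1 ⊢
      linear_combination e1 + e2 + 2 * e3'
    -- Pigeonhole: of six points sorted into those on the line of `g` and those off it, three fall
    -- into the same class. Points off the first line are on the second.
    have hpig : ∀ P : Fin 6 → Bool, ∃ i j k, i < j ∧ j < k ∧ P i = P j ∧ P j = P k := by decide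
    classical
    obtain ⟨i, j, k, hij, hjk, h1, h2⟩ :=
      hpig fun i => decide (g 0 * v i 0 + g 1 * v i 1 + g 2 * v i 2 = 0)
    simp only [decide_eq_decide] at h1 h2
    have fin : ∀ l : Fin 3 → K, (∀ x ∈ ({v i, v j, v k} : Set (Fin 3 → K)),
        l 0 * x 0 + l 1 * x 1 + l 2 * x 2 = 0) → l = 0 := by
      intro l hl
      by_contra hl0
      exact hb i j k hij hjk ((bracket_eq_zero_iff_exists _ _ _).2 ⟨l, hl0, hl⟩)
    by_cases hi : g 0 * v i 0 + g 1 * v i 1 + g 2 * v i 2 = 0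
    · have hj := h1.1 hi
      have hk := h2.1 hj
      have : g = 0 := fin g (by rintro x (rfl | rfl | rfl) <;> assumption)
      exact h0 (MvPolynomial.funext fun x => by rw [key, this]; simp)
    · have hj := fun h => hi (h1.2 h)
      have hk := fun h => hj (h2.2 h)
      have hz : ∀ m, g 0 * v m 0 + g 1 * v m 1 + g 2 * v m 2 ≠ 0 →
          h 0 * v m 0 + h 1 * v m 1 + h 2 * v m 2 = 0 := fun m hm =>
        (mul_eq_zero.1 ((key (v m)).symm.trans (hv m))).resolve_left hm
      have : h = 0 := fin h (by
        rintro x (rfl | rfl | rfl)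
        exacts [hz i hi, hz j hj, hz k hk])
      exact h0 (MvPolynomial.funext fun x => by rw [key, this]; simp)

/-- A quadric through the first three points amounts to a linear form in the Cremona image, so a
common quadric exists if and only if the Cremona images of the last three points are linearly
dependent. Irreducibility is equivalent to the absence of collinear triples by the two preceding
lemmas. -/
theorem exists_conic_iff {v : Fin 6 → Fin 3 → K}
    (hd : ∀ i j, i < j → LinearIndependent K ![v i, v j]) :
    (∃ F : MvPolynomial (Fin 3) K, F.IsHomogeneous 2 ∧ Irreducible F ∧ ∀ i, eval (v i) F = 0) ↔
      (∀ i j k, i < j → j < k → bracket (v i) (v j) (v k) ≠ 0) ∧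
        conicBracket (v 0) (v 1) (v 2) (v 3) (v 4) (v 5) = 0 := by
  constructor
  · rintro ⟨F, hF, hI, hv⟩
    have hb : ∀ i j k, i < j → j < k → bracket (v i) (v j) (v k) ≠ 0 := fun i j k hij hjk =>
      not_collinear_of_irreducible hF hI (hd i j hij) (hd i k (hij.trans hjk)) (hd j k hjk)
        (hv i) (hv j) (hv k)
    refine ⟨hb, ?_⟩
    obtain ⟨c, hc⟩ := exists_quad_coeff hF
    have hD : bracket (v 0) (v 1) (v 2) ≠ 0 := hb 0 1 2 (by decide) (by decide)
    have hq : ∀ i, quad c (v i) = 0 := fun i => by rw [← hc, hv]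
    have hx : ∀ x, bracket (v 0) (v 1) (v 2) ^ 2 * quad c x = _ :=
      bracket_sq_mul_quad c (v 0) (v 1) (v 2)
    simp only [hq, mul_zero, zero_add] at hx
    refine (bracket_eq_zero_iff_exists _ _ _).2 ⟨![polarForm c (v 1) (v 2),
      polarForm c (v 2) (v 0), polarForm c (v 0) (v 1)], ?_, ?_⟩
    · intro h
      have e0 := congrFun h 0
      have e1 := congrFun h 1
      have e2 := congrFun h 2
      simp only [Matrix.cons_val, Pi.zero_apply] at e0 e1 e2
      refine hI.ne_zero (MvPolynomial.funext fun x => ?_)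
      have := hx x
      rw [e0, e1, e2] at this
      rw [hc]
      simpa [hD] using this
    · rintro x (rfl | rfl | rfl)
      · have := hx (v 3)
        rw [hq] at this
        simp only [Matrix.cons_val]
        linear_combination -this
      · have := hx (v 4)
        rw [hq] at this
        simp only [Matrix.cons_val]
        linear_combination -this
      · have := hx (v 5)
        rw [hq] at this
        simp only [Matrix.cons_val]
        linear_combination -this
  · rintro ⟨hb, h0⟩
    obtain ⟨c, hc0, hc⟩ := (bracket_eq_zero_iff_exists _ _ _).1 h0
    have hD : bracket (v 0) (v 1) (v 2) ≠ 0 := hb 0 1 2 (by decide) (by decide)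
    set l := coordForm (v 0) (v 1) (v 2) with hl
    have hlh : ∀ i, (l i).IsHomogeneous 1 := isHomogeneous_coordForm _ _ _
    let F : MvPolynomial (Fin 3) K :=
      C (c 0) * (l 1 * l 2) + C (c 1) * (l 2 * l 0) + C (c 2) * (l 0 * l 1)
    have hFe : ∀ x, eval x F = c 0 * cremona (dualCoord (v 0) (v 1) (v 2) x) 0 +
        c 1 * cremona (dualCoord (v 0) (v 1) (v 2) x) 1 +
        c 2 * cremona (dualCoord (v 0) (v 1) (v 2) x) 2 := fun x => by
      simp [F, hl, eval_coordForm, cremona]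
    have hF : F.IsHomogeneous 2 := by
      refine IsHomogeneous.add (IsHomogeneous.add ?_ ?_) ?_ <;>
        exact ((hlh _).mul (hlh _)).C_mul _
    -- At the sum of two base points exactly one of the three products of coordinates survives,
    -- which isolates one coefficient.
    have hF0 : F ≠ 0 := by
      intro h
      have e0 := hFe (v 1 + v 2)
      have e1 := hFe (v 2 + v 0)
      have e2 := hFe (v 0 + v 1)
      have d : ∀ i, dualCoord (v 0) (v 1) (v 2) (v i) =
          ![bracket (v 1) (v 2) (v i), bracket (v 2) (v 0) (v i), bracket (v 0) (v 1) (v i)] :=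
        fun i => rfl
      rw [h, map_zero] at e0 e1 e2
      have c0 : c 0 * bracket (v 0) (v 1) (v 2) ^ 2 = 0 := by
        rw [e0]; simp [cremona, dualCoord, bracket]; ring
      have c1 : c 1 * bracket (v 0) (v 1) (v 2) ^ 2 = 0 := by
        rw [e1]; simp [cremona, dualCoord, bracket]; ring
      have c2 : c 2 * bracket (v 0) (v 1) (v 2) ^ 2 = 0 := by
        rw [e2]; simp [cremona, dualCoord, bracket]; ring
      simp only [mul_eq_zero, pow_eq_zero_iff, ne_eq, OfNat.ofNat_ne_zero, not_false_eq_true, hD,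
        or_false] at c0 c1 c2
      apply hc0
      ext i
      fin_cases i <;> assumption
    have hv : ∀ i, eval (v i) F = 0 := by
      intro i
      rw [hFe]
      fin_cases i
      · simp [cremona, dualCoord, bracket]; ring
      · simp [cremona, dualCoord, bracket]; ring
      · simp [cremona, dualCoord, bracket]; ring
      · exact hc _ (by simp)
      · exact hc _ (by simp)
      · exact hc _ (by simp)
    exact ⟨F, hF, irreducible_of_not_collinear hF hF0 hv hb, hv⟩

end
end Quatroid

/-! ### Homogeneous coordinates of configurations -/

namespace Quatroid
open MvPolynomial

section
variable {K : Type} [Field K]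

/-- The vectors `v i` are homogeneous coordinates of the points `p i`. -/
def IsCoord (v : Fin 8 → Fin 3 → K) (p : Config K) : Prop :=
  ∀ i, ∃ a : K, a ≠ 0 ∧ v i = a • (p i).rep

theorem isCoord_rep (p : Config K) : IsCoord (fun i => (p i).rep) p :=
  fun _ => ⟨1, one_ne_zero, (one_smul _ _).symm⟩

theorem exists_isCoord {v : Fin 8 → Fin 3 → K}
    (h : ∀ i j, i < j → LinearIndependent K ![v i, v j]) : ∃ p, IsCoord v p := by
  have h0 : ∀ i, v i ≠ 0 := by
    intro i
    by_cases hi : i = 0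
    · have := (h i 1 (by subst hi; decide)).ne_zero 0
      simpa using this
    · have := (h 0 i (Fin.pos_of_ne_zero hi)).ne_zero 1
      simpa using this
  have hne : ∀ i j, i < j →
      Projectivization.mk K (v i) (h0 i) ≠ Projectivization.mk K (v j) (h0 j) := fun i j hij =>
    (Projectivization.independent_pair_iff_ne _ _).1
      ((Projectivization.independent_mk_iff_LinearIndependent _ _).2 (h i j hij))
  refine ⟨⟨fun i => Projectivization.mk K (v i) (h0 i), fun i j hij => ?_⟩, fun i => ?_⟩
  · rcases lt_trichotomy i j with hlt | rfl | hlt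
    · exact (hne i j hlt hij).elim
    · rfl
    · exact (hne j i hlt hij.symm).elim
  · obtain ⟨a, ha⟩ := Projectivization.exists_smul_eq_mk_rep K (v i) (h0 i)
    refine ⟨((a⁻¹ : Kˣ) : K), (a⁻¹).ne_zero, ?_⟩
    change v i = ((a⁻¹ : Kˣ) : K) • (Projectivization.mk K (v i) (h0 i)).rep
    rw [← ha]
    change v i = a⁻¹ • a • v i
    rw [inv_smul_smul]

theorem linearIndependent_rep {p : Config K} {i j : Fin 8} (h : i ≠ j) :
    LinearIndependent K ![(p i).rep, (p j).rep] := by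
  rw [← Projectivization.independent_mk_iff_LinearIndependent (Projectivization.rep_nonzero _)
    (Projectivization.rep_nonzero _), Projectivization.mk_rep, Projectivization.mk_rep,
    Projectivization.independent_pair_iff_ne]
  exact fun h' => h (p.injective h')

theorem lineThrough_iff {v : Fin 8 → Fin 3 → K} {p : Config K} (hv : IsCoord v p)
    (i j k : Fin 8) : LineThrough p {i, j, k} ↔ bracket (v i) (v j) (v k) = 0 := by
  obtain ⟨a, ha, hi⟩ := hv i
  obtain ⟨b, hb, hj⟩ := hv j
  obtain ⟨c, hc, hk⟩ := hv k
  rw [hi, hj, hk, bracket_smul, LineThrough]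
  have : p '' (({i, j, k} : Finset (Fin 8)) : Set (Fin 8)) = {p i, p j, p k} := by
    simp [Set.image_insert_eq]
  rw [this, collinear_iff_bracket]
  simp [ha, hb, hc]

/-- The condition on triples cannot be dropped: `conicBracket` also vanishes when the six points lie
on a pair of lines. -/
theorem conicThrough_iff [CharZero K] {v : Fin 8 → Fin 3 → K} {p : Config K} (hv : IsCoord v p)
    {s : Fin 6 → Fin 8} (hs : Function.Injective s) :
    ConicThrough p (Finset.univ.image s) ↔
      (∀ i j k, i < j → j < k → ¬ LineThrough p {s i, s j, s k}) ∧
        conicBracket (v (s 0)) (v (s 1)) (v (s 2)) (v (s 3)) (v (s 4)) (v (s 5)) = 0 := by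
  have h1 : ConicThrough p (Finset.univ.image s) ↔ ∃ F : MvPolynomial (Fin 3) K,
      F.IsHomogeneous 2 ∧ Irreducible F ∧ ∀ i, eval (p (s i)).rep F = 0 := by
    simp [ConicThrough, OnConic]
  rw [h1, exists_conic_iff (v := fun i => (p (s i)).rep)
    fun i j hij => linearIndependent_rep (hs.ne hij.ne)]
  refine and_congr ?_ ?_
  · simp only [lineThrough_iff (isCoord_rep p), ne_eq]
  · obtain ⟨a, ha, e0⟩ := hv (s 0)
    obtain ⟨b, hb, e1⟩ := hv (s 1)
    obtain ⟨c, hc, e2⟩ := hv (s 2)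
    obtain ⟨d, hd, e3⟩ := hv (s 3)
    obtain ⟨e, he, e4⟩ := hv (s 4)
    obtain ⟨f, hf, e5⟩ := hv (s 5)
    rw [e0, e1, e2, e3, e4, e5, conicBracket_smul]
    simp [ha, hb, hc, hd, he, hf]

end
end Quatroid

/-! ### Relabelling and the necessity of the weak criteria -/

namespace Quatroid
open MvPolynomial

section
variable {K : Type} [Field K]

/-- The composite sends the label `i` to `p (σ i)`, so label sets are moved by `σ` itself rather
than by its inverse. -/
theorem lineThrough_relabel (σ : Equiv.Perm (Fin 8)) (p : Config K) (I : Finset (Fin 8)) :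
    LineThrough (σ.toEmbedding.trans p) I ↔ LineThrough p (σ • I) := by
  unfold LineThrough
  rw [Finset.coe_smul_finset, ← Set.image_smul, Set.image_image]
  rfl

theorem conicThrough_relabel (σ : Equiv.Perm (Fin 8)) (p : Config K) (J : Finset (Fin 8)) :
    ConicThrough (σ.toEmbedding.trans p) J ↔ ConicThrough p (σ • J) := by
  unfold ConicThrough
  rw [Finset.coe_smul_finset, ← Set.image_smul, Set.image_image]
  rfl

theorem forall_card_smul_iff (σ : Equiv.Perm (Fin 8)) (n : ℕ) (S : Finset (Finset (Fin 8)))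
    (P : Finset (Fin 8) → Prop) :
    (∀ I : Finset (Fin 8), I.card = n → (I ∈ σ • S ↔ P I)) ↔
      ∀ I : Finset (Fin 8), I.card = n → (I ∈ S ↔ P (σ • I)) := by
  constructor
  · intro h I hI
    rw [← h (σ • I) (by rwa [Finset.card_smul_finset]), Finset.smul_mem_smul_finset_iff]
  · intro h I hI
    have := h (σ⁻¹ • I) (by rwa [Finset.card_smul_finset])
    rwa [smul_inv_smul, Finset.inv_smul_mem_iff] at this

theorem isPair_smul_iff (σ : Equiv.Perm (Fin 8)) (Q : Pair) : IsPair (σ • Q) ↔ IsPair Q := by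
  simp only [IsPair, Prod.smul_fst, Prod.smul_snd, Finset.mem_smul_finset, forall_exists_index,
    and_imp, forall_apply_eq_imp_iff₂, Finset.card_smul_finset]

theorem represents_relabel (σ : Equiv.Perm (Fin 8)) (p : Config K) (Q : Pair) :
    Represents (σ.toEmbedding.trans p) Q ↔ Represents p (σ • Q) := by
  simp only [Represents, isPair_smul_iff, Prod.smul_fst, Prod.smul_snd, forall_card_smul_iff,
    lineThrough_relabel, conicThrough_relabel]

theorem representable_smul_iff (σ : Equiv.Perm (Fin 8)) (Q : Pair) :
    Representable K (σ • Q) ↔ Representable K Q := by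
  constructor
  · rintro ⟨p, hp⟩
    exact ⟨_, (represents_relabel σ p Q).2 hp⟩
  · rintro ⟨p, hp⟩
    refine ⟨(σ⁻¹).toEmbedding.trans p, (represents_relabel _ _ _).2 ?_⟩
    rwa [inv_smul_smul]

theorem matroidal_smul_iff (σ : Equiv.Perm (Fin 8)) (Q : Pair) :
    Matroidal (σ • Q) ↔ Matroidal Q := by
  have key : ∀ (τ : Equiv.Perm (Fin 8)) (P : Pair), Matroidal (τ • P) → Matroidal P := by
    rintro τ P ⟨p, hp⟩
    refine ⟨τ.toEmbedding.trans p, ?_⟩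
    simp only [lineThrough_relabel]
    rw [Prod.smul_fst, forall_card_smul_iff] at hp
    exact hp
  exact ⟨key σ Q, fun h => key σ⁻¹ _ (by rwa [inv_smul_smul])⟩

theorem Representable.isPair {Q : Pair} : Representable K Q → IsPair Q :=
  fun ⟨_, h⟩ => h.1

theorem Representable.matroidal {Q : Pair} : Representable ℂ Q → Matroidal Q :=
  fun ⟨p, h⟩ => ⟨p, h.2.1⟩

/-- If `x, y, z` all lie on the line through two distinct points, then they are collinear. -/
theorem bracket_eq_zero_of_line {a b x y z : Fin 3 → K} (hab : LinearIndependent K ![a, b])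
    (hx : bracket a b x = 0) (hy : bracket a b y = 0) (hz : bracket a b z = 0) :
    bracket x y z = 0 := by
  refine (bracket_eq_zero_iff_exists _ _ _).2 ⟨![a 1 * b 2 - a 2 * b 1, a 2 * b 0 - a 0 * b 2,
    a 0 * b 1 - a 1 * b 0], ?_, ?_⟩
  · intro h
    obtain ⟨w, hw⟩ := exists_bracket_ne_zero hab
    have h0 := congrFun h 0
    have h1 := congrFun h 1
    have h2 := congrFun h 2
    simp only [Matrix.cons_val, Pi.zero_apply] at h0 h1 h2
    apply hw
    simp only [bracket]
    linear_combination w 0 * h0 + w 1 * h1 + w 2 * h2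
  · simp only [bracket] at hx hy hz
    rintro w (rfl | rfl | rfl)
    · simp only [Matrix.cons_val]; linear_combination hx
    · simp only [Matrix.cons_val]; linear_combination hy
    · simp only [Matrix.cons_val]; linear_combination hz

/-- Two shared labels give two distinct points, and these already determine the line of either
triple. -/
theorem lineThrough_of_union {p : Config K} {I₁ I₂ : Finset (Fin 8)} (c₁ : I₁.card = 3)
    (c₂ : I₂.card = 3) (h₁ : LineThrough p I₁) (h₂ : LineThrough p I₂)
    (h : 1 < (I₁ ∩ I₂).card) {I : Finset (Fin 8)} (hI : I ⊆ I₁ ∪ I₂) (c : I.card = 3) :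
    LineThrough p I := by
  obtain ⟨a, ha, b, hb, hab⟩ := Finset.one_lt_card.1 h
  rw [Finset.mem_inter] at ha hb
  have key : ∀ S : Finset (Fin 8), S.card = 3 → LineThrough p S → a ∈ S → b ∈ S → ∀ x ∈ S,
      bracket (p a).rep (p b).rep (p x).rep = 0 := by
    intro S cS hS haS hbS x hx
    by_cases hxa : x = a
    · subst hxa; simp [bracket]; ring
    by_cases hxb : x = b
    · subst hxb; simp [bracket]; ring
    have : S = {a, b, x} := by
      refine (Finset.eq_of_subset_of_card_le ?_ ?_).symm
      · intro y hy
        simp only [Finset.mem_insert, Finset.mem_singleton] at hy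
        rcases hy with rfl | rfl | rfl <;> assumption
      · rw [cS, Finset.card_eq_three.2 ⟨a, b, x, hab, Ne.symm hxa, Ne.symm hxb, rfl⟩]
    rw [this] at hS
    exact (lineThrough_iff (isCoord_rep p) a b x).1 hS
  have hz : ∀ x ∈ I, bracket (p a).rep (p b).rep (p x).rep = 0 := fun x hx => by
    rcases Finset.mem_union.1 (hI hx) with h | h
    · exact key I₁ c₁ h₁ ha.1 hb.1 x h
    · exact key I₂ c₂ h₂ ha.2 hb.2 x h
  obtain ⟨x, y, z, -, -, -, rfl⟩ := Finset.card_eq_three.1 c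
  rw [lineThrough_iff (isCoord_rep p)]
  exact bracket_eq_zero_of_line (linearIndependent_rep hab) (hz x (by simp)) (hz y (by simp))
    (hz z (by simp))

variable [CharZero K]

theorem not_lineThrough_of_conicThrough {p : Config K} {J : Finset (Fin 8)}
    (h : ConicThrough p J) {i j k : Fin 8} (hi : i ∈ J) (hj : j ∈ J) (hk : k ∈ J) (hij : i ≠ j)
    (hik : i ≠ k) (hjk : j ≠ k) : ¬ LineThrough p {i, j, k} := by
  obtain ⟨F, hF, hI, hv⟩ := h
  have hz : ∀ m ∈ J, eval (p m).rep F = 0 := fun m hm => hv _ ⟨m, hm, rfl⟩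
  rw [lineThrough_iff (isCoord_rep p)]
  exact not_collinear_of_irreducible hF hI (linearIndependent_rep hij) (linearIndependent_rep hik)
    (linearIndependent_rep hjk) (hz i hi) (hz j hj) (hz k hk)

/-- An irreducible conic is determined by five of its points. -/
theorem eval_eq_zero_iff_conicBracket {F : MvPolynomial (Fin 3) K} (hF : F.IsHomogeneous 2)
    (hI : Irreducible F) {v : Fin 5 → Fin 3 → K} (hv : ∀ i, eval (v i) F = 0)
    (hb : ∀ i j k, i < j → j < k → bracket (v i) (v j) (v k) ≠ 0) (x : Fin 3 → K) :
    eval x F = 0 ↔ conicBracket (v 0) (v 1) (v 2) (v 3) (v 4) x = 0 := by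
  obtain ⟨c, hc⟩ := exists_quad_coeff hF
  have hD : bracket (v 0) (v 1) (v 2) ≠ 0 := hb 0 1 2 (by decide) (by decide)
  have hq : ∀ i, quad c (v i) = 0 := fun i => by rw [← hc, hv]
  have hx : ∀ x, bracket (v 0) (v 1) (v 2) ^ 2 * quad c x = _ :=
    bracket_sq_mul_quad c (v 0) (v 1) (v 2)
  simp only [hq, mul_zero, zero_add] at hx
  have h3 := hx (v 3)
  have h4 := hx (v 4)
  have hX := hx x
  rw [hq, mul_zero] at h3 h4
  set A := cremona (dualCoord (v 0) (v 1) (v 2) (v 3)) with hA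
  set B := cremona (dualCoord (v 0) (v 1) (v 2) (v 4)) with hB
  set Y := cremona (dualCoord (v 0) (v 1) (v 2) x) with hY
  -- The Cremona images `A`, `B` of the fourth and fifth point are independent: by a
  -- Grassmann–Plücker relation this minor is, up to sign, a product of brackets of the five points.
  have hn : A 1 * B 2 - A 2 * B 1 ≠ 0 := by
    have : A 1 * B 2 - A 2 * B 1 = - (bracket (v 1) (v 2) (v 3) * bracket (v 1) (v 2) (v 4) *
        (bracket (v 0) (v 1) (v 2) * bracket (v 0) (v 3) (v 4))) := by
      have pl : bracket (v 0) (v 1) (v 2) * bracket (v 0) (v 3) (v 4) =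
          bracket (v 2) (v 0) (v 3) * bracket (v 0) (v 1) (v 4) -
            bracket (v 0) (v 1) (v 3) * bracket (v 2) (v 0) (v 4) := by
        simp only [bracket]; ring
      rw [pl, hA, hB]
      simp [cremona, dualCoord]
      ring
    rw [this]
    exact neg_ne_zero.2 (mul_ne_zero (mul_ne_zero (hb 1 2 3 (by decide) (by decide))
      (hb 1 2 4 (by decide) (by decide))) (mul_ne_zero hD (hb 0 3 4 (by decide) (by decide))))
  set a := polarForm c (v 1) (v 2)
  set b := polarForm c (v 2) (v 0)
  set d := polarForm c (v 0) (v 1)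
  -- The coefficient vector `(a, b, d)` is orthogonal to `A` and `B`, hence proportional to their
  -- cross product. Therefore the value of `F` at `x` is a nonzero multiple of the determinant of
  -- `A`, `B`, `Y`, which is `conicBracket`.
  have e1 : (A 1 * B 2 - A 2 * B 1) * b = (A 2 * B 0 - A 0 * B 2) * a := by
    linear_combination B 2 * h3.symm - A 2 * h4.symm
  have e2 : (A 1 * B 2 - A 2 * B 1) * d = (A 0 * B 1 - A 1 * B 0) * a := by
    linear_combination A 1 * h4.symm - B 1 * h3.symm
  have key : (A 1 * B 2 - A 2 * B 1) * (bracket (v 0) (v 1) (v 2) ^ 2 * eval x F) =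
      a * conicBracket (v 0) (v 1) (v 2) (v 3) (v 4) x := by
    rw [hc, hX, conicBracket, ← hA, ← hB, ← hY, bracket]
    linear_combination Y 1 * e1 + Y 2 * e2
  have ha : a ≠ 0 := by
    intro ha
    rw [ha, mul_zero, mul_eq_zero, or_iff_right hn] at e1 e2
    refine hI.ne_zero (MvPolynomial.funext fun y => ?_)
    have := hx y
    rw [ha, e1, e2] at this
    rw [hc]
    simpa [hD] using this
  constructor
  · intro h
    rw [h] at key
    simpa [ha] using key.symm
  · intro h
    rw [h] at key
    simpa [hn, hD] using key

/-- Five common points, no three of them collinear, determine the zero locus, so either conic passes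
through all the points of the other. -/
theorem conicThrough_union {p : Config K} {J₁ J₂ : Finset (Fin 8)} (h₁ : ConicThrough p J₁)
    (h₂ : ConicThrough p J₂) (h : 4 < (J₁ ∩ J₂).card) : ConicThrough p (J₁ ∪ J₂) := by
  obtain ⟨T, hT, hcard⟩ := Finset.exists_subset_card_eq (Nat.succ_le_of_lt h)
  let s := T.orderEmbOfFin hcard
  have hs : ∀ i, s i ∈ J₁ ∧ s i ∈ J₂ := fun i =>
    Finset.mem_inter.1 (hT (T.orderEmbOfFin_mem hcard i))
  have hb : ∀ i j k, i < j → j < k →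
      bracket (p (s i)).rep (p (s j)).rep (p (s k)).rep ≠ 0 := by
    intro i j k hij hjk
    have := not_lineThrough_of_conicThrough h₁ (hs i).1 (hs j).1 (hs k).1
      (s.injective.ne hij.ne) (s.injective.ne (hij.trans hjk).ne) (s.injective.ne hjk.ne)
    rwa [lineThrough_iff (isCoord_rep p)] at this
  obtain ⟨F, hF, hI, hv⟩ := h₁
  obtain ⟨G, hG, hI', hv'⟩ := h₂
  refine ⟨F, hF, hI, ?_⟩
  rintro _ ⟨i, hi, rfl⟩
  rcases Finset.mem_union.1 (Finset.mem_coe.1 hi) with hi | hi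
  · exact hv _ ⟨i, hi, rfl⟩
  · rw [eval_eq_zero_iff_conicBracket hF hI (v := fun i => (p (s i)).rep)
      (fun i => hv _ ⟨_, (hs i).1, rfl⟩) hb,
      ← eval_eq_zero_iff_conicBracket hG hI' (v := fun i => (p (s i)).rep)
      (fun i => hv' _ ⟨_, (hs i).2, rfl⟩) hb]
    exact hv' _ ⟨i, hi, rfl⟩

theorem Representable.weakCriteria {Q : Pair} : Representable K Q → WeakCriteria Q := by
  rintro ⟨p, ⟨h3, h6⟩, hL, hC⟩
  refine ⟨fun I hI J hJ => ?_, fun I₁ hI₁ I₂ hI₂ h I hI c => ?_, fun J₁ hJ₁ J₂ hJ₂ h J hJ c => ?_⟩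
  · by_contra hcon
    have hcard : (I ∩ J).card = I.card := le_antisymm (Finset.card_le_card Finset.inter_subset_left)
      (by rw [h3 I hI]; omega)
    have hsub : I ⊆ J := by
      rw [← Finset.eq_of_subset_of_card_le Finset.inter_subset_left hcard.ge]
      exact Finset.inter_subset_right
    have hline := (hL I (h3 I hI)).1 hI
    have hconic := (hC J (h6 J hJ)).1 hJ
    obtain ⟨x, y, z, hxy, hxz, hyz, rfl⟩ := Finset.card_eq_three.1 (h3 I hI)
    exact not_lineThrough_of_conicThrough hconic (hsub (by simp)) (hsub (by simp))
      (hsub (by simp)) hxy hxz hyz hline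
  · exact (hL I c).2 (lineThrough_of_union (h3 _ hI₁) (h3 _ hI₂) ((hL _ (h3 _ hI₁)).1 hI₁)
      ((hL _ (h3 _ hI₂)).1 hI₂) h hI c)
  · obtain ⟨F, hF, hI, hv⟩ := conicThrough_union ((hC _ (h6 _ hJ₁)).1 hJ₁)
      ((hC _ (h6 _ hJ₂)).1 hJ₂) h
    exact (hC J c).2 ⟨F, hF, hI, fun P hP =>
      hv P (Set.image_mono (Finset.coe_subset.2 hJ) hP)⟩

theorem Representable.mem_candidates {Q : Pair} (h : Representable ℂ Q) : Q ∈ candidates :=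
  ⟨h.isPair, h.matroidal, h.weakCriteria⟩

end
end Quatroid

/-! ### Obstructions to representability: Fano, Möbius–Kantor, and a quadrilateral with three conics
-/

namespace Quatroid
open MvPolynomial

section
variable {K : Type} [Field K]

/-- Passing to coordinates in the basis `u, v, w` is multiplication by the adjugate of a 3 × 3
matrix, whose determinant is the square of the original one. -/
theorem bracket_dualCoord {R : Type*} [CommRing R] (u v w x y z : Fin 3 → R) :
    bracket (dualCoord u v w x) (dualCoord u v w y) (dualCoord u v w z) =
      bracket u v w ^ 2 * bracket x y z := by
  simp only [bracket, dualCoord, Matrix.cons_val]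
  ring

theorem bracket_swap_left {R : Type*} [CommRing R] (u v w : Fin 3 → R) :
    bracket v u w = -bracket u v w := by
  simp only [bracket]; ring

theorem bracket_swap_right {R : Type*} [CommRing R] (u v w : Fin 3 → R) :
    bracket u w v = -bracket u v w := by
  simp only [bracket]; ring

/-- A Grassmann–Plücker relation. -/
theorem bracket_mul_bracket {R : Type*} [CommRing R] (u v w x y : Fin 3 → R) :
    bracket u v w * bracket u x y =
      bracket w u x * bracket u v y - bracket u v x * bracket w u y := by
  simp only [bracket]; ring

/-- The Fano plane is not representable outside characteristic two. -/
theorem not_fano [CharZero K] (v : Fin 8 → Fin 3 → K)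
    (h012 : bracket (v 0) (v 1) (v 2) = 0) (h034 : bracket (v 0) (v 3) (v 4) = 0)
    (h135 : bracket (v 1) (v 3) (v 5) = 0) (h245 : bracket (v 2) (v 4) (v 5) = 0)
    (h236 : bracket (v 2) (v 3) (v 6) = 0) (h146 : bracket (v 1) (v 4) (v 6) = 0)
    (h056 : bracket (v 0) (v 5) (v 6) = 0) (h123 : bracket (v 1) (v 2) (v 3) ≠ 0)
    (h014 : bracket (v 0) (v 1) (v 4) ≠ 0) (h035 : bracket (v 0) (v 3) (v 5) ≠ 0)
    (h136 : bracket (v 1) (v 3) (v 6) ≠ 0) (h036 : bracket (v 0) (v 3) (v 6) ≠ 0)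
    (h016 : bracket (v 0) (v 1) (v 6) ≠ 0) : False := by
  -- All points are expressed in the basis `0, 1, 3`. A line through a base point becomes a two by
  -- two minor; the line `245`, which avoids the base points, remains a full determinant.
  have e236 := bracket_mul_bracket (v 3) (v 0) (v 1) (v 2) (v 6)
  have e146 := bracket_mul_bracket (v 1) (v 3) (v 0) (v 4) (v 6)
  have e056 := bracket_mul_bracket (v 0) (v 1) (v 3) (v 5) (v 6)
  have e245 := bracket_dualCoord (v 0) (v 1) (v 3) (v 2) (v 4) (v 5)
  have h034' : bracket (v 3) (v 0) (v 4) = 0 := by rw [bracket_swap_left, h034, neg_zero]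
  have h132 : bracket (v 1) (v 3) (v 2) ≠ 0 := by rwa [bracket_swap_right, neg_ne_zero]
  have h305 : bracket (v 3) (v 0) (v 5) ≠ 0 := by rwa [bracket_swap_left, neg_ne_zero]
  have h306 : bracket (v 3) (v 0) (v 6) ≠ 0 := by rwa [bracket_swap_left, neg_ne_zero]
  rw [bracket_swap_left (v 2) (v 3) (v 6), h236, neg_zero, mul_zero] at e236
  rw [h146, mul_zero] at e146
  rw [h056, mul_zero] at e056
  rw [h245, mul_zero, bracket] at e245
  simp only [dualCoord, Matrix.cons_val, h012, h034', h135] at e245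
  -- The three lines through the point `6` make the two terms of the determinant for `245` equal (a
  -- Ceva relation), where collinearity wants them opposite (Menelaus). Hence the factor 2.
  have : 2 * (bracket (v 1) (v 3) (v 2) * bracket (v 0) (v 1) (v 4) * bracket (v 3) (v 0) (v 5) *
      bracket (v 1) (v 3) (v 6) * bracket (v 3) (v 0) (v 6) * bracket (v 0) (v 1) (v 6)) = 0 := by
    generalize bracket (v 1) (v 3) (v 2) = a, bracket (v 3) (v 0) (v 2) = b,
      bracket (v 1) (v 3) (v 4) = c, bracket (v 0) (v 1) (v 4) = d, bracket (v 3) (v 0) (v 5) = e,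
      bracket (v 0) (v 1) (v 5) = f, bracket (v 1) (v 3) (v 6) = x, bracket (v 3) (v 0) (v 6) = y,
      bracket (v 0) (v 1) (v 6) = z at *
    grind
  simp [h132, h014, h305, h136, h306, h016] at this

/-- The Möbius–Kantor configuration yields a primitive sixth root of unity. -/
theorem not_moebiusKantor (hK : ∀ r : K, r ^ 2 - r + 1 ≠ 0) (v : Fin 8 → Fin 3 → K)
    (h012 : bracket (v 0) (v 1) (v 2) = 0) (h034 : bracket (v 0) (v 3) (v 4) = 0)
    (h135 : bracket (v 1) (v 3) (v 5) = 0) (h236 : bracket (v 2) (v 3) (v 6) = 0)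
    (h456 : bracket (v 4) (v 5) (v 6) = 0) (h147 : bracket (v 1) (v 4) (v 7) = 0)
    (h257 : bracket (v 2) (v 5) (v 7) = 0) (h067 : bracket (v 0) (v 6) (v 7) = 0)
    (h123 : bracket (v 1) (v 2) (v 3) ≠ 0) (h014 : bracket (v 0) (v 1) (v 4) ≠ 0)
    (h035 : bracket (v 0) (v 3) (v 5) ≠ 0) (h136 : bracket (v 1) (v 3) (v 6) ≠ 0)
    (h017 : bracket (v 0) (v 1) (v 7) ≠ 0) : False := by
  have e236 := bracket_mul_bracket (v 3) (v 0) (v 1) (v 2) (v 6)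
  have e147 := bracket_mul_bracket (v 1) (v 3) (v 0) (v 4) (v 7)
  have e067 := bracket_mul_bracket (v 0) (v 1) (v 3) (v 6) (v 7)
  have e257 := bracket_dualCoord (v 0) (v 1) (v 3) (v 2) (v 5) (v 7)
  have e456 := bracket_dualCoord (v 0) (v 1) (v 3) (v 4) (v 5) (v 6)
  have h034' : bracket (v 3) (v 0) (v 4) = 0 := by rw [bracket_swap_left, h034, neg_zero]
  have h132 : bracket (v 1) (v 3) (v 2) ≠ 0 := by rwa [bracket_swap_right, neg_ne_zero]
  have h305 : bracket (v 3) (v 0) (v 5) ≠ 0 := by rwa [bracket_swap_left, neg_ne_zero]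
  rw [bracket_swap_left (v 2) (v 3) (v 6), h236, neg_zero, mul_zero] at e236
  rw [h147, mul_zero] at e147
  rw [h067, mul_zero] at e067
  rw [h257, mul_zero, bracket] at e257
  rw [h456, mul_zero, bracket] at e456
  simp only [dualCoord, Matrix.cons_val, h012, h034', h135] at e257 e456
  generalize bracket (v 1) (v 3) (v 2) = a, bracket (v 3) (v 0) (v 2) = b,
    bracket (v 1) (v 3) (v 4) = c, bracket (v 0) (v 1) (v 4) = d, bracket (v 3) (v 0) (v 5) = e,
    bracket (v 0) (v 1) (v 5) = f, bracket (v 1) (v 3) (v 6) = x, bracket (v 3) (v 0) (v 6) = y,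
    bracket (v 0) (v 1) (v 6) = z, bracket (v 1) (v 3) (v 7) = X, bracket (v 3) (v 0) (v 7) = Y,
    bracket (v 0) (v 1) (v 7) = Z at *
  have hdx : d * x ≠ 0 := mul_ne_zero h014 h136
  -- In the basis `0, 1, 3`, the line `456` gives `k1`, and the line `257`, after elimination of the
  -- point `7`, gives `k2`. Eliminating `f * y` leaves the equation `r ^ 2 - r + 1 = 0` for `r = c *
  -- z / (d * x)`.
  have k1 : c * f * y = e * (c * z - d * x) := by linear_combination -e456
  have k2 : x * (e * z * d) = f * y * (d * x - c * z) := by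
    have : a * Z * (x * (e * z * d)) = a * Z * (f * y * (d * x - c * z)) := by
      linear_combination d * x * z * e257 + f * a * x * d * e067 + f * z * x * b * e147 +
        (-(f * z * Z * c)) * e236
    exact mul_left_cancel₀ (mul_ne_zero h132 h017) this
  apply hK (c * z / (d * x))
  have k3 : (c * z) ^ 2 - (c * z) * (d * x) + (d * x) ^ 2 = 0 := by
    apply mul_left_cancel₀ h305
    linear_combination c * k2 + (d * x - c * z) * k1
  field_simp
  linear_combination k3

/-- The common algebraic core of the three conic conditions below. -/
theorem conic_pencil {α l m n x y z X Y Z p q r s : K} (hα : α ≠ 0)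
    (h1 : α * p + m * q = 0) (h2 : α * r + n * s = 0)
    (h6 : α * x ^ 2 + l * (y * z) + m * (z * x) + n * (x * y) = 0)
    (h7 : α * X ^ 2 + l * (Y * Z) + m * (Z * X) + n * (X * Y) = 0) :
    Y * Z * x * (q * s * x - r * q * y - p * s * z) =
      y * z * X * (q * s * X - r * q * Y - p * s * Z) := by
  apply mul_left_cancel₀ hα
  linear_combination q * s * Y * Z * h6 - q * s * y * z * h7 - s * z * Z * (Y * x - y * X) * h1 -
    q * y * Y * (Z * x - z * X) * h2

/-- A conic through two base points, in the coordinates of a basis. -/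
theorem exists_conic_coeff [CharZero K] {p : Config K} {J : Finset (Fin 8)}
    (h : ConicThrough p J) {a b c : Fin 8} (hb : b ∈ J) (hc : c ∈ J)
    (hD : bracket (p a).rep (p b).rep (p c).rep ≠ 0) :
    ∃ α l m n : K, ¬ (α = 0 ∧ l = 0 ∧ m = 0 ∧ n = 0) ∧ ∀ i ∈ J, ∀ x y z : K,
      bracket (p b).rep (p c).rep (p i).rep = x → bracket (p c).rep (p a).rep (p i).rep = y →
      bracket (p a).rep (p b).rep (p i).rep = z →
      α * x ^ 2 + l * (y * z) + m * (z * x) + n * (x * y) = 0 := by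
  obtain ⟨F, hF, hI, hv⟩ := h
  obtain ⟨q, hq⟩ := exists_quad_coeff hF
  have hz : ∀ i ∈ J, quad q (p i).rep = 0 := fun i hi => by rw [← hq]; exact hv _ ⟨i, hi, rfl⟩
  have hx : ∀ x, bracket (p a).rep (p b).rep (p c).rep ^ 2 * quad q x = _ :=
    bracket_sq_mul_quad q (p a).rep (p b).rep (p c).rep
  rw [hz b hb, hz c hc] at hx
  refine ⟨quad q (p a).rep, polarForm q (p b).rep (p c).rep, polarForm q (p c).rep (p a).rep,
    polarForm q (p a).rep (p b).rep, ?_, ?_⟩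
  · rintro ⟨h0, h1, h2, h3⟩
    rw [h0, h1, h2, h3] at hx
    refine hI.ne_zero (MvPolynomial.funext fun y => ?_)
    rw [hq]
    simpa [hD] using hx y
  · rintro i hi x y z rfl rfl rfl
    have := hx (p i).rep
    rw [hz i hi] at this
    simp only [cremona, dualCoord, Matrix.cons_val] at this
    linear_combination -this

/-- `exists_conic_coeff` with the conclusion of `conic_pencil`. -/
theorem conic_pencil_of_conicThrough [CharZero K] {p : Config K} {J : Finset (Fin 8)}
    (h : ConicThrough p J) {a b c d e f g : Fin 8} (hb : b ∈ J) (hc : c ∈ J) (hd : d ∈ J)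
    (he : e ∈ J) (hf : f ∈ J) (hg : g ∈ J)
    (hD : bracket (p a).rep (p b).rep (p c).rep ≠ 0) {r s t w x y z X Y Z : K}
    (d0 : bracket (p b).rep (p c).rep (p d).rep = r)
    (d1 : bracket (p c).rep (p a).rep (p d).rep = 0)
    (d2 : bracket (p a).rep (p b).rep (p d).rep = s)
    (e0 : bracket (p b).rep (p c).rep (p e).rep = t)
    (e1 : bracket (p c).rep (p a).rep (p e).rep = w)
    (e2 : bracket (p a).rep (p b).rep (p e).rep = 0)
    (f0 : bracket (p b).rep (p c).rep (p f).rep = x)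
    (f1 : bracket (p c).rep (p a).rep (p f).rep = y)
    (f2 : bracket (p a).rep (p b).rep (p f).rep = z)
    (g0 : bracket (p b).rep (p c).rep (p g).rep = X)
    (g1 : bracket (p c).rep (p a).rep (p g).rep = Y)
    (g2 : bracket (p a).rep (p b).rep (p g).rep = Z)
    (hr : r ≠ 0) (hs : s ≠ 0) (ht : t ≠ 0) (hw : w ≠ 0) (hy : y ≠ 0) (hz : z ≠ 0) :
    Y * Z * x * (s * w * x - t * s * y - r * w * z) =
      y * z * X * (s * w * X - t * s * Y - r * w * Z) := by
  obtain ⟨α, l, m, n, hne, H⟩ := exists_conic_coeff h hb hc hD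
  -- The point `d` lies on the side `ca` of the reference triangle, so only two terms of the conic
  -- survive there and a factor `r` cancels. The same happens for `e` on the side `ab`.
  have k1 : α * r + m * s = 0 := by
    have := H d hd _ _ _ d0 d1 d2
    apply mul_left_cancel₀ hr
    linear_combination this
  have k2 : α * t + n * w = 0 := by
    have := H e he _ _ _ e0 e1 e2
    apply mul_left_cancel₀ ht
    linear_combination this
  have k6 := H f hf _ _ _ f0 f1 f2
  -- If `α` vanished, the points `d` and `e` would force `m = n = 0`, and then `f` would force `l =
  -- 0`.
  refine conic_pencil (fun hα => hne ⟨hα, ?_⟩) k1 k2 k6 (H g hg _ _ _ g0 g1 g2)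
  subst hα
  have hm : m = 0 := by simpa [hs] using k1
  have hn : n = 0 := by simpa [hw] using k2
  subst hm hn
  exact ⟨by simpa [hy, hz] using k6, rfl, rfl⟩

/-- Coordinates refer to the triangle `5, 4, 3`; `(x, y, z)` and `(X, Y, Z)` are the points `6` and
`7`. The hypothesis `hrel` is Menelaus' relation for `0, 1, 2`. It makes the linear forms in `E1`,
`E2`, `E3` proportional, each being an equation of the line `012`, with values `S` and `S'` up to a
common factor. Comparing the three relations shows that `X : Y : Z` equals `x : y : z` up to signs,
and every choice of signs contradicts a noncollinearity. -/
theorem quadrilateral_algebra [CharZero K] {p q r s t w x y z X Y Z : K} (hp : p ≠ 0)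
    (hs : s ≠ 0) (ht : t ≠ 0) (hw : w ≠ 0) (hx : x ≠ 0)
    (hy : y ≠ 0) (hz : z ≠ 0) (hX : X ≠ 0) (hZ : Z ≠ 0) (hY : Y ≠ 0)
    (hrel : p * s * t + q * r * w = 0)
    (E1 : Y * Z * x * (s * w * x - t * s * y - r * w * z) =
      y * z * X * (s * w * X - t * s * Y - r * w * Z))
    (E2 : Z * X * y * (t * q * y - p * t * z - w * q * x) =
      z * x * Y * (t * q * Y - p * t * Z - w * q * X))
    (E3 : X * Y * z * (p * r * z - s * p * x - q * r * y) =
      x * y * Z * (p * r * Z - s * p * X - q * r * Y))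
    (hq : q ≠ 0)
    (n016 : p * r * z - s * p * x - q * r * y ≠ 0) (n567 : y * Z - z * Y ≠ 0)
    (n236 : w * x - t * y ≠ 0) (n146 : s * x - r * z ≠ 0) (n056 : q * y - p * z ≠ 0) :
    False := by
  set S := s * w * x - t * s * y - r * w * z with hS
  set S' := s * w * X - t * s * Y - r * w * Z with hS'
  have hS0 : S ≠ 0 := by
    intro h
    have : w * (p * r * z - s * p * x - q * r * y) = 0 := by
      linear_combination (-p) * h - y * hrel
    simp [hw, n016] at this
  have hS1 : S' ≠ 0 := by
    intro h
    rw [h, mul_zero] at E1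
    simp [hY, hZ, hx, hS0] at E1
  have F2 : Z * X * y * S = z * x * Y * S' := by
    apply mul_left_cancel₀ hq
    linear_combination (-s) * E2 - (z * Z * (X * y - x * Y)) * hrel
  have F3 : X * Y * z * S = x * y * Z * S' := by
    apply mul_left_cancel₀ hp
    linear_combination (-w) * E3 + (y * Y * (Z * x - z * X)) * hrel
  have c1 : (x * Y - X * y) * (x * Y + X * y) = 0 := by
    apply mul_left_cancel₀ (mul_ne_zero (mul_ne_zero hz hZ) (mul_ne_zero hS0 hS1))
    linear_combination z * x * Y * S' * E1 - y * z * X * S' * F2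
  have c2 : (x * Z - X * z) * (x * Z + X * z) = 0 := by
    apply mul_left_cancel₀ (mul_ne_zero (mul_ne_zero hy hY) (mul_ne_zero hS0 hS1))
    linear_combination x * y * Z * S' * E1 - y * z * X * S' * F3
  have G : x * Y * (x * Z) * S = y * z * X * (x * S') := by linear_combination x * E1
  have two : (2 : K) ≠ 0 := two_ne_zero
  have hk : X ^ 2 * (y * z) ≠ 0 := mul_ne_zero (pow_ne_zero 2 hX) (mul_ne_zero hy hz)
  -- Equal signs make `5, 6, 7` collinear. In each other case `E1` gives a relation between `S` and
  -- `S'` that puts `6` on the line `23`, `14` or `05`, twice over; whence the characteristic.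
  rcases mul_eq_zero.1 c1 with a | a <;> rcases mul_eq_zero.1 c2 with b | b
  · apply n567
    apply mul_left_cancel₀ hx
    linear_combination y * b - z * a
  · apply n236
    apply mul_left_cancel₀ (mul_ne_zero hk (mul_ne_zero two hs))
    linear_combination (S * (x * Z) + y * z * X * (t * s)) * a +
      (S * (X * y) + y * z * X * (r * w)) * b - G
  · apply n146
    apply mul_left_cancel₀ (mul_ne_zero hk (mul_ne_zero two hw))
    linear_combination (S * (x * Z) + y * z * X * (t * s)) * a +
      (y * z * X * (r * w) - S * (X * y)) * b - G
  · apply n056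
    apply mul_left_cancel₀ (mul_ne_zero hk (mul_ne_zero two (mul_ne_zero hs ht)))
    linear_combination q * (S * (x * Z) + y * z * X * (t * s)) * a +
      q * (y * z * X * (r * w) - S * (X * y)) * b - q * G - 2 * X ^ 2 * y * z * z * hrel

/-- Six vertices of a complete quadrilateral and two further points cannot be such that each pair
of opposite pairs of vertices lies on a conic through the two further points. -/
theorem not_quadrilateral_of_conics [CharZero K] (p : Config K)
    (hz : ∀ i j k : Fin 8,
      (i, j, k) ∈ [((0 : Fin 8), (1 : Fin 8), (2 : Fin 8)), (0, 3, 4), (1, 3, 5), (2, 4, 5)] →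
      LineThrough p {i, j, k})
    (hn : ∀ i j k : Fin 8, i < j → j < k →
      (i, j, k) ∉ [((0 : Fin 8), (1 : Fin 8), (2 : Fin 8)), (0, 3, 4), (1, 3, 5), (2, 4, 5)] →
      ¬ LineThrough p {i, j, k})
    (hA : ConicThrough p {1, 2, 3, 4, 6, 7}) (hB : ConicThrough p {0, 2, 3, 5, 6, 7})
    (hC : ConicThrough p {0, 1, 4, 5, 6, 7}) : False := by
  have Z : ∀ i j k : Fin 8,
      (i, j, k) ∈ [((0 : Fin 8), (1 : Fin 8), (2 : Fin 8)), (0, 3, 4), (1, 3, 5), (2, 4, 5)] →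
      ∀ a b c : Fin 8, ({i, j, k} : Finset (Fin 8)) = {a, b, c} →
      bracket (p a).rep (p b).rep (p c).rep = 0 := by
    intro i j k hm a b c h
    rw [← lineThrough_iff (isCoord_rep p), ← h]
    exact hz i j k hm
  have N : ∀ i j k : Fin 8, i < j → j < k →
      (i, j, k) ∉ [((0 : Fin 8), (1 : Fin 8), (2 : Fin 8)), (0, 3, 4), (1, 3, 5), (2, 4, 5)] →
      ∀ a b c : Fin 8, ({i, j, k} : Finset (Fin 8)) = {a, b, c} →
      bracket (p a).rep (p b).rep (p c).rep ≠ 0 := by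
    intro i j k hij hjk hm a b c h
    rw [ne_eq, ← lineThrough_iff (isCoord_rep p), ← h]
    exact hn i j k hij hjk hm
  have z0 := Z 0 3 4 (by decide) 4 3 0 (by decide)
  have z1 := Z 1 3 5 (by decide) 3 5 1 (by decide)
  have z2 := Z 2 4 5 (by decide) 5 4 2 (by decide)
  have rel := bracket_dualCoord (p 5).rep (p 4).rep (p 3).rep (p 0).rep (p 1).rep (p 2).rep
  rw [Z 0 1 2 (by decide) 0 1 2 rfl, mul_zero] at rel
  have n016 := bracket_dualCoord (p 5).rep (p 4).rep (p 3).rep (p 0).rep (p 1).rep (p 6).rep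
  have n567 := bracket_mul_bracket (p 5).rep (p 4).rep (p 3).rep (p 6).rep (p 7).rep
  have n146 := bracket_mul_bracket (p 4).rep (p 3).rep (p 5).rep (p 1).rep (p 6).rep
  have n236 := bracket_mul_bracket (p 3).rep (p 5).rep (p 4).rep (p 2).rep (p 6).rep
  have n056 := bracket_mul_bracket (p 5).rep (p 4).rep (p 3).rep (p 0).rep (p 6).rep
  have D := N 3 4 5 (by decide) (by decide) (by decide) 5 4 3 (by decide)
  rw [bracket] at rel n016
  simp only [dualCoord, Matrix.cons_val, z0, z1, z2] at rel n016
  refine quadrilateral_algebra (K := K)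
    (N 0 3 5 (by decide) (by decide) (by decide) 3 5 0 (by decide))
    (N 1 4 5 (by decide) (by decide) (by decide) 5 4 1 (by decide))
    (N 2 3 4 (by decide) (by decide) (by decide) 4 3 2 (by decide))
    (N 2 3 5 (by decide) (by decide) (by decide) 3 5 2 (by decide))
    (N 3 4 6 (by decide) (by decide) (by decide) 4 3 6 (by decide))
    (N 3 5 6 (by decide) (by decide) (by decide) 3 5 6 (by decide))
    (N 4 5 6 (by decide) (by decide) (by decide) 5 4 6 (by decide))
    (N 3 4 7 (by decide) (by decide) (by decide) 4 3 7 (by decide))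
    (N 4 5 7 (by decide) (by decide) (by decide) 5 4 7 (by decide))
    (N 3 5 7 (by decide) (by decide) (by decide) 3 5 7 (by decide))
    (q := bracket (p 5).rep (p 4).rep (p 0).rep) (r := bracket (p 4).rep (p 3).rep (p 1).rep)
    ?_ ?_ ?_ ?_
    (N 0 4 5 (by decide) (by decide) (by decide) 5 4 0 (by decide)) ?_ ?_ ?_ ?_ ?_
  · linear_combination rel
  -- Each conic omits exactly one vertex of the reference triangle `3, 4, 5`. The omitted vertex
  -- plays the part of `a`, and the two quadrilateral vertices on the sides through it those of `d`
  -- and `e`.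
  · exact conic_pencil_of_conicThrough hA (a := 5) (b := 4) (c := 3) (d := 1) (e := 2) (f := 6)
      (g := 7) (by decide) (by decide) (by decide) (by decide) (by decide) (by decide) D
      rfl z1 rfl rfl rfl z2 rfl rfl rfl rfl rfl rfl
      (N 1 3 4 (by decide) (by decide) (by decide) 4 3 1 (by decide))
      (N 1 4 5 (by decide) (by decide) (by decide) 5 4 1 (by decide))
      (N 2 3 4 (by decide) (by decide) (by decide) 4 3 2 (by decide))
      (N 2 3 5 (by decide) (by decide) (by decide) 3 5 2 (by decide))
      (N 3 5 6 (by decide) (by decide) (by decide) 3 5 6 (by decide))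
      (N 4 5 6 (by decide) (by decide) (by decide) 5 4 6 (by decide))
  · exact conic_pencil_of_conicThrough hB (a := 4) (b := 3) (c := 5) (d := 2) (e := 0) (f := 6)
      (g := 7) (by decide) (by decide) (by decide) (by decide) (by decide) (by decide)
      (N 3 4 5 (by decide) (by decide) (by decide) 4 3 5 (by decide))
      rfl z2 rfl rfl rfl z0 rfl rfl rfl rfl rfl rfl
      (N 2 3 5 (by decide) (by decide) (by decide) 3 5 2 (by decide))
      (N 2 3 4 (by decide) (by decide) (by decide) 4 3 2 (by decide))
      (N 0 3 5 (by decide) (by decide) (by decide) 3 5 0 (by decide))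
      (N 0 4 5 (by decide) (by decide) (by decide) 5 4 0 (by decide))
      (N 4 5 6 (by decide) (by decide) (by decide) 5 4 6 (by decide))
      (N 3 4 6 (by decide) (by decide) (by decide) 4 3 6 (by decide))
  · exact conic_pencil_of_conicThrough hC (a := 3) (b := 5) (c := 4) (d := 0) (e := 1) (f := 6)
      (g := 7) (by decide) (by decide) (by decide) (by decide) (by decide) (by decide)
      (N 3 4 5 (by decide) (by decide) (by decide) 3 5 4 (by decide))
      rfl z0 rfl rfl rfl z1 rfl rfl rfl rfl rfl rfl
      (N 0 4 5 (by decide) (by decide) (by decide) 5 4 0 (by decide))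
      (N 0 3 5 (by decide) (by decide) (by decide) 3 5 0 (by decide))
      (N 1 4 5 (by decide) (by decide) (by decide) 5 4 1 (by decide))
      (N 1 3 4 (by decide) (by decide) (by decide) 4 3 1 (by decide))
      (N 3 4 6 (by decide) (by decide) (by decide) 4 3 6 (by decide))
      (N 3 5 6 (by decide) (by decide) (by decide) 3 5 6 (by decide))
  · intro h
    refine mul_ne_zero (pow_ne_zero 2 D)
      (N 0 1 6 (by decide) (by decide) (by decide) 0 1 6 rfl) ?_
    rw [← n016]
    linear_combination -h
  · rw [← n567]
    exact mul_ne_zero D (N 5 6 7 (by decide) (by decide) (by decide) 5 6 7 rfl)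
  · intro h
    refine mul_ne_zero (N 3 4 5 (by decide) (by decide) (by decide) 3 5 4 (by decide))
      (N 2 3 6 (by decide) (by decide) (by decide) 3 2 6 (by decide)) ?_
    rw [n236]
    linear_combination -h
  · rw [← n146]
    exact mul_ne_zero (N 3 4 5 (by decide) (by decide) (by decide) 4 3 5 (by decide))
      (N 1 4 6 (by decide) (by decide) (by decide) 4 1 6 (by decide))
  · intro h
    refine mul_ne_zero D (N 0 5 6 (by decide) (by decide) (by decide) 5 0 6 (by decide)) ?_
    rw [n056]
    linear_combination -h

end
end Quatroid

namespace Quatroid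

/-! ### Closed collections of subsets and their flats -/

section Flats

/-- All members of `A` have `m + 1` elements, and the `(m + 1)`-subsets of the union of two members
that share `m` elements are again members. -/
def FlatClosed (m : ℕ) (A : Finset (Finset (Fin 8))) : Prop :=
  (∀ I ∈ A, I.card = m + 1) ∧ ∀ I₁ ∈ A, ∀ I₂ ∈ A, m ≤ (I₁ ∩ I₂).card →
    ∀ I : Finset (Fin 8), I ⊆ I₁ ∪ I₂ → I.card = m + 1 → I ∈ A

/-- All `(m + 1)`-subsets of `s` belong to `A`, and there is at least one. -/
def IsFull (m : ℕ) (A : Finset (Finset (Fin 8))) (s : Finset (Fin 8)) : Prop :=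
  m + 1 ≤ s.card ∧ ∀ I ⊆ s, I.card = m + 1 → I ∈ A

/-- A maximal full set. -/
def IsFlat (m : ℕ) (A : Finset (Finset (Fin 8))) (s : Finset (Fin 8)) : Prop :=
  IsFull m A s ∧ ∀ t, IsFull m A t → s ⊆ t → t = s

variable {m : ℕ} {A : Finset (Finset (Fin 8))}

/-- Induction on the number of elements of `I` outside `c`. If there are two, `x` and `y`, replacing
either by an element `e` of `c` outside `I` gives a set closer to `c`. Both sets are members by
induction, share `m` elements and cover `I`. -/
theorem FlatClosed.mem_of_subset_star (h : FlatClosed m A) {c : Finset (Fin 8)}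
    (hc : c.card = m) (I : Finset (Fin 8)) (hI : I.card = m + 1)
    (hs : ∀ x ∈ I, x ∈ c ∨ insert x c ∈ A) : I ∈ A := by
  induction hn : (I \ c).card using Nat.strong_induction_on generalizing I with
  | _ n ih =>
    subst hn
    have h1 : 1 ≤ (I \ c).card := by
      have := Finset.le_card_sdiff c I
      omega
    rcases h1.eq_or_lt with h1 | h1
    · obtain ⟨x, hx⟩ := Finset.card_eq_one.1 h1.symm
      have hxI : x ∈ I \ c := by rw [hx]; simp
      rw [Finset.mem_sdiff] at hxI
      have hsub : I ⊆ insert x c := by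
        intro y hy
        by_cases hyc : y ∈ c
        · exact Finset.mem_insert_of_mem hyc
        · have : y ∈ I \ c := Finset.mem_sdiff.2 ⟨hy, hyc⟩
          rw [hx, Finset.mem_singleton] at this
          simp [this]
      rw [Finset.eq_of_subset_of_card_le hsub (by
        rw [Finset.card_insert_of_notMem hxI.2, hc, hI])]
      exact (hs x hxI.1).resolve_left hxI.2
    · obtain ⟨x, hx, y, hy, hxy⟩ := Finset.one_lt_card.1 h1
      rw [Finset.mem_sdiff] at hx hy
      have h2 : (c \ I).Nonempty := by
        rw [← Finset.card_pos]
        have e1 := Finset.card_sdiff_add_card_inter I c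
        have e2 := Finset.card_sdiff_add_card_inter c I
        rw [Finset.inter_comm] at e2
        omega
      obtain ⟨e, he⟩ := h2
      rw [Finset.mem_sdiff] at he
      have key : ∀ z ∈ I, z ∉ c → insert e (I.erase z) ∈ A := by
        intro z hz hzc
        refine ih _ ?_ _ ?_ ?_ rfl
        · apply Finset.card_lt_card
          refine ⟨fun w hw => ?_, fun hsub => ?_⟩
          · simp only [Finset.mem_sdiff, Finset.mem_insert, Finset.mem_erase] at hw ⊢
            rcases hw with ⟨rfl | hw, hwc⟩
            · exact absurd he.1 hwc
            · exact ⟨hw.2, hwc⟩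
          · have := hsub (Finset.mem_sdiff.2 ⟨hz, hzc⟩)
            simp only [Finset.mem_sdiff, Finset.mem_insert, Finset.mem_erase] at this
            rcases this.1 with rfl | hw
            · exact hzc he.1
            · exact hw.1 rfl
        · rw [Finset.card_insert_of_notMem (by simp [he.2]), Finset.card_erase_of_mem hz, hI]
          omega
        · intro w hw
          rw [Finset.mem_insert, Finset.mem_erase] at hw
          rcases hw with rfl | hw
          · exact Or.inl he.1
          · exact hs w hw.2
      refine h.2 _ (key x hx.1 hx.2) _ (key y hy.1 hy.2) ?_ I ?_ hI
      · have hsub : insert e ((I.erase x).erase y) ⊆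
            insert e (I.erase x) ∩ insert e (I.erase y) := by
          intro w hw
          simp only [Finset.mem_inter, Finset.mem_insert, Finset.mem_erase] at hw ⊢
          tauto
        refine le_trans ?_ (Finset.card_le_card hsub)
        rw [Finset.card_insert_of_notMem (by simp [he.2]), Finset.card_erase_of_mem
          (Finset.mem_erase.2 ⟨hxy.symm, hy.1⟩), Finset.card_erase_of_mem hx.1, hI]
        omega
      · intro w hw
        simp only [Finset.mem_union, Finset.mem_insert, Finset.mem_erase]
        by_cases hwx : w = x
        · subst hwx; exact Or.inr (Or.inr ⟨hxy, hw⟩)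
        · exact Or.inl (Or.inr ⟨hwx, hw⟩)

/-- If two flats share an `m`-set `c`, both lie in the set of all `x` that `c` generates, which is
full by `FlatClosed.mem_of_subset_star`. Maximality identifies both with it. -/
theorem FlatClosed.card_inter_lt (h : FlatClosed m A) {s t : Finset (Fin 8)} (hs : IsFlat m A s)
    (ht : IsFlat m A t) (hst : s ≠ t) : (s ∩ t).card < m := by
  classical
  by_contra! hcon
  obtain ⟨c, hcs, hc⟩ := Finset.exists_subset_card_eq hcon
  let u : Finset (Fin 8) := Finset.univ.filter fun x => x ∈ c ∨ insert x c ∈ A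
  have hsub : ∀ r, IsFlat m A r → c ⊆ r → r ⊆ u := by
    intro r hr hcr x hx
    simp only [u, Finset.mem_filter, Finset.mem_univ, true_and]
    by_cases hxc : x ∈ c
    · exact Or.inl hxc
    · refine Or.inr (hr.1.2 _ (Finset.insert_subset hx hcr) ?_)
      rw [Finset.card_insert_of_notMem hxc, hc]
  have hs' := hsub s hs (hcs.trans Finset.inter_subset_left)
  have ht' := hsub t ht (hcs.trans Finset.inter_subset_right)
  have hu : IsFull m A u := by
    refine ⟨hs.1.1.trans (Finset.card_le_card hs'), fun I hI hcI => ?_⟩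
    refine h.mem_of_subset_star hc I hcI fun x hx => ?_
    simpa [u] using hI hx
  exact hst ((hs.2 u hu hs').symm.trans (ht.2 u hu ht'))

theorem FlatClosed.exists_isFlat (h : FlatClosed m A) {I : Finset (Fin 8)} (hI : I ∈ A) :
    ∃ s, IsFlat m A s ∧ I ⊆ s := by
  have hfull : IsFull m A I := by
    refine ⟨(h.1 I hI).ge, fun J hJ hc => ?_⟩
    rwa [Finset.eq_of_subset_of_card_le hJ (by rw [hc, h.1 I hI])]
  obtain ⟨s, hIs, hs⟩ := Set.Finite.exists_le_maximal (Set.toFinite {t | IsFull m A t}) hfull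
  exact ⟨s, ⟨hs.1, fun t ht hst => le_antisymm (hs.2 ht hst) hst⟩, hIs⟩

/-- A family of sets of size more than `m` that pairwise share fewer than `m` elements is
determined by the `(m + 1)`-subsets of its members. -/
theorem subset_of_facets {B C : Set (Finset (Fin 8))} (hB : ∀ s ∈ B, m + 1 ≤ s.card)
    (hB' : ∀ s ∈ B, ∀ t ∈ B, s ≠ t → (s ∩ t).card < m)
    (hC' : ∀ s ∈ C, ∀ t ∈ C, s ≠ t → (s ∩ t).card < m)
    (h : ∀ I : Finset (Fin 8), I.card = m + 1 → ((∃ s ∈ B, I ⊆ s) ↔ ∃ s ∈ C, I ⊆ s)) : B ⊆ C := by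
  -- A member of `B` lies inside a member of `C`: exchanging one element of an `(m + 1)`-subset
  -- keeps `m` elements, so its container in `C` cannot change. Applied in both directions, this
  -- sandwiches a member of `C` between two members of `B` with a common `(m + 1)`-subset.
  have key : ∀ B C : Set (Finset (Fin 8)), (∀ s ∈ C, ∀ t ∈ C, s ≠ t → (s ∩ t).card < m) →
      (∀ I : Finset (Fin 8), I.card = m + 1 → (∃ s ∈ B, I ⊆ s) → ∃ s ∈ C, I ⊆ s) →
      ∀ s ∈ B, ∀ I ⊆ s, I.card = m + 1 → ∃ t ∈ C, s ⊆ t := by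
    intro B C hC' h s hs I hI hc
    obtain ⟨t, ht, hIt⟩ := h I hc ⟨s, hs, hI⟩
    refine ⟨t, ht, fun x hx => ?_⟩
    by_cases hxI : x ∈ I
    · exact hIt hxI
    obtain ⟨e, he⟩ : I.Nonempty := Finset.card_pos.1 (by omega)
    obtain ⟨t', ht', hIt'⟩ := h (insert x (I.erase e)) (by
      rw [Finset.card_insert_of_notMem (by simp [hxI]), Finset.card_erase_of_mem he, hc]; rfl)
      ⟨s, hs, Finset.insert_subset hx ((Finset.erase_subset _ _).trans hI)⟩
    by_cases htt : t = t'
    · rw [htt]; exact hIt' (Finset.mem_insert_self _ _)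
    · have h1 := hC' t ht t' ht' htt
      have h2 : I.erase e ⊆ t ∩ t' := Finset.subset_inter ((Finset.erase_subset _ _).trans hIt)
        ((Finset.subset_insert _ _).trans hIt')
      have h3 := Finset.card_le_card h2
      rw [Finset.card_erase_of_mem he, hc] at h3
      omega
  intro s hs
  obtain ⟨I, hI, hc⟩ := Finset.exists_subset_card_eq (hB s hs)
  obtain ⟨t, ht, hst⟩ := key B C hC' (fun I hc => (h I hc).1) s hs I hI hc
  obtain ⟨s', hs', hts⟩ := key C B hB' (fun I hc => (h I hc).2) t ht I (hI.trans hst) hc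
  have : s = s' := by
    by_contra hne
    have h1 := hB' s hs s' hs' hne
    have h2 := Finset.card_le_card (Finset.subset_inter hI ((hI.trans hst).trans hts))
    omega
  have : s = t := le_antisymm hst (this ▸ hts)
  rwa [this]

end Flats

/-! ### Blocks, cliques, and their correspondence with pairs -/

/-- A block is a set of labels, together with a flag telling whether it stands for a conic or for
a line. -/
@[ext]
structure Block where
  /-- Does the block stand for a conic? -/
  isConic : Bool
  /-- The labels of the points of the block. -/
  points : Finset (Fin 8)
deriving DecidableEq

namespace Block

noncomputable instance : Fintype Block :=
  Fintype.ofInjective (fun b : Block => (b.isConic, b.points)) fun _ _ h =>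
    Block.ext (congrArg Prod.fst h) (congrArg Prod.snd h)

instance : MulAction (Equiv.Perm (Fin 8)) Block where
  smul σ b := ⟨b.1, σ • b.2⟩
  one_smul b := Block.ext rfl (one_smul _ b.2)
  mul_smul σ τ b := Block.ext rfl (mul_smul σ τ b.2)

theorem smul_fst (σ : Equiv.Perm (Fin 8)) (b : Block) : (σ • b).1 = b.1 := rfl

theorem smul_snd (σ : Equiv.Perm (Fin 8)) (b : Block) : (σ • b).2 = σ • b.2 := rfl

/-- The number of points that impose no condition on a curve of the given type. -/
def freePoints (κ : Bool) : ℕ := cond κ 5 2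

/-- A block has to be large enough to impose a condition. -/
def Valid (b : Block) : Prop := freePoints b.1 + 1 ≤ b.2.card

/-- The bound for the number of common points of two distinct curves. -/
def Compat (b c : Block) : Prop := (b.2 ∩ c.2).card ≤ 2 ^ (b.1.toNat + c.1.toNat)

end Block

open Block

/-- Families of lines and conics that obey the bounds of Bézout's theorem. -/
def IsClique (X : Finset Block) : Prop :=
  (∀ b ∈ X, Valid b) ∧ ∀ b ∈ X, ∀ c ∈ X, b ≠ c → Compat b c

theorem isClique_smul (σ : Equiv.Perm (Fin 8)) {X : Finset Block} (h : IsClique X) :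
    IsClique (σ • X) := by
  refine ⟨fun b hb => ?_, fun b hb c hc hbc => ?_⟩
  · obtain ⟨b, hb', rfl⟩ := Finset.mem_smul_finset.1 hb
    simpa [Valid, smul_fst, smul_snd, Finset.card_smul_finset] using h.1 b hb'
  · obtain ⟨b, hb', rfl⟩ := Finset.mem_smul_finset.1 hb
    obtain ⟨c, hc', rfl⟩ := Finset.mem_smul_finset.1 hc
    have := h.2 b hb' c hc' (fun h => hbc (h ▸ rfl))
    simpa [Compat, smul_fst, smul_snd, ← Finset.smul_finset_inter, Finset.card_smul_finset]
      using this

/-- The pair of all triples and sextuples contained in the lines and conics of a family. -/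
def toPair (X : Finset Block) : Pair :=
  ((X.filter fun b => b.1 = false).biUnion fun b => b.2.powersetCard 3,
    (X.filter fun b => b.1 = true).biUnion fun b => b.2.powersetCard 6)

theorem mem_toPair_fst {X : Finset Block} {I : Finset (Fin 8)} :
    I ∈ (toPair X).1 ↔ I.card = 3 ∧ ∃ s ∈ {s | (⟨false, s⟩ : Block) ∈ X}, I ⊆ s := by
  simp only [toPair, Finset.mem_biUnion, Finset.mem_filter, Finset.mem_powersetCard,
    Set.mem_ofPred_eq]
  constructor
  · rintro ⟨⟨k, s⟩, ⟨hb, rfl⟩, hI, hc⟩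
    exact ⟨hc, s, hb, hI⟩
  · rintro ⟨hc, s, hs, hI⟩
    exact ⟨⟨false, s⟩, ⟨hs, rfl⟩, hI, hc⟩

theorem mem_toPair_snd {X : Finset Block} {I : Finset (Fin 8)} :
    I ∈ (toPair X).2 ↔ I.card = 6 ∧ ∃ s ∈ {s | (⟨true, s⟩ : Block) ∈ X}, I ⊆ s := by
  simp only [toPair, Finset.mem_biUnion, Finset.mem_filter, Finset.mem_powersetCard,
    Set.mem_ofPred_eq]
  constructor
  · rintro ⟨⟨k, s⟩, ⟨hb, rfl⟩, hI, hc⟩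
    exact ⟨hc, s, hb, hI⟩
  · rintro ⟨hc, s, hs, hI⟩
    exact ⟨⟨true, s⟩, ⟨hs, rfl⟩, hI, hc⟩

theorem toPair_smul (σ : Equiv.Perm (Fin 8)) (X : Finset Block) :
    toPair (σ • X) = σ • toPair X := by
  have key : ∀ (κ : Bool) (I : Finset (Fin 8)),
      (∃ s ∈ {s | (⟨κ, s⟩ : Block) ∈ σ • X}, I ⊆ s) ↔
        ∃ s ∈ {s | (⟨κ, s⟩ : Block) ∈ X}, σ⁻¹ • I ⊆ s := by
    intro κ I
    constructor
    · rintro ⟨s, hs, hI⟩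
      refine ⟨σ⁻¹ • s, Finset.inv_smul_mem_iff.2 hs, Finset.smul_finset_subset_smul_finset hI⟩
    · rintro ⟨s, hs, hI⟩
      have hs' : σ • (⟨κ, s⟩ : Block) ∈ σ • X := Finset.smul_mem_smul_finset hs
      refine ⟨σ • s, hs', ?_⟩
      have := Finset.smul_finset_subset_smul_finset (a := σ) hI
      rwa [smul_inv_smul] at this
  refine Prod.ext ?_ ?_
  · ext I
    rw [Prod.smul_fst, ← Finset.inv_smul_mem_iff, mem_toPair_fst, mem_toPair_fst, key,
      Finset.card_smul_finset]
  · ext I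
    rw [Prod.smul_snd, ← Finset.inv_smul_mem_iff, mem_toPair_snd, mem_toPair_snd, key,
      Finset.card_smul_finset]

theorem isPair_toPair (X : Finset Block) : IsPair (toPair X) :=
  ⟨fun _ h => (mem_toPair_fst.1 h).1, fun _ h => (mem_toPair_snd.1 h).1⟩

theorem IsClique.card_inter_lt {X : Finset Block} (h : IsClique X) (κ : Bool) :
    ∀ s ∈ {s | (⟨κ, s⟩ : Block) ∈ X}, ∀ t ∈ {s | (⟨κ, s⟩ : Block) ∈ X}, s ≠ t →
      (s ∩ t).card < freePoints κ := by
  intro s hs t ht hst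
  have := h.2 _ hs _ ht (fun h => hst (congrArg Block.points h))
  cases κ <;> simp [Compat, freePoints] at this ⊢ <;> omega

theorem IsClique.le_card {X : Finset Block} (h : IsClique X) (κ : Bool) :
    ∀ s ∈ {s | (⟨κ, s⟩ : Block) ∈ X}, freePoints κ + 1 ≤ s.card :=
  fun _ hs => h.1 _ hs

theorem toPair_injOn : Set.InjOn toPair {X | IsClique X} := by
  have key : ∀ X Y, IsClique X → IsClique Y → toPair X = toPair Y → X ⊆ Y := by
    rintro X Y hX hY h ⟨κ, s⟩ hb
    refine subset_of_facets (hX.le_card κ) (hX.card_inter_lt κ) (hY.card_inter_lt κ) ?_ hb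
    intro I hc
    cases κ
    · have h1 := mem_toPair_fst (X := X) (I := I)
      rw [h, mem_toPair_fst] at h1
      have hc' : I.card = 3 := hc
      simpa [hc'] using h1.symm
    · have h1 := mem_toPair_snd (X := X) (I := I)
      rw [h, mem_toPair_snd] at h1
      have hc' : I.card = 6 := hc
      simpa [hc'] using h1.symm
  intro X hX Y hY h
  exact Finset.Subset.antisymm (key X Y hX hY h) (key Y X hY hX h.symm)

theorem IsClique.weakCriteria {X : Finset Block} (h : IsClique X) : WeakCriteria (toPair X) := by
  have key : ∀ (κ : Bool) (I₁ I₂ s t : Finset (Fin 8)), (⟨κ, s⟩ : Block) ∈ X →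
      (⟨κ, t⟩ : Block) ∈ X → I₁ ⊆ s → I₂ ⊆ t → freePoints κ ≤ (I₁ ∩ I₂).card → s = t := by
    intro κ I₁ I₂ s t hs ht h1 h2 hc
    by_contra hne
    have e1 := h.card_inter_lt κ s hs t ht hne
    have e2 := Finset.card_le_card (Finset.inter_subset_inter h1 h2)
    omega
  refine ⟨fun I hI J hJ => ?_, fun I₁ hI₁ I₂ hI₂ hc I hI hc' => ?_,
    fun I₁ hI₁ I₂ hI₂ hc I hI hc' => ?_⟩
  · obtain ⟨-, s, hs, hIs⟩ := mem_toPair_fst.1 hI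
    obtain ⟨-, t, ht, hJt⟩ := mem_toPair_snd.1 hJ
    have := h.2 _ hs _ ht (fun h => Bool.noConfusion (congrArg Block.isConic h))
    exact (Finset.card_le_card (Finset.inter_subset_inter hIs hJt)).trans this
  · obtain ⟨-, s, hs, h1⟩ := mem_toPair_fst.1 hI₁
    obtain ⟨-, t, ht, h2⟩ := mem_toPair_fst.1 hI₂
    obtain rfl := key false I₁ I₂ s t hs ht h1 h2 hc
    exact mem_toPair_fst.2 ⟨hc', s, hs, hI.trans (Finset.union_subset h1 h2)⟩
  · obtain ⟨-, s, hs, h1⟩ := mem_toPair_snd.1 hI₁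
    obtain ⟨-, t, ht, h2⟩ := mem_toPair_snd.1 hI₂
    obtain rfl := key true I₁ I₂ s t hs ht h1 h2 hc
    exact mem_toPair_snd.2 ⟨hc', s, hs, hI.trans (Finset.union_subset h1 h2)⟩

/-- The blocks are the flats of the two collections, with `m = 2` for lines and `m = 5` for conics.
The second and third weak criteria are the closure property of flats; the first bounds the
intersection of a line with a conic. -/
theorem exists_clique_toPair {Q : Pair} (hQ : IsPair Q) (hW : WeakCriteria Q) :
    ∃ X, IsClique X ∧ toPair X = Q := by
  classical
  have c3 : FlatClosed 2 Q.1 := ⟨hQ.1, fun I₁ h₁ I₂ h₂ h => hW.2.1 I₁ h₁ I₂ h₂ h⟩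
  have c6 : FlatClosed 5 Q.2 := ⟨hQ.2, fun I₁ h₁ I₂ h₂ h => hW.2.2 I₁ h₁ I₂ h₂ h⟩
  let X : Finset Block := Finset.univ.filter fun b =>
    IsFlat (freePoints b.1) (cond b.1 Q.2 Q.1) b.2
  have mf : ∀ s, (⟨false, s⟩ : Block) ∈ X ↔ IsFlat 2 Q.1 s := fun s => by
    rw [Finset.mem_filter, and_iff_right (Finset.mem_univ _)]; rfl
  have mt : ∀ s, (⟨true, s⟩ : Block) ∈ X ↔ IsFlat 5 Q.2 s := fun s => by
    rw [Finset.mem_filter, and_iff_right (Finset.mem_univ _)]; rfl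
  -- Three common labels would form a triple of `Q` contained in some sextuple of `Q` inside `t`.
  have lc : ∀ s t, IsFlat 2 Q.1 s → IsFlat 5 Q.2 t → (s ∩ t).card ≤ 2 := by
    intro s t hs ht
    by_contra! hcon
    obtain ⟨I, hI, hc⟩ := Finset.exists_subset_card_eq (Nat.succ_le_of_lt hcon)
    obtain ⟨J, hIJ, hJt, hcJ⟩ := Finset.exists_subsuperset_card_eq
      (hI.trans Finset.inter_subset_right) (by rw [hc]; decide : I.card ≤ 6) ht.1.1
    have := hW.1 I (hs.1.2 I (hI.trans Finset.inter_subset_left) hc) J (ht.1.2 J hJt hcJ)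
    rw [Finset.inter_eq_left.2 hIJ, hc] at this
    omega
  refine ⟨X, ⟨?_, ?_⟩, ?_⟩
  · rintro ⟨κ, s⟩ hb
    cases κ
    · exact ((mf s).1 hb).1.1
    · exact ((mt s).1 hb).1.1
  · rintro ⟨κ, s⟩ hb ⟨ν, t⟩ hc hne
    cases κ <;> cases ν
    · have := c3.card_inter_lt ((mf s).1 hb) ((mf t).1 hc) (fun h => hne (h ▸ rfl))
      exact Nat.le_of_lt_succ this
    · exact lc s t ((mf s).1 hb) ((mt t).1 hc)
    · have := lc t s ((mf t).1 hc) ((mt s).1 hb)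
      rw [Finset.inter_comm] at this
      exact this
    · have := c6.card_inter_lt ((mt s).1 hb) ((mt t).1 hc) (fun h => hne (h ▸ rfl))
      exact Nat.le_of_lt_succ this
  · refine Prod.ext ?_ ?_
    · ext I
      rw [mem_toPair_fst]
      constructor
      · rintro ⟨hc, s, hs, hI⟩
        exact ((mf s).1 hs).1.2 I hI hc
      · intro hI
        obtain ⟨s, hs, hIs⟩ := c3.exists_isFlat hI
        exact ⟨hQ.1 I hI, s, (mf s).2 hs, hIs⟩
    · ext I
      rw [mem_toPair_snd]
      constructor
      · rintro ⟨hc, s, hs, hI⟩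
        exact ((mt s).1 hs).1.2 I hI hc
      · intro hI
        obtain ⟨s, hs, hIs⟩ := c6.exists_isFlat hI
        exact ⟨hQ.2 I hI, s, (mt s).2 hs, hIs⟩

/-- A block larger than necessary contains two triples, or sextuples, that differ in a single label;
blocks of minimal size contribute just themselves. -/
theorem IsClique.strongCriteria_iff {X : Finset Block} (h : IsClique X) :
    StrongCriteria (toPair X) ↔ ∀ b ∈ X, b.2.card = freePoints b.1 + 1 := by
  have split : ∀ (n : ℕ) (s : Finset (Fin 8)), n + 2 ≤ s.card →
      ∃ I ⊆ s, ∃ J ⊆ s, I.card = n + 1 ∧ J.card = n + 1 ∧ I ≠ J ∧ n ≤ (I ∩ J).card := by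
    intro n s hs
    obtain ⟨T, hT, hc⟩ := Finset.exists_subset_card_eq hs
    obtain ⟨x, hx, y, hy, hxy⟩ := Finset.one_lt_card.1 (by omega : 1 < T.card)
    refine ⟨T.erase x, (Finset.erase_subset _ _).trans hT, T.erase y,
      (Finset.erase_subset _ _).trans hT, ?_, ?_, ?_, ?_⟩
    · rw [Finset.card_erase_of_mem hx, hc]; rfl
    · rw [Finset.card_erase_of_mem hy, hc]; rfl
    · intro he
      have : x ∈ T.erase x := by rw [he]; exact Finset.mem_erase.2 ⟨hxy, hx⟩
      simp at this
    · have hsub : (T.erase x).erase y ⊆ T.erase x ∩ T.erase y := by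
        intro w hw
        simp only [Finset.mem_inter, Finset.mem_erase] at hw ⊢
        tauto
      refine le_trans ?_ (Finset.card_le_card hsub)
      rw [Finset.card_erase_of_mem (Finset.mem_erase.2 ⟨hxy.symm, hy⟩),
        Finset.card_erase_of_mem hx, hc]
      omega
  constructor
  · rintro ⟨h3, h6⟩ ⟨κ, s⟩ hb
    refine le_antisymm ?_ (h.1 _ hb)
    by_contra! hcon
    obtain ⟨I, hI, J, hJ, cI, cJ, hIJ, hn⟩ := split (freePoints κ) s hcon
    cases κ
    · have := h3 I (mem_toPair_fst.2 ⟨cI, s, hb, hI⟩) J (mem_toPair_fst.2 ⟨cJ, s, hb, hJ⟩) hIJ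
      simp [freePoints] at hn
      omega
    · have := h6 I (mem_toPair_snd.2 ⟨cI, s, hb, hI⟩) J (mem_toPair_snd.2 ⟨cJ, s, hb, hJ⟩) hIJ
      simp [freePoints] at hn
      omega
  · intro hall
    have key : ∀ (κ : Bool) (I J s t : Finset (Fin 8)), (⟨κ, s⟩ : Block) ∈ X →
        (⟨κ, t⟩ : Block) ∈ X → I ⊆ s → J ⊆ t → I.card = freePoints κ + 1 →
        J.card = freePoints κ + 1 → I ≠ J → (I ∩ J).card < freePoints κ := by
      intro κ I J s t hs ht hI hJ cI cJ hne
      have e1 : I = s := Finset.eq_of_subset_of_card_le hI (by rw [hall _ hs, cI])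
      have e2 : J = t := Finset.eq_of_subset_of_card_le hJ (by rw [hall _ ht, cJ])
      subst e1 e2
      exact h.card_inter_lt κ I hs J ht hne
    refine ⟨fun I hI J hJ hne => ?_, fun I hI J hJ hne => ?_⟩
    · obtain ⟨cI, s, hs, hIs⟩ := mem_toPair_fst.1 hI
      obtain ⟨cJ, t, ht, hJt⟩ := mem_toPair_fst.1 hJ
      exact Nat.le_of_lt_succ (key false I J s t hs ht hIs hJt cI cJ hne)
    · obtain ⟨cI, s, hs, hIs⟩ := mem_toPair_snd.1 hI
      obtain ⟨cJ, t, ht, hJt⟩ := mem_toPair_snd.1 hJ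
      exact Nat.le_of_lt_succ (key true I J s t hs ht hIs hJt cI cJ hne)

end Quatroid

namespace Quatroid

/-! ### Double counting along orbits -/

section DoubleCounting
variable {G α ι : Type*} [Group G] [Fintype G] [MulAction G α] [DecidableEq α] [Fintype ι]

variable (G) in
/-- The orbit of `x`, as a finite set. -/
def orbitFinset (x : α) : Finset α := Finset.univ.image fun g : G => g • x

theorem mem_orbitFinset {x y : α} : y ∈ orbitFinset G x ↔ ∃ g : G, g • x = y := by
  simp [orbitFinset]

theorem smul_mem_orbitFinset (g : G) {x y : α} :
    g • y ∈ orbitFinset G x ↔ y ∈ orbitFinset G x := by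
  simp only [mem_orbitFinset]
  constructor
  · rintro ⟨h, hh⟩
    exact ⟨g⁻¹ * h, by rw [mul_smul, hh, inv_smul_smul]⟩
  · rintro ⟨h, rfl⟩
    exact ⟨g * h, mul_smul _ _ _⟩

/-- Double counting of the pairs related by an invariant relation whose second member lies in a
given orbit. -/
theorem card_orbitFinset_mul (R : α → α → Prop) (hR : ∀ (g : G) x y, R (g • x) (g • y) ↔ R x y)
    (r : ι → α) (hr : ∀ i j (g : G), g • r i = r j → i = j) (y : α) (B : Finset α)
    (hB : ∀ x, x ∈ B ↔ R x y) (hcov : ∀ x, R x y → ∃ i, ∃ g : G, g • r i = x) (m : ι → ℕ)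
    [∀ x, DecidablePred (R x)]
    (hm : ∀ i, ((orbitFinset G y).filter (R (r i))).card = m i) :
    (orbitFinset G y).card * B.card = ∑ i, (orbitFinset G (r i)).card * m i := by
  classical
  -- Pairs in `R` are counted between this union of orbits and the orbit of `y`. By invariance, the
  -- number of partners is constant on each orbit: `B.card` on the orbit of `y`, and `m i` on that
  -- of `r i`.
  let s : Finset α := Finset.univ.biUnion fun i => orbitFinset G (r i)
  have hs : ∀ (g : G) x, g • x ∈ s ↔ x ∈ s := by
    intro g x
    simp [s, smul_mem_orbitFinset]
  have h := Finset.sum_card_bipartiteAbove_eq_sum_card_bipartiteBelow R (s := s)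
    (t := orbitFinset G y)
  have hright : ∀ b ∈ orbitFinset G y, (s.bipartiteBelow R b).card = B.card := by
    intro b hb
    obtain ⟨g, rfl⟩ := mem_orbitFinset.1 hb
    have : s.bipartiteBelow R (g • y) = B.image (g • ·) := by
      ext x
      simp only [Finset.mem_bipartiteBelow, Finset.mem_image]
      constructor
      · rintro ⟨-, hx⟩
        refine ⟨g⁻¹ • x, (hB _).2 ((hR g _ _).1 ?_), smul_inv_smul _ _⟩
        rwa [smul_inv_smul]
      · rintro ⟨x, hx, rfl⟩
        have hx' := (hB x).1 hx
        refine ⟨(hs g x).2 ?_, (hR g _ _).2 hx'⟩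
        obtain ⟨i, g', rfl⟩ := hcov x hx'
        exact Finset.mem_biUnion.2 ⟨i, Finset.mem_univ _, mem_orbitFinset.2 ⟨g', rfl⟩⟩
    rw [this, Finset.card_image_of_injective _ (MulAction.injective g)]
  have hleft : ∀ i, ∀ a ∈ orbitFinset G (r i),
      ((orbitFinset G y).bipartiteAbove R a).card = m i := by
    intro i a ha
    obtain ⟨g, rfl⟩ := mem_orbitFinset.1 ha
    have : (orbitFinset G y).bipartiteAbove R (g • r i) =
        ((orbitFinset G y).filter (R (r i))).image (g • ·) := by
      ext x
      simp only [Finset.mem_bipartiteAbove, Finset.mem_image, Finset.mem_filter]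
      constructor
      · rintro ⟨hx, hx'⟩
        refine ⟨g⁻¹ • x, ⟨(smul_mem_orbitFinset _).2 hx, (hR g _ _).1 ?_⟩, smul_inv_smul _ _⟩
        rwa [smul_inv_smul]
      · rintro ⟨x, ⟨hx, hx'⟩, rfl⟩
        exact ⟨(smul_mem_orbitFinset _).2 hx, (hR g _ _).2 hx'⟩
    rw [this, Finset.card_image_of_injective _ (MulAction.injective g), hm]
  rw [Finset.sum_congr rfl hright, Finset.sum_const, smul_eq_mul, Finset.sum_biUnion] at h
  · rw [← h]
    refine Finset.sum_congr rfl fun i _ => ?_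
    rw [Finset.sum_congr rfl (hleft i), Finset.sum_const, smul_eq_mul]
  · intro i _ j _ hij
    refine Finset.disjoint_left.2 fun x hx hx' => hij ?_
    obtain ⟨g, rfl⟩ := mem_orbitFinset.1 hx
    obtain ⟨g', hg'⟩ := mem_orbitFinset.1 hx'
    exact (hr j i (g⁻¹ * g') (by rw [mul_smul, hg', inv_smul_smul])).symm

end DoubleCounting

/-! ### Orderly generation of cliques -/

section Classification

/-- The blocks of a family are added in the order given by this rank. -/
def Block.rank (b : Block) : ℕ := 8 * b.1.toNat + (8 - b.2.card)

theorem Block.rank_smul (σ : Equiv.Perm (Fin 8)) (b : Block) : (σ • b).rank = b.rank := by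
  simp [Block.rank, Block.smul_fst, Block.smul_snd, Finset.card_smul_finset]

/-- `b` may be added to `X` as a block of the largest rank. -/
def IsExtension (X : Finset Block) (b : Block) : Prop :=
  b ∉ X ∧ b.Valid ∧ ∀ c ∈ X, Block.Compat c b ∧ c.rank ≤ b.rank

/-- `Y` arises from `X` by adding a block of the largest rank. -/
def IsCover (X Y : Finset Block) : Prop :=
  ∃ b, b ∉ X ∧ Y = insert b X ∧ ∀ c ∈ X, c.rank ≤ b.rank

/-- The blocks of the largest rank. -/
noncomputable def topBlocks (X : Finset Block) : Finset Block :=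
  X.filter fun b => ∀ c ∈ X, c.rank ≤ b.rank

theorem isCover_smul (σ : Equiv.Perm (Fin 8)) (X Y : Finset Block) :
    IsCover (σ • X) (σ • Y) ↔ IsCover X Y := by
  have key : ∀ (τ : Equiv.Perm (Fin 8)) (X Y : Finset Block), IsCover X Y →
      IsCover (τ • X) (τ • Y) := by
    rintro τ X Y ⟨b, hb, rfl, hr⟩
    refine ⟨τ • b, by rwa [Finset.smul_mem_smul_finset_iff], Finset.smul_finset_insert _ _ _,
      fun c hc => ?_⟩
    obtain ⟨c, hc', rfl⟩ := Finset.mem_smul_finset.1 hc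
    simpa [Block.rank_smul] using hr c hc'
  refine ⟨fun h => ?_, key σ X Y⟩
  simpa using key σ⁻¹ _ _ h

theorem IsClique.mono {X Y : Finset Block} (h : IsClique Y) (hXY : X ⊆ Y) : IsClique X :=
  ⟨fun b hb => h.1 b (hXY hb), fun b hb c hc => h.2 b (hXY hb) c (hXY hc)⟩

theorem IsClique.isExtension {X : Finset Block} {b : Block} (h : IsClique (insert b X))
    (hb : b ∉ X) (hr : ∀ c ∈ X, c.rank ≤ b.rank) : IsExtension X b :=
  ⟨hb, h.1 b (by simp), fun c hc =>
    ⟨h.2 c (by simp [hc]) b (by simp) fun e => hb (e ▸ hc), hr c hc⟩⟩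

variable {N : ℕ} {r : Fin N → Finset Block}

/-- A block of the largest rank is removed, the rest is carried to a representative by induction,
and the block, carried along, becomes an admissible extension of that representative. -/
theorem exists_smul_of_isClique (h0 : ∃ i, r i = ∅)
    (hext : ∀ i b, IsExtension (r i) b → ∃ j, ∃ σ : Equiv.Perm (Fin 8), σ • insert b (r i) = r j)
    {X : Finset Block} (hX : IsClique X) : ∃ i, ∃ σ : Equiv.Perm (Fin 8), σ • r i = X := by
  induction hn : X.card generalizing X with
  | zero =>
    obtain ⟨i, hi⟩ := h0
    refine ⟨i, 1, ?_⟩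
    rw [one_smul, hi, Finset.card_eq_zero.1 hn]
  | succ n ih =>
    have hne : X.Nonempty := by rw [← Finset.card_pos, hn]; omega
    obtain ⟨b, hb, hmax⟩ := X.exists_max_image Block.rank hne
    obtain ⟨i, σ, hσ⟩ := ih (hX.mono (X.erase_subset b)) (by
      rw [Finset.card_erase_of_mem hb, hn]; rfl)
    have hXi : insert (σ⁻¹ • b) (r i) = σ⁻¹ • X := by
      rw [← Finset.insert_erase hb, Finset.smul_finset_insert, ← hσ, inv_smul_smul]
    have hcl := isClique_smul σ⁻¹ hX
    rw [← hXi] at hcl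
    have hnot : σ⁻¹ • b ∉ r i := by
      rw [← Finset.smul_mem_smul_finset_iff σ, smul_inv_smul, hσ]
      simp
    obtain ⟨j, τ, hτ⟩ := hext i _ (hcl.isExtension hnot fun c hc => by
      have : σ • c ∈ X := by
        have := Finset.smul_mem_smul_finset (a := σ) hc
        rw [hσ] at this
        exact Finset.mem_of_mem_erase this
      simpa [Block.rank_smul] using hmax _ this)
    refine ⟨j, σ * τ⁻¹, ?_⟩
    rw [mul_smul, ← hτ, inv_smul_smul, hXi, smul_inv_smul]

/-- The recursion for the sizes of the orbits. -/
theorem card_orbitFinset_mul_card_topBlocks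
    (hr : ∀ i j (σ : Equiv.Perm (Fin 8)), σ • r i = r j → i = j)
    (hclique : ∀ i, IsClique (r i)) (h0 : ∃ i, r i = ∅)
    (hext : ∀ i b, IsExtension (r i) b → ∃ j, ∃ σ : Equiv.Perm (Fin 8), σ • insert b (r i) = r j)
    (m : Fin N → Fin N → ℕ) (E : Fin N → Fin N → Finset Block)
    (hE : ∀ i j b, b ∈ E i j ↔
      IsExtension (r i) b ∧ ∃ σ : Equiv.Perm (Fin 8), σ • insert b (r i) = r j)
    (hm : ∀ i j, (E i j).card = m i j) (j : Fin N) :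
    (orbitFinset (Equiv.Perm (Fin 8)) (r j)).card * (topBlocks (r j)).card =
      ∑ i, (orbitFinset (Equiv.Perm (Fin 8)) (r i)).card * m i j := by
  classical
  -- The families covered by `r j` arise by erasing one of its top blocks, and different blocks give
  -- different families.
  have hinj : Set.InjOn (fun b => (r j).erase b) (topBlocks (r j)) := by
    intro b hb c hc h
    exact (Finset.erase_inj _ (Finset.mem_filter.1 (Finset.mem_coe.1 hb)).1).1 h
  rw [← Finset.card_image_of_injOn hinj]
  refine card_orbitFinset_mul IsCover isCover_smul r hr (r j) _ ?_ ?_ (m · j) ?_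
  · intro X
    simp only [Finset.mem_image, topBlocks, Finset.mem_filter]
    constructor
    · rintro ⟨b, ⟨hb, hmax⟩, rfl⟩
      exact ⟨b, by simp, (Finset.insert_erase hb).symm,
        fun c hc => hmax c (Finset.mem_of_mem_erase hc)⟩
    · rintro ⟨b, hb, he, hmax⟩
      refine ⟨b, ⟨by simp [he], fun c hc => ?_⟩, by rw [he, Finset.erase_insert hb]⟩
      rw [he, Finset.mem_insert] at hc
      rcases hc with rfl | hc
      · exact le_rfl
      · exact hmax c hc
  · rintro X ⟨b, hb, he, -⟩
    exact exists_smul_of_isClique h0 hext ((hclique j).mono (he ▸ Finset.subset_insert b X))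
  · intro i
    rw [← hm i j]
    -- The covers of `r i` in the orbit of `r j` are the extensions of `r i` that are equivalent to
    -- `r j`.
    have : (orbitFinset (Equiv.Perm (Fin 8)) (r j)).filter (IsCover (r i)) =
        (E i j).image fun b => insert b (r i) := by
      ext X
      simp only [Finset.mem_filter, mem_orbitFinset, Finset.mem_image, hE]
      constructor
      · rintro ⟨⟨σ, hσ⟩, b, hb, rfl, hmax⟩
        have hcl := isClique_smul σ (hclique j)
        rw [hσ] at hcl
        exact ⟨b, ⟨hcl.isExtension hb hmax, σ⁻¹, by rw [← hσ, inv_smul_smul]⟩, rfl⟩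
      · rintro ⟨b, ⟨hb, σ, hσ⟩, rfl⟩
        exact ⟨⟨σ⁻¹, by rw [← hσ, inv_smul_smul]⟩, b, hb.1, rfl, fun c hc => (hb.2.2 c hc).2⟩
    rw [this, Finset.card_image_of_injOn]
    intro b hb c hc h
    have hb' := ((hE i j b).1 hb).1.1
    have hc' := ((hE i j c).1 hc).1.1
    exact (Finset.insert_inj hb').1 h

end Classification
end Quatroid

namespace Quatroid

/-! ### Binary codes of blocks and families -/

section Codes

/-- The number of ones among the last eight binary digits. -/
def bitCount (n : ℕ) : ℕ :=
  -- The hexadecimal digit at position `k` of the constant is the number of binary ones of `k`; the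
  -- two halves of the byte are looked up separately. The arithmetic is written with `Nat`
  -- primitives, which the kernel evaluates directly.
  Nat.add (Nat.land (Nat.shiftRight 0x4332322132212110 (Nat.mul 4 (Nat.land n 15))) 15)
    (Nat.land (Nat.shiftRight 0x4332322132212110
      (Nat.mul 4 (Nat.land (Nat.shiftRight n 4) 15))) 15)

/-- The block whose points are the ones among the last eight binary digits of `n`, the ninth digit
telling whether it is a conic. -/
def decodeBlock (n : ℕ) : Block := ⟨n.testBit 8, Finset.univ.filter fun i : Fin 8 => n.testBit i⟩

/-- The family of blocks with the given codes. -/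
def decode (l : List ℕ) : Finset Block := (l.map decodeBlock).toFinset

theorem mem_points_decodeBlock {n : ℕ} {i : Fin 8} :
    i ∈ (decodeBlock n).points ↔ n.testBit i = true := by simp [decodeBlock]

theorem card_filter_testBit (n : ℕ) :
    (Finset.univ.filter fun i : Fin 8 => n.testBit i).card = bitCount n := by
  have h1 : ∀ n < 256, (Finset.univ.filter fun i : Fin 8 => n.testBit i).card = bitCount n := by
    decide +kernel
  have h2 : bitCount n = bitCount (n % 2 ^ 8) := by
    have e1 : Nat.land (n % 2 ^ 8) 15 = Nat.land n 15 := by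
      change n % 2 ^ 8 &&& (2 ^ 4 - 1) = n &&& (2 ^ 4 - 1)
      rw [Nat.and_two_pow_sub_one_eq_mod, Nat.and_two_pow_sub_one_eq_mod]
      omega
    have e2 : Nat.land (Nat.shiftRight (n % 2 ^ 8) 4) 15 = Nat.land (Nat.shiftRight n 4) 15 := by
      change (n % 2 ^ 8) >>> 4 &&& (2 ^ 4 - 1) = n >>> 4 &&& (2 ^ 4 - 1)
      rw [Nat.and_two_pow_sub_one_eq_mod, Nat.and_two_pow_sub_one_eq_mod,
        Nat.shiftRight_eq_div_pow, Nat.shiftRight_eq_div_pow]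
      omega
    simp only [bitCount, e1, e2]
  rw [h2, ← h1 (n % 2 ^ 8) (Nat.mod_lt _ (by norm_num))]
  congr 1
  ext i
  rw [Finset.mem_filter, Finset.mem_filter, Nat.testBit_mod_two_pow]
  simp [i.2]

theorem card_points_decodeBlock (n : ℕ) : (decodeBlock n).points.card = bitCount n :=
  card_filter_testBit n

theorem card_points_inter (m n : ℕ) :
    ((decodeBlock m).points ∩ (decodeBlock n).points).card = bitCount (Nat.land m n) := by
  rw [← card_filter_testBit]
  congr 1
  ext i
  change _ ↔ i ∈ Finset.univ.filter fun i : Fin 8 => (m &&& n).testBit i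
  simp [decodeBlock, Nat.testBit_and]

/-- One for a conic and zero for a line. -/
def conicBit (n : ℕ) : ℕ := Nat.land (Nat.shiftRight n 8) 1

theorem toNat_isConic_decodeBlock (n : ℕ) : (decodeBlock n).isConic.toNat = conicBit n := by
  change (n.testBit 8).toNat = n >>> 8 &&& 1
  rw [Nat.toNat_testBit, Nat.and_one_is_mod, Nat.shiftRight_eq_div_pow]

theorem decodeBlock_injOn : Set.InjOn decodeBlock {n | n < 512} := by
  intro m hm n hn h
  refine Nat.eq_of_testBit_eq fun i => ?_
  rcases lt_trichotomy i 8 with hi | rfl | hi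
  · have := congrArg (fun b : Block => (⟨i, hi⟩ : Fin 8) ∈ b.points) h
    simp only [mem_points_decodeBlock, eq_iff_iff] at this
    exact Bool.eq_iff_iff.2 this
  · exact congrArg Block.isConic h
  · have h9 : 2 ^ 9 ≤ 2 ^ i := Nat.pow_le_pow_right (by norm_num) hi
    have hm' : m < 512 := hm
    have hn' : n < 512 := hn
    rw [Nat.testBit_lt_two_pow (by omega), Nat.testBit_lt_two_pow (by omega)]

theorem exists_testBit_iff (s : Finset (Fin 8)) :
    ∃ n < 2 ^ 8, ∀ i : Fin 8, n.testBit i = true ↔ i ∈ s := by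
  induction s using Finset.induction_on with
  | empty => exact ⟨0, by norm_num, by simp⟩
  | insert a s _ ih =>
    obtain ⟨n, hn, h⟩ := ih
    refine ⟨n ||| 2 ^ (a : ℕ), Nat.or_lt_two_pow hn
      (Nat.pow_lt_pow_right (by norm_num) a.2), fun i => ?_⟩
    rw [Nat.testBit_or, Bool.or_eq_true, h, Nat.testBit_two_pow, decide_eq_true_iff,
      Finset.mem_insert, Fin.val_inj, or_comm, eq_comm]

theorem exists_decodeBlock (b : Block) : ∃ n < 512, decodeBlock n = b := by
  obtain ⟨κ, s⟩ := b
  obtain ⟨n, hn, h⟩ := exists_testBit_iff s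
  cases κ
  · refine ⟨n, by omega, Block.ext ?_ ?_⟩
    · exact Nat.testBit_lt_two_pow hn
    · ext i
      rw [mem_points_decodeBlock, h]
  · refine ⟨2 ^ 8 + n, by omega, Block.ext ?_ ?_⟩
    · change (2 ^ 8 + n).testBit 8 = true
      rw [Nat.testBit_two_pow_add_eq, Nat.testBit_lt_two_pow hn]
      rfl
    · ext i
      rw [mem_points_decodeBlock, Nat.testBit_two_pow_add_gt i.2, h]

theorem mem_decode {l : List ℕ} {b : Block} : b ∈ decode l ↔ ∃ n ∈ l, decodeBlock n = b := by
  simp [decode]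

theorem decodeBlock_mem_decode {l : List ℕ} (hl : ∀ n ∈ l, n < 512) {n : ℕ} (hn : n < 512) :
    decodeBlock n ∈ decode l ↔ n ∈ l := by
  rw [mem_decode]
  constructor
  · rintro ⟨m, hm, h⟩
    rwa [← decodeBlock_injOn (hl m hm) hn h]
  · exact fun h => ⟨n, h, rfl⟩

theorem nodup_map_decodeBlock {l : List ℕ} (hl : ∀ n ∈ l, n < 512) (hn : l.Nodup) :
    (l.map decodeBlock).Nodup :=
  List.Nodup.map_on (fun m hm n hn h => decodeBlock_injOn (hl m hm) (hl n hn) h) hn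

theorem card_decode {l : List ℕ} (hl : ∀ n ∈ l, n < 512) (hn : l.Nodup) :
    (decode l).card = l.length := by
  rw [decode, List.toFinset_card_of_nodup (nodup_map_decodeBlock hl hn), List.length_map]

theorem sum_decode {l : List ℕ} (hl : ∀ n ∈ l, n < 512) (hn : l.Nodup) (f : Block → ℕ) :
    ∑ b ∈ decode l, f b = (l.map fun n => f (decodeBlock n)).sum := by
  rw [decode, List.sum_toFinset _ (nodup_map_decodeBlock hl hn), List.map_map]
  rfl

/-- `Block.Valid` on codes. -/
def codeValid (n : ℕ) : Bool := Nat.ble (Nat.add 3 (Nat.mul 3 (conicBit n))) (bitCount n)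

/-- `Block.Compat` on codes. -/
def codeCompat (m n : ℕ) : Bool :=
  Nat.ble (bitCount (Nat.land m n)) (Nat.pow 2 (Nat.add (conicBit m) (conicBit n)))

/-- `Block.rank` on codes. -/
def codeRank (n : ℕ) : ℕ := Nat.add (Nat.mul 8 (conicBit n)) (Nat.sub 8 (bitCount n))

theorem freePoints_add_one (κ : Bool) : Block.freePoints κ + 1 = 3 + 3 * κ.toNat := by
  cases κ <;> rfl

theorem codeValid_iff (n : ℕ) : codeValid n = true ↔ (decodeBlock n).Valid := by
  rw [codeValid, Nat.ble_eq, Block.Valid, card_points_decodeBlock, freePoints_add_one,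
    toNat_isConic_decodeBlock]
  rfl

theorem codeCompat_iff (m n : ℕ) :
    codeCompat m n = true ↔ (decodeBlock m).Compat (decodeBlock n) := by
  rw [codeCompat, Nat.ble_eq, Block.Compat, card_points_inter, toNat_isConic_decodeBlock,
    toNat_isConic_decodeBlock]
  rfl

theorem codeRank_eq (n : ℕ) : codeRank n = (decodeBlock n).rank := by
  rw [codeRank, Block.rank, card_points_decodeBlock, toNat_isConic_decodeBlock]
  rfl

theorem not_beq_iff (m n : ℕ) : (!Nat.beq m n) = true ↔ m ≠ n := by
  rw [Bool.not_eq_true', ← Bool.not_eq_true, Nat.beq_eq]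

/-- `IsClique` on codes. -/
def codeClique : List ℕ → Bool
  | [] => true
  | n :: l => codeValid n && Nat.blt n 512 && l.all (fun m => codeCompat n m && !Nat.beq n m) &&
      codeClique l

theorem codeClique_iff (l : List ℕ) (h : codeClique l = true) :
    (∀ n ∈ l, n < 512) ∧ l.Nodup ∧ IsClique (decode l) := by
  induction l with
  | nil => exact ⟨by simp, List.nodup_nil, by simp [IsClique, decode]⟩
  | cons n l ih =>
    simp only [codeClique, Bool.and_eq_true, List.all_eq_true, not_beq_iff,
      Nat.blt_eq] at h
    obtain ⟨⟨⟨hv, hn⟩, hc⟩, hl⟩ := h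
    obtain ⟨h1, h2, h3⟩ := ih hl
    refine ⟨by simpa [hn] using h1, List.nodup_cons.2 ⟨fun hm => (hc n hm).2 rfl, h2⟩, ?_, ?_⟩
    · intro b hb
      obtain ⟨m, hm, rfl⟩ := mem_decode.1 hb
      rcases List.mem_cons.1 hm with rfl | hm
      · exact (codeValid_iff _).1 hv
      · exact h3.1 _ (mem_decode.2 ⟨m, hm, rfl⟩)
    · intro b hb c hc' hbc
      obtain ⟨m, hm, rfl⟩ := mem_decode.1 hb
      obtain ⟨k, hk, rfl⟩ := mem_decode.1 hc'
      rcases List.mem_cons.1 hm with rfl | hm' <;> rcases List.mem_cons.1 hk with rfl | hk'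
      · exact absurd rfl hbc
      · exact (codeCompat_iff _ _).1 (hc k hk').1
      · have := (codeCompat_iff _ _).1 (hc m hm').1
        rw [Block.Compat, Finset.inter_comm, add_comm] at this
        exact this
      · exact h3.2 _ (mem_decode.2 ⟨m, hm', rfl⟩) _ (mem_decode.2 ⟨k, hk', rfl⟩) hbc

/-- The codes of the blocks that may be added to a family. -/
def extensionCodes (l : List ℕ) : List ℕ :=
  ((List.range 512).filter codeValid).filter fun n =>
    l.all fun m => Nat.ble (codeRank m) (codeRank n) && codeCompat m n && !Nat.beq m n

theorem mem_extensionCodes {l : List ℕ} (hl : ∀ n ∈ l, n < 512) {n : ℕ} :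
    n ∈ extensionCodes l ↔ n < 512 ∧ IsExtension (decode l) (decodeBlock n) := by
  simp only [extensionCodes, List.mem_filter, List.mem_range, List.all_eq_true, Bool.and_eq_true,
    not_beq_iff, Nat.ble_eq, codeValid_iff, codeCompat_iff,
    codeRank_eq, IsExtension]
  constructor
  · rintro ⟨⟨hn, hv⟩, h⟩
    refine ⟨hn, fun hm => ?_, hv, fun b hb => ?_⟩
    · rw [decodeBlock_mem_decode hl hn] at hm
      exact (h n hm).2 rfl
    · obtain ⟨m, hm, rfl⟩ := mem_decode.1 hb
      exact ⟨(h m hm).1.2, (h m hm).1.1⟩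
  · rintro ⟨hn, hnot, hv, h⟩
    refine ⟨⟨hn, hv⟩, fun m hm => ?_⟩
    have hb := mem_decode.2 ⟨m, hm, rfl⟩
    refine ⟨⟨(h _ hb).2, (h _ hb).1⟩, ?_⟩
    rintro rfl
    exact hnot hb

/-- The number of blocks of the largest rank. -/
def codeTop (l : List ℕ) : ℕ :=
  (l.filter fun n => l.all fun m => Nat.ble (codeRank m) (codeRank n)).length

theorem card_topBlocks_decode {l : List ℕ} (hl : ∀ n ∈ l, n < 512) (hn : l.Nodup) :
    (topBlocks (decode l)).card = codeTop l := by
  rw [codeTop, ← card_decode (fun n h => hl n (List.mem_of_mem_filter h)) (hn.filter _)]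
  congr 1
  ext b
  simp only [topBlocks, Finset.mem_filter, mem_decode, List.mem_filter, List.all_eq_true,
    Nat.ble_eq, codeRank_eq]
  constructor
  · rintro ⟨⟨n, hn, rfl⟩, h⟩
    exact ⟨n, ⟨hn, fun m hm => h _ ⟨m, hm, rfl⟩⟩, rfl⟩
  · rintro ⟨n, ⟨hn, h⟩, rfl⟩
    refine ⟨⟨n, hn, rfl⟩, ?_⟩
    rintro _ ⟨m, hm, rfl⟩
    exact h m hm

end Codes

/-! ### Permutations acting on codes -/

section Permutations

/-- The image of `k` under the permutation whose values are the octal digits of `π`. -/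
def octalDigit (π k : ℕ) : ℕ := Nat.land (Nat.shiftRight π (Nat.mul 3 k)) 7

/-- The code of the image of a block under a permutation. -/
def codeImage (π n : ℕ) : ℕ :=
  (List.range 8).foldl (fun a k => Nat.lor a
    (Nat.shiftLeft (Nat.land (Nat.shiftRight n k) 1) (octalDigit π k))) (Nat.land n 256)

theorem octalDigit_lt (π k : ℕ) : octalDigit π k < 8 := by
  change π >>> (3 * k) &&& (2 ^ 3 - 1) < 8
  rw [Nat.and_two_pow_sub_one_eq_mod]
  exact Nat.mod_lt _ (by norm_num)

theorem testBit_codeImage (π n j : ℕ) : (codeImage π n).testBit j = true ↔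
    (j = 8 ∧ n.testBit 8 = true) ∨ ∃ k < 8, n.testBit k = true ∧ octalDigit π k = j := by
  have step : ∀ (l : List ℕ) (a : ℕ), (l.foldl (fun a k => Nat.lor a
      (Nat.shiftLeft (Nat.land (Nat.shiftRight n k) 1) (octalDigit π k))) a).testBit j = true ↔
      a.testBit j = true ∨ ∃ k ∈ l, n.testBit k = true ∧ octalDigit π k = j := by
    intro l
    induction l with
    | nil => simp
    | cons k l ih =>
      intro a
      rw [List.foldl_cons, ih]
      have h1 : (Nat.lor a (Nat.shiftLeft (Nat.land (Nat.shiftRight n k) 1)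
          (octalDigit π k))).testBit j = true ↔
          a.testBit j = true ∨ (n.testBit k = true ∧ octalDigit π k = j) := by
        change (a ||| (n >>> k &&& 1) <<< octalDigit π k).testBit j = true ↔ _
        rw [Nat.testBit_or, Bool.or_eq_true, Nat.testBit_shiftLeft, Nat.testBit_and,
          Nat.testBit_shiftRight]
        refine or_congr Iff.rfl ?_
        simp only [Bool.and_eq_true, decide_eq_true_iff, Nat.testBit_one_eq_true_iff_self_eq_zero]
        constructor
        · rintro ⟨h, h', h''⟩
          have : octalDigit π k = j := by omega
          subst this
          simpa using h'
        · rintro ⟨h, rfl⟩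
          simpa using h
      rw [h1]
      simp [or_assoc]
  rw [codeImage, step]
  refine or_congr ?_ (by simp)
  change (n &&& 2 ^ 8).testBit j = true ↔ _
  rw [Nat.testBit_and, Nat.testBit_two_pow, Bool.and_eq_true, decide_eq_true_iff]
  constructor
  · rintro ⟨h, rfl⟩
    exact ⟨rfl, h⟩
  · rintro ⟨rfl, h⟩
    exact ⟨h, rfl⟩

/-- The code 255 is the set of all labels, so the hypothesis says that the digits hit every label; a
surjection of a finite set onto itself is a permutation. -/
theorem exists_perm_octalDigit {π : ℕ} (h : codeImage π 255 = 255) :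
    ∃ σ : Equiv.Perm (Fin 8), ∀ k : Fin 8, ((σ k : Fin 8) : ℕ) = octalDigit π k := by
  let f : Fin 8 → Fin 8 := fun k => ⟨octalDigit π k, octalDigit_lt π k⟩
  have hf : Function.Surjective f := by
    intro j
    have h1 : (codeImage π 255).testBit j = true := by
      rw [h]
      revert j
      decide
    rcases (testBit_codeImage _ _ _).1 h1 with h2 | ⟨k, hk, -, hj⟩
    · exact absurd h2.1 j.2.ne
    · exact ⟨⟨k, hk⟩, Fin.ext hj⟩
  exact ⟨Equiv.ofBijective f (Finite.surjective_iff_bijective.1 hf), fun _ => rfl⟩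

theorem decodeBlock_codeImage {π : ℕ} {σ : Equiv.Perm (Fin 8)}
    (h : ∀ k : Fin 8, ((σ k : Fin 8) : ℕ) = octalDigit π k) (n : ℕ) :
    decodeBlock (codeImage π n) = σ • decodeBlock n := by
  refine Block.ext ?_ ?_
  · change (codeImage π n).testBit 8 = n.testBit 8
    rw [Bool.eq_iff_iff, testBit_codeImage]
    constructor
    · rintro (h | ⟨k, -, -, hk⟩)
      · exact h.2
      · exact absurd hk (octalDigit_lt π k).ne
    · exact fun h => Or.inl ⟨rfl, h⟩
  · ext j
    rw [mem_points_decodeBlock, testBit_codeImage, Block.smul_snd, Finset.mem_smul_finset]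
    constructor
    · rintro (h' | ⟨k, hk, hn, hj⟩)
      · exact absurd h'.1 j.2.ne
      · refine ⟨⟨k, hk⟩, mem_points_decodeBlock.2 hn, Fin.ext ?_⟩
        rw [Equiv.Perm.smul_def, h, hj]
    · rintro ⟨k, hk, rfl⟩
      exact Or.inr ⟨k, k.2, mem_points_decodeBlock.1 hk, (h k).symm⟩

/-- The set of members of a list, as a number. -/
def listMask (l : List ℕ) : ℕ := l.foldl (fun a n => Nat.lor a (Nat.shiftLeft 1 n)) 0

theorem testBit_listMask (l : List ℕ) (j : ℕ) : (listMask l).testBit j = true ↔ j ∈ l := by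
  have step : ∀ (l : List ℕ) (a : ℕ),
      (l.foldl (fun a n => Nat.lor a (Nat.shiftLeft 1 n)) a).testBit j = true ↔
        a.testBit j = true ∨ j ∈ l := by
    intro l
    induction l with
    | nil => simp
    | cons k l ih =>
      intro a
      rw [List.foldl_cons, ih]
      have h1 : (Nat.lor a (Nat.shiftLeft 1 k)).testBit j = true ↔ a.testBit j = true ∨ j = k := by
        change (a ||| 1 <<< k).testBit j = true ↔ _
        rw [Nat.testBit_or, Bool.or_eq_true, Nat.one_shiftLeft, Nat.testBit_two_pow,
          decide_eq_true_iff, eq_comm (a := k)]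
      rw [h1, List.mem_cons, or_assoc]
  rw [listMask, step]
  simp

/-- The mask forgets the order of a list, so an equality of families becomes the equality of two
numbers. -/
theorem smul_decode_of_listMask {π : ℕ} {l l' : List ℕ} (hπ : codeImage π 255 = 255)
    (h : listMask (l.map (codeImage π)) = listMask l') :
    ∃ σ : Equiv.Perm (Fin 8), σ • decode l = decode l' := by
  obtain ⟨σ, hσ⟩ := exists_perm_octalDigit hπ
  refine ⟨σ, ?_⟩
  have hmem : ∀ j, j ∈ l.map (codeImage π) ↔ j ∈ l' := fun j => by
    rw [← testBit_listMask, h, testBit_listMask]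
  ext b
  rw [Finset.mem_smul_finset, mem_decode]
  constructor
  · rintro ⟨c, hc, rfl⟩
    obtain ⟨n, hn, rfl⟩ := mem_decode.1 hc
    exact ⟨codeImage π n, (hmem _).1 (List.mem_map_of_mem hn), decodeBlock_codeImage hσ n⟩
  · rintro ⟨m, hm, rfl⟩
    obtain ⟨n, hn, rfl⟩ := List.mem_map.1 ((hmem m).2 hm)
    exact ⟨_, mem_decode.2 ⟨n, hn, rfl⟩, (decodeBlock_codeImage hσ n).symm⟩

end Permutations

/-! ### An orbit invariant of cliques -/

section Invariant

/-- The weight of a block in the invariant below. -/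
def Block.weight (b : Block) : ℕ := (b.points.card + b.isConic.toNat) ^ 2

/-- The total weight of the blocks through a point. -/
def pointWeight (X : Finset Block) (i : Fin 8) : ℕ := ∑ b ∈ X with i ∈ b.points, b.weight

/-- A number that separates the orbits of cliques. -/
def orbitInvariant (X : Finset Block) : ℕ :=
  ∑ b ∈ X, b.weight * (∑ i ∈ b.points, pointWeight X i ^ 2) ^ 2

theorem Block.weight_smul (σ : Equiv.Perm (Fin 8)) (b : Block) : (σ • b).weight = b.weight := by
  simp [Block.weight, Block.smul_fst, Block.smul_snd, Finset.card_smul_finset]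

theorem pointWeight_smul (σ : Equiv.Perm (Fin 8)) (X : Finset Block) (i : Fin 8) :
    pointWeight (σ • X) (σ i) = pointWeight X i := by
  have : (σ • X).filter (fun b => σ i ∈ b.points) =
      (X.filter fun b => i ∈ b.points).image (σ • ·) := by
    ext b
    simp only [Finset.mem_filter, Finset.mem_image, Finset.mem_smul_finset]
    constructor
    · rintro ⟨⟨c, hc, rfl⟩, hi⟩
      rw [Block.smul_snd, ← Equiv.Perm.smul_def, Finset.smul_mem_smul_finset_iff] at hi
      exact ⟨c, ⟨hc, hi⟩, rfl⟩
    · rintro ⟨c, ⟨hc, hi⟩, rfl⟩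
      refine ⟨⟨c, hc, rfl⟩, ?_⟩
      rwa [Block.smul_snd, ← Equiv.Perm.smul_def, Finset.smul_mem_smul_finset_iff]
  rw [pointWeight, this, Finset.sum_image fun a _ b _ h => MulAction.injective σ h]
  simp only [Block.weight_smul]
  rfl

theorem orbitInvariant_smul (σ : Equiv.Perm (Fin 8)) (X : Finset Block) :
    orbitInvariant (σ • X) = orbitInvariant X := by
  have h1 : σ • X = X.image (σ • ·) := rfl
  rw [orbitInvariant, h1, Finset.sum_image fun a _ b _ h => MulAction.injective σ h, ← h1]
  refine Finset.sum_congr rfl fun b _ => ?_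
  have h2 : (σ • b).points = b.points.image (σ • ·) := rfl
  rw [Block.weight_smul, h2, Finset.sum_image fun a _ b _ h => MulAction.injective σ h]
  simp only [Equiv.Perm.smul_def, pointWeight_smul]

/-- `Block.weight` on codes. -/
def codeWeight (n : ℕ) : ℕ := Nat.pow (Nat.add (bitCount n) (conicBit n)) 2

/-- `pointWeight` on codes. -/
def codePointWeight (l : List ℕ) (i : ℕ) : ℕ :=
  l.foldr (fun n a => Nat.add (Nat.mul (Nat.land (Nat.shiftRight n i) 1) (codeWeight n)) a) 0

/-- `orbitInvariant` on codes. -/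
def codeInvariant (l : List ℕ) : ℕ :=
  l.foldr (fun n a => Nat.add (Nat.mul (codeWeight n) (Nat.pow ((List.range 8).foldr (fun i a =>
    Nat.add (Nat.mul (Nat.land (Nat.shiftRight n i) 1) (Nat.pow (codePointWeight l i) 2)) a) 0)
      2)) a) 0

theorem codeWeight_eq (n : ℕ) : codeWeight n = (decodeBlock n).weight := by
  rw [codeWeight, Block.weight, card_points_decodeBlock, toNat_isConic_decodeBlock]
  rfl

theorem foldr_add_eq_sum {α : Type*} (f : α → ℕ) (l : List α) :
    l.foldr (fun n a => Nat.add (f n) a) 0 = (l.map f).sum := by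
  induction l with
  | nil => rfl
  | cons n l ih => rw [List.foldr_cons, ih, List.map_cons, List.sum_cons]; rfl

theorem land_shiftRight_mul (n i c : ℕ) :
    Nat.mul (Nat.land (Nat.shiftRight n i) 1) c = if n.testBit i = true then c else 0 := by
  change (n >>> i &&& 1) * c = _
  rw [Nat.and_one_is_mod, Nat.shiftRight_eq_div_pow, ← Nat.toNat_testBit]
  cases n.testBit i <;> simp

theorem codePointWeight_eq {l : List ℕ} (hl : ∀ n ∈ l, n < 512) (hn : l.Nodup) (i : Fin 8) :
    codePointWeight l i = pointWeight (decode l) i := by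
  rw [codePointWeight, foldr_add_eq_sum, pointWeight, Finset.sum_filter, sum_decode hl hn]
  simp only [land_shiftRight_mul, mem_points_decodeBlock, codeWeight_eq]

theorem codeInvariant_eq {l : List ℕ} (hl : ∀ n ∈ l, n < 512) (hn : l.Nodup) :
    codeInvariant l = orbitInvariant (decode l) := by
  rw [codeInvariant, foldr_add_eq_sum, orbitInvariant, sum_decode hl hn]
  congr 2
  ext n
  rw [foldr_add_eq_sum, codeWeight_eq]
  refine congrArg (fun x => (decodeBlock n).weight * x ^ 2) ?_
  rw [← List.sum_toFinset _ List.nodup_range, List.toFinset_range, Finset.sum_range]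
  simp only [land_shiftRight_mul]
  rw [← Finset.sum_filter]
  refine Finset.sum_congr rfl fun i _ => ?_
  rw [codePointWeight_eq hl hn]
  rfl

end Invariant
end Quatroid

namespace Quatroid

/-! ### The table of representatives -/

/-- An orbit of cliques: the blocks of a representative, the number of elements, the coordinates
of a realization, and the ways of adding a block of the largest rank. Coordinates are shifted by
two and written as octal digits; they are zero if there is no realization over the integers. An
extension is written as `n + 512 * j + 65536 * π`, for the code `n` of the new block, the index `j`
of the orbit of the extended family, and a permutation `π` (in octal digits) that maps the
extended family to the representative of that orbit. -/
structure ClassData where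
  blocks : List ℕ
  size : ℕ
  coords : ℕ
  extensions : List ℕ

/-- The orbits of cliques. -/
def classTable : List ClassData := [
  ⟨[], 1, 0o23303142043333324034132, [0xfac6880207, 0xfac4c8020b, 0xfac458020d, 0xfac443020e,
   0xfac688040f, 0xfaa8c80213, 0xfaa8580215, 0xfaa8430216, 0xfab8880417, 0xfaa3180219,
   0xfaa303021a, 0xfab508041b, 0xfaa223021c, 0xfab460041d, 0xfab444041e, 0xfac688061f,
   0xf958c80223, 0xf958580225, 0xf958430226, 0xf9d8880427, 0xf953180229, 0xf95303022a,
   0xf9d508042b, 0xf95223022c, 0xf9d460042d, 0xf9d444042e, 0xfa5688062f, 0xf91b180231,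
   0xf91b030232, 0xf9ab080433, 0xf91a230234, 0xf9aa600435, 0xf9aa440436, 0xfa3a880637,
   0xf911630238, 0xf9a3600439, 0xf9a344043a, 0xfa3548063b, 0xf9a22c043c, 0xfa3468063d,
   0xfa3445063e, 0xfac688083f, 0xeb58c80243, 0xeb58580245, 0xeb58430246, 0xef58880447,
   0xeb53180249, 0xeb5303024a, 0xef5508044b, 0xeb5223024c, 0xef5460044d, 0xef5444044e,
   0xf35688064f, 0xeb1b180251, 0xeb1b030252, 0xef2b080453, 0xeb1a230254, 0xef2a600455,
   0xef2a440456, 0xf33a880657, 0xeb11630258, 0xef23600459, 0xef2344045a, 0xf33548065b,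
   0xef222c045c, 0xf33468065d, 0xf33445065e, 0xf74688085f, 0xe8eb180261, 0xe8eb030262,
   0xed6b080463, 0xe8ea230264, 0xed6a600465, 0xed6a440466, 0xf1ea880667, 0xe8e1630268,
   0xed63600469, 0xed6344046a, 0xf1e548066b, 0xed622c046c, 0xf1e468066d, 0xf1e445066e,
   0xf66688086f, 0xe88d630270, 0xed1d600471, 0xed1d440472, 0xf1ad480673, 0xed1c2c0474,
   0xf1ac680675, 0xf1ac450676, 0xf63c880877, 0xed11ac0478, 0xf1a3a80679, 0xf1a385067a,
   0xf63588087b, 0xf1a235067c, 0xf63470087d, 0xf63446087e, 0xfac6880a7f, 0x5f58c80283,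
   0x5f58580285, 0x5f58430286, 0x7f58880487, 0x5f53180289, 0x5f5303028a, 0x7f5508048b,
   0x5f5223028c, 0x7f5460048d, 0x7f5444048e, 0x9f5688068f, 0x5f1b180291, 0x5f1b030292,
   0x7f2b080493, 0x5f1a230294, 0x7f2a600495, 0x7f2a440496, 0x9f3a880697, 0x5f11630298,
   0x7f23600499, 0x7f2344049a, 0x9f3548069b, 0x7f222c049c, 0x9f3468069d, 0x9f3445069e,
   0xbf4688089f, 0x5ceb1802a1, 0x5ceb0302a2, 0x7d6b0804a3, 0x5cea2302a4, 0x7d6a6004a5,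
   0x7d6a4404a6, 0x9dea8806a7, 0x5ce16302a8, 0x7d636004a9, 0x7d634404aa, 0x9de54806ab,
   0x7d622c04ac, 0x9de46806ad, 0x9de44506ae, 0xbe668808af, 0x5c8d6302b0, 0x7d1d6004b1,
   0x7d1d4404b2, 0x9dad4806b3, 0x7d1c2c04b4, 0x9dac6806b5, 0x9dac4506b6, 0xbe3c8808b7,
   0x7d11ac04b8, 0x9da3a806b9, 0x9da38506ba, 0xbe358808bb, 0x9da23506bc, 0xbe347008bd,
   0xbe344608be, 0xdec6880abf, 0x47eb1802c1, 0x47eb0302c2, 0x6beb0804c3, 0x47ea2302c4,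
   0x6bea6004c5, 0x6bea4404c6, 0x8fea8806c7, 0x47e16302c8, 0x6be36004c9, 0x6be34404ca,
   0x8fe54806cb, 0x6be22c04cc, 0x8fe46806cd, 0x8fe44506ce, 0xb3e68808cf, 0x478d6302d0,
   0x6b9d6004d1, 0x6b9d4404d2, 0x8fad4806d3, 0x6b9c2c04d4, 0x8fac6806d5, 0x8fac4506d6,
   0xb3bc8808d7, 0x6b91ac04d8, 0x8fa3a806d9, 0x8fa38506da, 0xb3b58808db, 0x8fa23506dc,
   0xb3b47008dd, 0xb3b44608de, 0xd7c6880adf, 0x447d6302e0, 0x68fd6004e1, 0x68fd4404e2,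
   0x8d7d4806e3, 0x68fc2c04e4, 0x8d7c6806e5, 0x8d7c4506e6, 0xb1fc8808e7, 0x68f1ac04e8,
   0x8d73a806e9, 0x8d738506ea, 0xb1f58808eb, 0x8d723506ec, 0xb1f47008ed, 0xb1f44608ee,
   0xd676880aef, 0x688fac04f0, 0x8d1fa806f1, 0x8d1f8506f2, 0xb1af8808f3, 0x8d1e3506f4,
   0xb1ae7008f5, 0xb1ae4608f6, 0xd63e880af7, 0x8d11f506f8, 0xb1a3f008f9, 0xb1a3c608fa,
   0xd635c80afb, 0xb1a23e08fc, 0xd634780afd, 0xd634470afe, 0xfac6880cff, 0xfac6880f3f,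
   0xf746880f5f, 0xf666880f6f, 0xf63c880f77, 0xf635880f7b, 0xf634700f7d, 0xf634460f7e,
   0xfac688117f, 0xbf46880f9f, 0xbe66880faf, 0xbe3c880fb7, 0xbe35880fbb, 0xbe34700fbd,
   0xbe34460fbe, 0xdec68811bf, 0xb3e6880fcf, 0xb3bc880fd7, 0xb3b5880fdb, 0xb3b4700fdd,
   0xb3b4460fde, 0xd7c68811df, 0xb1fc880fe7, 0xb1f5880feb, 0xb1f4700fed, 0xb1f4460fee,
   0xd6768811ef, 0xb1af880ff3, 0xb1ae700ff5, 0xb1ae460ff6, 0xd63e8811f7, 0xb1a3f00ff9,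
   0xb1a3c60ffa, 0xd635c811fb, 0xb1a23e0ffc, 0xd6347811fd, 0xd6344711fe, 0xfac68813ff]⟩,
  ⟨[7], 56, 0o313322043144214332003334, [0xfac6881419, 0xfac681141a, 0xfac611141c, 0xfa56881429,
   0xfa5681142a, 0xfa5611142c, 0xfa3a881431, 0xfa3a811432, 0xfa3a111434, 0xfac6881638,
   0xf356881449, 0xf35681144a, 0xf35611144c, 0xf33a881451, 0xf33a811452, 0xf33a111454,
   0xf746881658, 0xf1ea881461, 0xf1ea811462, 0xf1ea111464, 0xf666881668, 0xf63c881670,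
   0x9f56881489, 0x9f5681148a, 0x9f5611148c, 0x9f3a881491, 0x9f3a811492, 0x9f3a111494,
   0xbf46881698, 0x9dea8814a1, 0x9dea8114a2, 0x9dea1114a4, 0xbe668816a8, 0xbe3c8816b0,
   0x8fea8814c1, 0x8fea8114c2, 0x8fea1114c4, 0xb3e68816c8, 0xb3bc8816d0, 0xb1fc8816e0,
   0xfac688197b, 0xfac650197d, 0xfac642197e, 0xdec68819bb, 0xdec65019bd, 0xdec64219be,
   0xd7c68819db, 0xd7c65019dd, 0xd7c64219de, 0xd6768819eb, 0xd6765019ed, 0xd6764219ee,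
   0xd63e8819f3, 0xd63e5019f5, 0xd63e4219f6, 0xfac6881bf9, 0xfac6811bfa, 0xfac6881dfb,
   0xfac6111bfc, 0xfac6501dfd, 0xfac6421dfe]⟩,
  ⟨[15], 70, 0o332143134203344334314324, [0xfac6881e31, 0xfac6811e32, 0xfac6111e34, 0xfac0d11e38,
   0xf746881e51, 0xf746811e52, 0xf746111e54, 0xf740d11e58, 0xf666881e61, 0xf666811e62,
   0xf666111e64, 0xf660d11e68, 0xfac6882070, 0xfac6882271, 0xfac6812272, 0xfac6112274,
   0xfac0d12278, 0xbf46881e91, 0xbf46811e92, 0xbf46111e94, 0xbf40d11e98, 0xbe66881ea1,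
   0xbe66811ea2, 0xbe66111ea4, 0xbe60d11ea8, 0xdec68820b0, 0xdec68822b1, 0xdec68122b2,
   0xdec61122b4, 0xdec0d122b8, 0xb3e6881ec1, 0xb3e6811ec2, 0xb3e6111ec4, 0xb3e0d11ec8,
   0xd7c68820d0, 0xd7c68822d1, 0xd7c68122d2, 0xd7c61122d4, 0xd7c0d122d8, 0xd6768820e0,
   0xd6768822e1, 0xd6768122e2, 0xd6761122e4, 0xd670d122e8, 0xfac68824f0, 0xfac68827f3,
   0xfac65027f5, 0xfac64227f6, 0xfac2d027f9, 0xfac2c227fa, 0xfac21a27fc]⟩,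
  ⟨[31], 56, 0o342223114034232133143014, [0xfac6882861, 0xfac6812862, 0xfac6112864, 0xfac0d12868,
   0xfa88d12870, 0xdec68828a1, 0xdec68128a2, 0xdec61128a4, 0xdec0d128a8, 0xde88d128b0,
   0xd7c68828c1, 0xd7c68128c2, 0xd7c61128c4, 0xd7c0d128c8, 0xd788d128d0, 0xfac6882ae0,
   0xfac6882ce1, 0xfac6812ce2, 0xfac6112ce4, 0xfac0d12ce8, 0xfa88d12cf0]⟩,
  ⟨[63], 28, 0o434142433403413423232443, [0xfac6882ec1, 0xfac6812ec2, 0xfac6112ec4, 0xfac0d12ec8,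
   0xfa88d12ed0, 0xf858d12ee0]⟩,
  ⟨[127], 8, 0o214034014232133103143113, []⟩,
  ⟨[255], 1, 0o443003113114332334223333, []⟩,
  ⟨[319], 28, 0o124134403432233032333103, [0xfac68831cf, 0xfab88831d7, 0xfab50831db, 0xfab46031dd,
   0xfab44431de, 0xf9d88831e7, 0xf9d50831eb, 0xf9d46031ed, 0xf9d44431ee, 0xf9ab0831f3,
   0xf9aa6031f5, 0xf9aa4431f6, 0xf9a36031f9, 0xf9a34431fa, 0xf9a22c31fc]⟩,
  ⟨[383], 8, 0o342343403324313003334023, []⟩,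
  ⟨[511], 1, 0o403113413203033333243043, []⟩,
  ⟨[7, 25], 840, 0o243403034114332104213113, [0xfac688322a, 0xfac650322c, 0xfab8883232,
   0xfab8503234, 0xf74688324a, 0xf74650324c, 0xf738883252, 0xf738503254, 0xfac6883461,
   0xfac6883662, 0xfac6503664, 0xfaa3183668, 0xfa95183670, 0xbf4688328a, 0xbf4650328c,
   0xbf38883292, 0xbf38503294, 0xdec68834a1, 0xdec68836a2, 0xdec65036a4, 0xdea31836a8,
   0xde951836b0, 0xd7c68834c1, 0xd7c68836c2, 0xd7c65036c4, 0xd7a31836c8, 0xd7951836d0,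
   0xfac68838e0, 0xfac6883b7e, 0xdec6883bbe, 0xd7c6883bde, 0xfac6883deb, 0xfac6503ded,
   0xfac6883fee, 0xfab8883df3, 0xfab8503df5, 0xfab8883ff6, 0xfaa3183ffa, 0xfaa2e03ffc,
   0xfac68841fe]⟩,
  ⟨[7, 56], 280, 0o313233123103143304342203, [0xeb53183649, 0xeb5303364a, 0xeb5223364c,
   0xeb1b183651, 0xeb1b033652, 0xeb1a233654, 0xe8eb183661, 0xe8eb033662, 0xe8ea233664,
   0x5f53183689, 0x5f5303368a, 0x5f5223368c, 0x5f1b183691, 0x5f1b033692, 0x5f1a233694,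
   0x5ceb1836a1, 0x5ceb0336a2, 0x5cea2336a4, 0x8fea8838c1, 0x8fea8138c2, 0x8fea1138c4,
   0x8d11f538c8, 0x8d03f538d0, 0x8c23f538e0, 0xfac68843db, 0xfac65043dd, 0xfac64243de,
   0xfa568843eb, 0xfa565043ed, 0xfa564243ee, 0xfa3a8843f3, 0xfa3a5043f5, 0xfa3a4243f6]⟩,
  ⟨[7, 379], 840, 0o32104344203003414232333, [0xfac68845bd, 0xfac68145be, 0xf7468845dd,
   0xf7468145de, 0xf6668845ed, 0xf6668145ee, 0xf63c8845f5, 0xf63c8145f6, 0xfac68847fc]⟩,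
  ⟨[7, 505], 168, 0o23432134332234104103223, [0xfac642477e, 0xdec64247be, 0xd7c64247de,
   0xd6764247ee, 0xd63e4247f6]⟩,
  ⟨[7, 507], 168, 0o143332132003304103343104, []⟩,
  ⟨[15, 49], 1680, 0o23313333003032413034223, [0xfac6884852, 0xfac6504854, 0xfac2d04858,
   0xfa56884862, 0xfa56504864, 0xfa52d04868, 0xdec6884892, 0xdec6504894, 0xdec2d04898,
   0xde568848a2, 0xde565048a4, 0xde52d048a8, 0xfac6884ac1, 0xfac6884cc2, 0xfac6504cc4,
   0xfac2d04cc8, 0xfac6884ed0, 0xfa56884ee0, 0xfac68851f6, 0xfac4c851fa, 0xfac45851fc]⟩,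
  ⟨[15, 112], 280, 0o414124103243344433144322, [0xbf46884e91, 0xbf46814e92, 0xbf46114e94,
   0xbf40d14e98, 0xbe66884ea1, 0xbe66814ea2, 0xbe66114ea4, 0xbe60d14ea8, 0xb3e6884ec1,
   0xb3e6814ec2, 0xb3e6114ec4, 0xb3e0d14ec8]⟩,
  ⟨[15, 113], 560, 0o332032413033114314214414, [0xfac6885292, 0xfac6505294, 0xfac2d05298,
   0xfa568852a2, 0xfa565052a4, 0xfa52d052a8, 0xf3568852c2, 0xf3565052c4, 0xf352d052c8]⟩,
  ⟨[15, 240], 35, 0o323432113214043423233032, []⟩,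
  ⟨[15, 499], 420, 0o142113232413023323223324, [0xfac68855fc]⟩,
  ⟨[31, 97], 840, 0o333313413324344334314304, [0xfac68856a2, 0xfac65056a4, 0xfac2d056a8,
   0xfa98d056b0, 0xf7468856c2, 0xf7465056c4, 0xf742d056c8, 0xf718d056d0]⟩,
  ⟨[31, 224], 56, 0o113223443032014023403213, []⟩,
  ⟨[31, 225], 280, 0o134232144344223343342104, []⟩,
  ⟨[63, 193], 168, 0o324232333114443003332334, []⟩,
  ⟨[319, 463], 210, 0o234343023032214332423314, [0xfac68859f3, 0xfac65059f5, 0xfac64259f6,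
   0xfac2d059f9, 0xfac2c259fa, 0xfac21a59fc]⟩,
  ⟨[7, 25, 42], 3360, 0o343132104423332213214203, [0xfac6885a34, 0xfac6885c4c, 0xfaa3185c52,
   0xfac6885e54, 0xf953035c61, 0xfa56815e64, 0xfa21595e70, 0xdec6885c8c, 0xdea3185c92,
   0xdec6885e94, 0xdd53035ca1, 0xde56815ea4, 0xde21595eb0, 0xfac68860c1, 0xfa568160c2,
   0xfac68862c4, 0xfa215960c8, 0xfaa31862d0, 0xf9530362e0, 0xfac68865de, 0xfa568165ed,
   0xfa215965f3, 0xfac68867f5, 0xfa568167f6, 0xfa215967fc]⟩,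
  ⟨[7, 25, 97], 840, 0o43203403333434033213303, [0xf953035c2a, 0xf952235c2c, 0xf91b035c32,
   0xf91a235c34, 0xeb53035c4a, 0xeb52235c4c, 0xeb1b035c52, 0xeb1a235c54, 0xbf4688608a,
   0xbf4650608c, 0xbf38886092, 0xbf38506094, 0xb1fc8860a2, 0xb1fc5060a4, 0xb1a3f060a8,
   0xb195f060b0, 0xae7c8860c2, 0xae7c5060c4, 0xae23f060c8, 0xae15f060d0, 0xfac688697e,
   0xfac6886bbe, 0xf746886bde, 0xf1ea886bee, 0xf1dc886bf6, 0xf1a3a86bfa, 0xf1a3706bfc,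
   0xfac6886dfe]⟩,
  ⟨[7, 25, 98], 5040, 0o324233032013234322043443, [0xfa56115e2c, 0xfa3a115e34, 0xf356115e4c,
   0xf33a115e54, 0x9f5681608a, 0xbf4650628c, 0x9f3a816092, 0xbf38506294, 0x95fc8860a1,
   0xb1fc4262a4, 0xfac6886ea8, 0xfab8886eb0, 0x8efc8860c1, 0xae7c4262c4, 0xf746886ec8,
   0xf738886ed0, 0xfac68871be, 0xf7468871de, 0xf1ea8171ed, 0xf1dc8171f5, 0xfac68873fc]⟩,
  ⟨[7, 25, 224], 840, 0o403414233113032304144303, [0xf95303622a, 0xf95223622c, 0xf91b036232,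
   0xf91a236234, 0xeb5303624a, 0xeb5223624c, 0xeb1b036252, 0xeb1a236254, 0x5f5303628a,
   0x5f5223628c, 0x5f1b036292, 0x5f1a236294, 0xfac688757e, 0xdec68875be, 0xd7c68875de]⟩,
  ⟨[7, 25, 382], 2520, 0o323114103423203214032313, [0xfac68877eb, 0xfac65077ed, 0xfab88877f3,
   0xfab85077f5]⟩,
  ⟨[7, 25, 491], 3360, 0o403142434343103114234342, [0xfac688777e, 0xdec68877be, 0xd7c68877de,
   0xfac68879f5, 0xfac6887bf6, 0xfaa3187bfc]⟩,
  ⟨[7, 25, 494], 3360, 0o403243134334213104103343, [0xfab8887bf3, 0xfab8507bf5]⟩,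
  ⟨[7, 25, 510], 840, 0o33003143103213344243323, []⟩,
  ⟨[7, 56, 475], 2520, 0o103014413013322124342233, [0xfac6887ded, 0xfac6817dee, 0xfab8887df5,
   0xfab8817df6]⟩,
  ⟨[7, 379, 445], 3360, 0o434413124123113432142032, [0xfac6887fde, 0xfa56887fee, 0xfa3a887ff6]⟩,
  ⟨[7, 379, 508], 840, 0o124243234313133104324434, []⟩,
  ⟨[15, 49, 82], 10080, 0o114324223142104213313304, [0xfac6888064, 0xfac4c88068, 0xfac6888294,
   0xfac4c88298, 0xfac68884a2, 0xfac68886a4, 0xfac4c886a8, 0xf7468184c1, 0xf7468186c4,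
   0xf744c186c8, 0xfac68888e0, 0xfac6888bfc]⟩,
  ⟨[15, 49, 193], 840, 0o234324014104313043134132, [0xf746818452, 0xf746118454, 0xf740d18458,
   0xf666818462, 0xf666118464, 0xf660d18468, 0xbf46818492, 0xbf46118494, 0xbf40d18498,
   0xbe668184a2, 0xbe661184a4, 0xbe60d184a8, 0xfac6888df6, 0xfac4c88dfa, 0xfac4588dfc]⟩,
  ⟨[15, 49, 194], 2520, 0o123233132313333113332223, [0xf746118654, 0xf740d18658, 0xf666118664,
   0xf660d18668, 0xbf46118694, 0xbf40d18698, 0xbe661186a4, 0xbe60d186a8, 0xfac6888ffc]⟩,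
  ⟨[15, 49, 208], 3360, 0o32203124013434232343333, [0xfa56888862, 0xfa56508864, 0xfa52d08868,
   0xde568888a2, 0xde565088a4, 0xde52d088a8]⟩,
  ⟨[15, 49, 502], 5040, 0o423414403123214034132304, []⟩,
  ⟨[15, 113, 146], 5040, 0o233332113333132313133223, [0xfac68890a4, 0xfac4c890a8, 0xf7468890c4,
   0xf744c890c8]⟩,
  ⟨[15, 499, 508], 210, 0o443043333133013413104304, []⟩,
  ⟨[31, 97, 162], 3360, 0o203123014414223032033034, [0xfac68892c4, 0xfac4c892c8, 0xfaa8c892d0]⟩,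
  ⟨[319, 463, 499], 420, 0o234014433144403323134123, [0xfac68895fc]⟩,
  ⟨[7, 25, 42, 52], 840, 0o304134034232032113033142, [0xfac688964c, 0xfab8509652, 0xf9d8429661,
   0xdec688968c, 0xdeb8509692, 0xddd84296a1, 0xfac68898c1, 0xfa568198c2, 0xfa3a1198c4,
   0xfa215998c8, 0xfa04e998d0, 0xf844cd98e0, 0xfac6889bde, 0xfa56819bed, 0xfa3a119bf3]⟩,
  ⟨[7, 25, 42, 76], 6720, 0o344114033234134232323434, [0xfac6889634, 0xf746509652, 0xf666429661,
   0xfac6889c70, 0xfac6889e92, 0xf746509e94, 0xfa56819ea1, 0xf666429ea4, 0xfac688a0b0,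
   0xf356119ec1, 0xf2e60a9ec2, 0xf74650a0d0, 0xf66642a0e0, 0xfac688a3f3, 0xf74650a3f5,
   0xf66642a3f6]⟩,
  ⟨[7, 25, 42, 84], 10080, 0o433123132314014413104322, [0xf953039c61, 0xbf46509e8c, 0xbbb8889e92,
   0xdd5303a0a1, 0xfac688a4a4, 0xfaa318a4b0, 0xcb9a23a0c1, 0xf73850a4c2, 0xf714e0a4c8,
   0xfac688a6e0, 0xfac688a9ed, 0xf73850a9f3]⟩,
  ⟨[7, 25, 42, 193], 10080, 0o13113234423203333232313, [0xfac6889834, 0xf356119e4c, 0xf305599e52,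
   0xcb9a23a054, 0xf5e842a464, 0xf591a2a470, 0x9f56119e8c, 0x9f05599e92, 0x5b9a23a094,
   0xbde842a4a4, 0xbd91a2a4b0, 0xfac688abde, 0xfac688adf6, 0xfaa318adfc]⟩,
  ⟨[7, 25, 42, 196], 10080, 0o344334443104043304143142, [0xfa3a119834, 0xf71518a052, 0xf4e503a061,
   0xfa2159a670, 0xbf1518a092, 0xbce503a0a1, 0xde2159a6b0, 0xfac688aff3]⟩,
  ⟨[7, 25, 42, 478], 10080, 0o214233303342003304403123, [0xfac688b1ed, 0xfaa318b1f3,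
   0xfac688b3f5]⟩,
  ⟨[7, 25, 42, 501], 10080, 0o304134323403303014414322, [0xfac688b3de]⟩,
  ⟨[7, 25, 97, 382], 840, 0o334232434423132144033333, []⟩,
  ⟨[7, 25, 97, 446], 5040, 0o203432423322214333434414, []⟩,
  ⟨[7, 25, 97, 510], 840, 0o113433432234213132133223, []⟩,
  ⟨[7, 25, 98, 168], 5040, 0o124413232142144123403304, [0xf91a23a434, 0xe6e41ca44c, 0xf33a11a654,
   0x3e8794a492, 0x9f04e9a694, 0x21fba2a4c1, 0x817ccda6c4, 0x1133f5a6d0, 0xfac688b5de,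
   0xf1ea81b5f5]⟩,
  ⟨[7, 25, 98, 446], 20160, 0o114033413013333314032124, [0xfac688b7ed, 0xfab888b7f5]⟩,
  ⟨[7, 25, 98, 508], 5040, 0o33304113243344043313403, []⟩,
  ⟨[7, 25, 224, 382], 2520, 0o443423433213114313134132, []⟩,
  ⟨[7, 25, 382, 491], 10080, 0o313304334103133003144123, [0xfac688b9f5]⟩,
  ⟨[7, 25, 491, 501], 1680, 0o304133313124023144414324, [0xfac688b97e, 0xdec688b9be,
   0xd7c688b9de]⟩,
  ⟨[7, 25, 491, 502], 6720, 0o433443003103344304013104, []⟩,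
  ⟨[7, 56, 475, 493], 5040, 0o304443324423123114144104, [0xfac688bbf6]⟩,
  ⟨[7, 379, 445, 478], 3360, 0o304403432132213344233433, []⟩,
  ⟨[15, 49, 82, 100], 6720, 0o344323322414213123303114, [0xfac688bc94, 0xfac688be98, 0xfa5650bca2,
   0xfa5650bea8, 0xf35642bcc1, 0xf35642bec8]⟩,
  ⟨[15, 49, 82, 148], 6720, 0o34114304113434014223013, [0xfac688bc64, 0xfac4c8be68, 0xdec650bca2,
   0xdec458bea8, 0xd7c642bcc1, 0xd7c443bec8, 0xfac688c0e0]⟩,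
  ⟨[15, 49, 82, 162], 10080, 0o213132113133323333313232, [0xfa5650bc64, 0xfa52d0bc68,
   0xdec650bc94, 0xdec2d0bc98, 0xfac688c2c1, 0xfac688c4c4, 0xfac4c8c4c8, 0xfac688c7fc]⟩,
  ⟨[15, 49, 82, 164], 20160, 0o332133213313123323223322, [0xfa52d0be68, 0xdec298be98,
   0xf74681c4c1, 0xfac688c8c8]⟩,
  ⟨[15, 49, 82, 224], 10080, 0o233132323313113332223333, [0xfac688c094, 0xfac4c8c098]⟩,
  ⟨[15, 49, 82, 508], 10080, 0o13213203142134132133043, []⟩,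
  ⟨[15, 49, 193, 502], 2520, 0o434324432342124344234332, []⟩,
  ⟨[15, 49, 194, 508], 2520, 0o213303043003133113123232, []⟩,
  ⟨[15, 113, 146, 164], 10080, 0o213333322233123113232133, [0xfac688cac8]⟩,
  ⟨[31, 97, 162, 196], 3360, 0o223213403103123232133014, []⟩,
  ⟨[319, 463, 499, 508], 105, 0o234213323414334304123014, []⟩,
  ⟨[7, 25, 42, 52, 76], 5040, 0o342304132043413313143234, [0xfac688cc52, 0xfa5681cc61,
   0xfac688ce92, 0xfa5681cea1, 0xfac688d0c1, 0xfa5681d0c2, 0xfa04e9d0d0, 0xf844cdd0e0,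
   0xfac688d3f3]⟩,
  ⟨[7, 25, 42, 52, 193], 5040, 0o113213233333323133132313, [0xfac688d04c, 0xfab850d052,
   0xdec688d08c, 0xdeb850d092, 0xfac688d5de]⟩,
  ⟨[7, 25, 42, 52, 478], 2520, 0o323314034434014334113223, [0xfac688d7ed, 0xfab850d7f3]⟩,
  ⟨[7, 25, 42, 76, 112], 3360, 0o413223123324214232313434, [0xfac688d892, 0xf74650d894,
   0xfa5681d8a1, 0xf66642d8a4, 0xf35611d8c1, 0xf2e60ad8c2]⟩,
  ⟨[7, 25, 42, 76, 146], 20160, 0o332133233323232113213313, [0xfac688ce34, 0xf66642d061,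
   0xfac688d870, 0xbe119ad0a1, 0xdea318d8a4, 0x5b894bd8c1, 0xfac688dae0, 0xfac688ddf5]⟩,
  ⟨[7, 25, 42, 76, 176], 20160, 0o413133423232322344124332, [0xf30559d052, 0xe46762d061,
   0xf35611dac1, 0xf2e60adac2]⟩,
  ⟨[7, 25, 42, 76, 499], 20160, 0o334023032343303104113313, []⟩,
  ⟨[7, 25, 42, 84, 164], 20160, 0o234432124142114332144034, [0xf4e503d861, 0xbf1518d892,
   0x434ee9dac1, 0xa6ecddac2, 0xfac688dec8, 0xfac688e1f3]⟩,
  ⟨[7, 25, 42, 84, 224], 10080, 0o342132232013313103323213, [0xbf4650da8c, 0xbbb888da92]⟩,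
  ⟨[7, 25, 42, 84, 493], 20160, 0o34432313324434114414214, [0xfac688e3f3]⟩,
  ⟨[7, 25, 42, 193, 478], 10080, 0o3144434304323332232342, []⟩,
  ⟨[7, 25, 42, 193, 502], 20160, 0o33133243234123334003333, []⟩,
  ⟨[7, 25, 42, 196, 499], 10080, 0o334214314143043342223343, []⟩,
  ⟨[7, 25, 42, 478, 493], 10080, 0o142103303344033043132133, [0xfac688e5f3]⟩,
  ⟨[7, 25, 42, 478, 501], 10080, 0o14304113403223124114134, []⟩,
  ⟨[7, 25, 98, 168, 478], 10080, 0o133313113233123323213332, [0xfac688e7f5]⟩,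
  ⟨[7, 25, 98, 446, 493], 20160, 0o303234213314304434214324, []⟩,
  ⟨[7, 25, 382, 491, 501], 5040, 0o142333214314434144243342, []⟩,
  ⟨[7, 56, 475, 493, 502], 1680, 0o322123134043132333003113, []⟩,
  ⟨[15, 49, 82, 100, 148], 20160, 0o233313113133332322132232, [0xfac688e8a2, 0xfac688eaa8,
   0xf74681e8c1, 0xf74681eac8]⟩,
  ⟨[15, 49, 82, 100, 152], 20160, 0o113323233232133132313223, [0xfa5650eaa2, 0xf35642eac1]⟩,
  ⟨[15, 49, 82, 148, 224], 6720, 0o233332123223313213113322, []⟩,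
  ⟨[15, 49, 82, 162, 193], 2520, 0o144142034032003333332223, [0xf66611e864, 0xf660d1e868,
   0xbf4611e894, 0xbf40d1e898, 0xfac688edfc]⟩,
  ⟨[15, 49, 82, 162, 196], 10080, 0o323123333133213223232233, [0xf660d1ea68, 0xbf40d1ea98]⟩,
  ⟨[15, 49, 82, 162, 508], 10080, 0o123132323313113332223333, []⟩,
  ⟨[15, 49, 82, 164, 200], 5040, 0o132343323223433233344322, []⟩,
  ⟨[15, 113, 146, 164, 200], 3360, 0o123223213233322132332232, []⟩,
  ⟨[7, 25, 42, 52, 76, 82], 1680, 0o413232333144003033114123, [0xfac688ee61, 0xfac688f0a1,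
   0xf73888f0c1, 0xf4350ef0e0]⟩,
  ⟨[7, 25, 42, 52, 76, 146], 5040, 0o342123114232324124432334, [0xfa5681f061, 0xde3a11f0a1,
   0xfac688f2c1, 0xf844cdf2e0]⟩,
  ⟨[7, 25, 42, 52, 76, 193], 20160, 0o123213333313223232332132, [0xf73888f052, 0xfac688f292]⟩,
  ⟨[7, 25, 42, 52, 76, 499], 5040, 0o403343232342123332133243, []⟩,
  ⟨[7, 25, 42, 52, 193, 478], 5040, 0o332323133113313123132213, []⟩,
  ⟨[7, 25, 42, 52, 478, 493], 2520, 0o43303014132143104113413, [0xfac688f5f3]⟩,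
  ⟨[7, 25, 42, 76, 112, 146], 20160, 0o213323333313223123113133, [0xb9a1e1f2a1, 0xfac688f6a4,
   0xf35611f6c1]⟩,
  ⟨[7, 25, 42, 76, 146, 224], 20160, 0o332213323233322113123133, [0xf844cdf234]⟩,
  ⟨[7, 25, 42, 76, 146, 501], 20160, 0o213434432332313303103203, []⟩,
  ⟨[7, 25, 42, 84, 164, 200], 3360, 0o232324203303304243443143, [0xd5f881f661, 0xbbb888f692,
   0xfac688f9f3]⟩,
  ⟨[7, 25, 42, 84, 164, 499], 20160, 0o133313233213332322123323, []⟩,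
  ⟨[7, 25, 42, 84, 493, 499], 10080, 0o304034123142324114023313, []⟩,
  ⟨[7, 25, 42, 478, 493, 499], 3360, 0o144103213033232142203043, []⟩,
  ⟨[7, 25, 98, 168, 478, 501], 5040, 0o132123133323313332113333, []⟩,
  ⟨[15, 49, 82, 100, 148, 162], 10080, 0o233332223322313333232323, [0xd63e88fac1, 0xfac688fcc8]⟩,
  ⟨[15, 49, 82, 100, 148, 168], 20160, 0o133213322223333313232323, [0xf74681fcc1]⟩,
  ⟨[15, 49, 82, 162, 193, 508], 2520, 0o213113233333123323223322, []⟩,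
  -- The Fano plane on the labels `0, …, 6`, with the label `7` on no line.
  ⟨[7, 25, 42, 52, 76, 82, 97], 240, 0, []⟩,
  ⟨[7, 25, 42, 52, 76, 82, 161], 5040, 0o313123323132332233213232, []⟩,
  ⟨[7, 25, 42, 52, 76, 146, 193], 10080, 0o233332313223322132213123, []⟩,
  -- The complete quadrilateral with three conics through `6` and `7`, each omitting a pair of
  -- opposite vertices.
  ⟨[7, 25, 42, 52, 478, 493, 499], 840, 0, []⟩,
  ⟨[7, 25, 42, 76, 112, 146, 164], 6720, 0o332133223132233333232323, [0xfac688fec1]⟩,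
  ⟨[7, 25, 42, 84, 164, 200, 499], 3360, 0o123133332333232233132323, []⟩,
  -- The Fano plane with the label `7` added to one of its lines.
  ⟨[135, 25, 42, 52, 76, 82, 97], 1680, 0, []⟩,
  ⟨[15, 49, 82, 100, 148, 162, 200], 5040, 0o233323333223132232322332, []⟩,
  -- The Möbius–Kantor configuration, which has coordinates over the complex numbers only.
  ⟨[7, 25, 42, 76, 112, 146, 164, 193], 840, 0, []⟩]

end Quatroid

/-! ### Certificates for the table -/

namespace Quatroid

/-- The data of the orbit with index `i`. -/
def classAt (i : ℕ) : ClassData := classTable.getD i ⟨[], 0, 0, []⟩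

/-- The code of the new block of an extension. -/
def extBlock (n : ℕ) : ℕ := Nat.land n 511

/-- The index of the orbit of an extension. -/
def extClass (n : ℕ) : ℕ := Nat.land (Nat.shiftRight n 9) 127

/-- The permutation that maps an extension to its representative. -/
def extPerm (n : ℕ) : ℕ := Nat.shiftRight n 16

/-- The extensions of the representative with index `i` are complete and correct. -/
def checkExtensions (i : ℕ) (c : ClassData) : Bool :=
  codeClique c.blocks && extensionCodes c.blocks == c.extensions.map extBlock &&
    -- Extensions lead to larger indices only, so the recursion for the sizes determines them one
    -- after another.
    c.extensions.all fun n => Nat.blt i (extClass n) && Nat.beq (codeImage (extPerm n) 255) 255 &&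
      Nat.beq (listMask ((extBlock n :: c.blocks).map (codeImage (extPerm n))))
        (listMask (classAt (extClass n)).blocks)

/-- Numbers are pairwise distinct, and not among the digits of `mask`. -/
def allDistinct : List ℕ → ℕ → Bool
  | [], _ => true
  | n :: l, mask => Nat.beq (Nat.land (Nat.shiftRight mask n) 1) 0 &&
      allDistinct l (Nat.lor mask (Nat.shiftLeft 1 n))

/-- The number of extensions that lead to the orbit with index `i`. -/
def countExtensions (i : ℕ) (c : ClassData) : ℕ :=
  (c.extensions.filter fun n => Nat.beq (extClass n) i).length

/-- The sizes of the orbits satisfy the recursion. -/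
def checkSize (i : ℕ) (c : ClassData) : Bool :=
  Nat.ble 1 (codeTop c.blocks) && Nat.beq (Nat.mul c.size (codeTop c.blocks))
    (classTable.foldr (fun d a => Nat.add (Nat.mul d.size (countExtensions i d)) a) 0)

theorem checkExtensions_classTable :
    ((List.range 128).all fun i => checkExtensions i (classAt i)) = true := by
  decide +kernel

/-- The 128 invariants stay distinct modulo 1556, which keeps the bit mask of the values already
seen short. -/
theorem allDistinct_codeInvariant :
    allDistinct ((List.range 128).map fun i => codeInvariant (classAt i).blocks % 1556) 0 =
      true := by
  decide +kernel

/-- Index 0 is left out: the empty family has no block of the largest rank, and its orbit of size 1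
starts the recursion. -/
theorem checkSize_classTable :
    ((List.range 127).all fun i => checkSize (i + 1) (classAt (i + 1))) = true := by
  decide +kernel

end Quatroid

/-! ### The classification of cliques and the sizes of their orbits -/

namespace Quatroid

theorem allDistinct_iff (l : List ℕ) (mask : ℕ) (h : allDistinct l mask = true) :
    l.Nodup ∧ ∀ n ∈ l, mask.testBit n = false := by
  induction l generalizing mask with
  | nil => simp
  | cons n l ih =>
    rw [allDistinct, Bool.and_eq_true, Nat.beq_eq] at h
    obtain ⟨h1, h2⟩ := ih _ h.2
    have h3 : ∀ m, (Nat.lor mask (Nat.shiftLeft 1 n)).testBit m =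
        (mask.testBit m || decide (n = m)) := by
      intro m
      change (mask ||| 1 <<< n).testBit m = _
      rw [Nat.testBit_or, Nat.one_shiftLeft, Nat.testBit_two_pow]
    have h4 : mask.testBit n = false := by
      have h5 : mask >>> n &&& 1 = 0 := h.1
      rw [Nat.and_one_is_mod, Nat.shiftRight_eq_div_pow, ← Nat.toNat_testBit] at h5
      simpa using h5
    refine ⟨List.nodup_cons.2 ⟨fun hn => ?_, h1⟩, ?_⟩
    · have := h2 n hn
      rw [h3] at this
      simp at this
    · intro m hm
      rcases List.mem_cons.1 hm with rfl | hm
      · exact h4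
      · have := h2 m hm
        rw [h3] at this
        exact (Bool.or_eq_false_iff.1 this).1

/-- The representatives of the orbits of cliques. -/
def classFamily (i : Fin 128) : Finset Block := decode (classAt i).blocks

theorem checkExtensions_classAt (i : Fin 128) : checkExtensions i (classAt i) = true :=
  List.all_eq_true.1 checkExtensions_classTable i (List.mem_range.2 i.2)

theorem codeClique_classAt (i : Fin 128) : codeClique (classAt i).blocks = true := by
  have := checkExtensions_classAt i
  rw [checkExtensions, Bool.and_eq_true, Bool.and_eq_true] at this
  exact this.1.1

theorem blocks_lt (i : Fin 128) : ∀ n ∈ (classAt i).blocks, n < 512 :=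
  (codeClique_iff _ (codeClique_classAt i)).1

theorem blocks_nodup (i : Fin 128) : (classAt i).blocks.Nodup :=
  (codeClique_iff _ (codeClique_classAt i)).2.1

theorem isClique_classFamily (i : Fin 128) : IsClique (classFamily i) :=
  (codeClique_iff _ (codeClique_classAt i)).2.2

theorem extensionCodes_classAt (i : Fin 128) :
    extensionCodes (classAt i).blocks = (classAt i).extensions.map extBlock := by
  have := checkExtensions_classAt i
  rw [checkExtensions, Bool.and_eq_true, Bool.and_eq_true] at this
  exact beq_iff_eq.1 this.1.2

theorem extClass_lt (n : ℕ) : extClass n < 128 := by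
  change n >>> 9 &&& (2 ^ 7 - 1) < 128
  rw [Nat.and_two_pow_sub_one_eq_mod]
  exact Nat.mod_lt _ (by norm_num)

theorem extClass_spec (i : Fin 128) {n : ℕ} (hn : n ∈ (classAt i).extensions) :
    (i : ℕ) < extClass n ∧ ∃ σ : Equiv.Perm (Fin 8),
      σ • insert (decodeBlock (extBlock n)) (classFamily i) =
        classFamily ⟨extClass n, extClass_lt n⟩ := by
  have := checkExtensions_classAt i
  rw [checkExtensions, Bool.and_eq_true, List.all_eq_true] at this
  have h := this.2 n hn
  rw [Bool.and_eq_true, Bool.and_eq_true, Nat.blt_eq, Nat.beq_eq, Nat.beq_eq] at h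
  obtain ⟨σ, hσ⟩ := smul_decode_of_listMask h.1.2 h.2
  refine ⟨h.1.1, σ, ?_⟩
  have : insert (decodeBlock (extBlock n)) (classFamily i) =
      decode (extBlock n :: (classAt i).blocks) := by
    simp [classFamily, decode]
  rw [this, hσ]
  rfl

theorem isExtension_classFamily {i : Fin 128} {b : Block} :
    IsExtension (classFamily i) b ↔
      ∃ n ∈ (classAt i).extensions, decodeBlock (extBlock n) = b := by
  have key : ∀ m, m ∈ extensionCodes (classAt i).blocks ↔ _ :=
    fun m => mem_extensionCodes (blocks_lt i) (n := m)
  rw [extensionCodes_classAt] at key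
  constructor
  · intro h
    obtain ⟨m, hm, rfl⟩ := exists_decodeBlock b
    obtain ⟨n, hn, rfl⟩ := List.mem_map.1 ((key m).2 ⟨hm, h⟩)
    exact ⟨n, hn, rfl⟩
  · rintro ⟨n, hn, rfl⟩
    exact ((key _).1 (List.mem_map_of_mem hn)).2

theorem classFamily_injective (i j : Fin 128) (σ : Equiv.Perm (Fin 8))
    (h : σ • classFamily i = classFamily j) : i = j := by
  have hd := (allDistinct_iff _ _ allDistinct_codeInvariant).1
  have := congrArg orbitInvariant h
  rw [orbitInvariant_smul, classFamily, classFamily,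
    ← codeInvariant_eq (blocks_lt i) (blocks_nodup i),
    ← codeInvariant_eq (blocks_lt j) (blocks_nodup j)] at this
  exact Fin.ext (List.inj_on_of_nodup_map hd (List.mem_range.2 i.2) (List.mem_range.2 j.2)
    (congrArg (· % 1556) this))

theorem exists_extension_classFamily (i : Fin 128) (b : Block)
    (h : IsExtension (classFamily i) b) :
    ∃ j, ∃ σ : Equiv.Perm (Fin 8), σ • insert b (classFamily i) = classFamily j := by
  obtain ⟨n, hn, rfl⟩ := isExtension_classFamily.1 h
  exact ⟨_, (extClass_spec i hn).2⟩

theorem classFamily_zero : classFamily 0 = ∅ := by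
  have : (classAt 0).blocks = [] := by decide +kernel
  change decode (classAt 0).blocks = ∅
  rw [this]
  rfl

theorem exists_smul_classFamily {X : Finset Block} (hX : IsClique X) :
    ∃ i, ∃ σ : Equiv.Perm (Fin 8), σ • classFamily i = X :=
  exists_smul_of_isClique ⟨0, classFamily_zero⟩ exists_extension_classFamily hX

theorem map_classAt_range : (List.range 128).map classAt = classTable :=
  List.ext_getElem (by rw [List.length_map, List.length_range]; decide +kernel) fun i h₁ h₂ => by
    rw [List.getElem_map, List.getElem_range, classAt, List.getD_eq_getElem _ _ h₂]

/-- Strong induction on the index. The double counting identity expresses the size of an orbit,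
times a positive number of top blocks, through the sizes of orbits with smaller index; the tabulated
sizes satisfy the same recursion. -/
theorem card_orbit_classFamily (i : Fin 128) :
    (orbitFinset (Equiv.Perm (Fin 8)) (classFamily i)).card = (classAt i).size := by
  classical
  let E : Fin 128 → Fin 128 → Finset Block := fun k j =>
    (((classAt k).extensions.filter fun n => Nat.beq (extClass n) j).map
      fun n => decodeBlock (extBlock n)).toFinset
  have hE : ∀ k j b, b ∈ E k j ↔ IsExtension (classFamily k) b ∧
      ∃ σ : Equiv.Perm (Fin 8), σ • insert b (classFamily k) = classFamily j := by
    intro k j b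
    simp only [E, List.mem_toFinset, List.mem_map, List.mem_filter, Nat.beq_eq,
      isExtension_classFamily]
    constructor
    · rintro ⟨n, ⟨hn, hj⟩, rfl⟩
      refine ⟨⟨n, hn, rfl⟩, ?_⟩
      obtain ⟨σ, hσ⟩ := (extClass_spec k hn).2
      exact ⟨σ, hσ.trans (congrArg classFamily (Fin.ext hj))⟩
    · rintro ⟨⟨n, hn, rfl⟩, σ, hσ⟩
      refine ⟨n, ⟨hn, ?_⟩, rfl⟩
      obtain ⟨τ, hτ⟩ := (extClass_spec k hn).2
      -- An extension is equivalent to only one representative, so the recorded index has to be `j`.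
      have := classFamily_injective ⟨extClass n, extClass_lt n⟩ j (σ * τ⁻¹) (by
        rw [mul_smul, ← hτ, inv_smul_smul, hσ])
      exact congrArg Fin.val this
  have hm : ∀ k j : Fin 128, (E k j).card = countExtensions j (classAt k) := by
    intro k j
    have hnd : ((classAt k).extensions.map extBlock).Nodup := by
      rw [← extensionCodes_classAt]
      exact (List.nodup_range.filter _).filter _
    have hlt : ∀ n ∈ (classAt k).extensions.map extBlock, n < 512 := by
      intro n hn
      rw [← extensionCodes_classAt] at hn
      exact ((mem_extensionCodes (blocks_lt k)).1 hn).1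
    have hnd' := nodup_map_decodeBlock hlt hnd
    rw [List.map_map] at hnd'
    exact (List.toFinset_card_of_nodup
      (List.Nodup.sublist (List.Sublist.map _ List.filter_sublist) hnd')).trans (List.length_map _)
  have hrec := card_orbitFinset_mul_card_topBlocks classFamily_injective isClique_classFamily
    ⟨0, classFamily_zero⟩ exists_extension_classFamily
    (fun k j => countExtensions j (classAt k)) E hE hm
  induction hn : i.val using Nat.strong_induction_on generalizing i with
  | _ n ih =>
    subst hn
    rcases Nat.eq_zero_or_pos i with hi | hi
    · obtain rfl : i = 0 := Fin.ext hi
      have h1 : (classAt (0 : Fin 128)).size = 1 := by decide +kernel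
      rw [h1, classFamily_zero, Finset.card_eq_one]
      refine ⟨∅, ?_⟩
      ext X
      simp [mem_orbitFinset, eq_comm]
    · have hc := List.all_eq_true.1 checkSize_classTable (i - 1) (List.mem_range.2 (by omega))
      rw [Nat.sub_add_cancel hi, checkSize, Bool.and_eq_true, Nat.ble_eq, Nat.beq_eq,
        foldr_add_eq_sum, ← map_classAt_range, List.map_map,
        ← List.sum_toFinset _ List.nodup_range, List.toFinset_range, Finset.sum_range] at hc
      have hr := hrec i
      rw [classFamily, card_topBlocks_decode (blocks_lt i) (blocks_nodup i)] at hr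
      apply Nat.eq_of_mul_eq_mul_right hc.1
      refine hr.trans (Eq.trans ?_ hc.2.symm)
      refine Finset.sum_congr rfl fun k _ => ?_
      by_cases hk : k < i
      · rw [ih k hk k rfl]
        rfl
      -- An orbit of index `k ≥ i` has no extension of index `i`, so its term vanishes and no size
      -- is needed for it.
      · have : countExtensions i (classAt k) = 0 := by
          rw [countExtensions, List.length_eq_zero_iff, List.filter_eq_nil_iff]
          intro n hn hb
          have := (extClass_spec k hn).1
          rw [Nat.eq_of_beq_eq_true hb] at this
          exact hk this
        simp [this]

end Quatroid

/-! ### Verification of explicit realizations -/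

namespace Quatroid

/-- The positions of the ones among the last eight binary digits. -/
def bitList (n : ℕ) : List ℕ :=
  (List.range 8).filter fun k => Nat.beq (Nat.land (Nat.shiftRight n k) 1) 1

/-- The codes of the subsets of the label set with `k` elements. -/
def subsetCodes (k : ℕ) : List ℕ := (List.range 256).filter fun n => Nat.beq (bitCount n) k

/-- Does a block of the given type contain the set with code `s`? -/
def coveredBy (κ : ℕ) (l : List ℕ) (s : ℕ) : Bool :=
  l.any fun n => Nat.beq (conicBit n) κ && Nat.beq (Nat.land n s) s

/-- Does a line contain three elements of the set with code `s`? -/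
def hasLine (l : List ℕ) (s : ℕ) : Bool :=
  l.any fun n => Nat.beq (conicBit n) 0 && Nat.ble 3 (bitCount (Nat.land n s))

section
variable {R : Type} [CommRing R] [DecidableEq R]

/-- The points are distinct. -/
def checkPair (v : ℕ → Fin 3 → R) : List ℕ → Bool
  | [i, j] => !(decide (v i 1 * v j 2 - v i 2 * v j 1 = 0) &&
      decide (v i 2 * v j 0 - v i 0 * v j 2 = 0) && decide (v i 0 * v j 1 - v i 1 * v j 0 = 0))
  | _ => false

/-- The three points are collinear exactly if `b` is true. -/
def checkTriple (v : ℕ → Fin 3 → R) (b : Bool) : List ℕ → Bool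
  | [i, j, k] => b == decide (bracket (v i) (v j) (v k) = 0)
  | _ => false

/-- The six points satisfy the conic condition exactly if `b` is true. -/
def checkSextuple (v : ℕ → Fin 3 → R) (b : Bool) : List ℕ → Bool
  | [i, j, k, l, m, n] =>
      b == decide (conicBracket (v i) (v j) (v k) (v l) (v m) (v n) = 0)
  | _ => false

/-- The vectors are coordinates of points that realize the family with the given codes. -/
def checkRealization (l : List ℕ) (v : ℕ → Fin 3 → R) : Bool :=
  ((subsetCodes 2).all fun s => checkPair v (bitList s)) &&
  ((subsetCodes 3).all fun s => checkTriple v (coveredBy 0 l s) (bitList s)) &&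
  -- A sextuple with three collinear labels lies on no irreducible conic, whatever its
  -- `conicBracket`; it only has to be absent from the conics of the family.
  ((subsetCodes 6).all fun s => cond (hasLine l s) (!coveredBy 1 l s)
    (checkSextuple v (coveredBy 1 l s) (bitList s)))

end

/-- The integer coordinates stored in a table entry. -/
def tableCoord (c k : ℕ) (i : Fin 3) : ℤ :=
  Int.subNatNat (Nat.land (Nat.shiftRight c (Nat.mul 3 (Nat.add (Nat.mul 3 k) i))) 7) 2

/-- The indices of the orbits without integer coordinates. -/
def exceptional : List ℕ := [119, 122, 125, 127]

theorem checkRealization_classTable : ((List.range 128).all fun i =>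
    exceptional.any (Nat.beq i) ||
      checkRealization (classAt i).blocks (tableCoord (classAt i).coords)) = true := by
  decide +kernel

end Quatroid

namespace Quatroid

theorem mem_bitList {n k : ℕ} : k ∈ bitList n ↔ k < 8 ∧ n.testBit k = true := by
  rw [bitList, List.mem_filter, List.mem_range, Nat.beq_eq]
  refine and_congr Iff.rfl ?_
  change n >>> k &&& 1 = 1 ↔ _
  rw [Nat.and_one_is_mod, Nat.shiftRight_eq_div_pow, ← Nat.toNat_testBit]
  cases n.testBit k <;> simp

theorem nodup_bitList (n : ℕ) : (bitList n).Nodup := List.nodup_range.filter _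

/-- The set `S` has the code `n`. -/
def IsCode (n : ℕ) (S : Finset (Fin 8)) : Prop :=
  n < 2 ^ 8 ∧ ∀ i : Fin 8, n.testBit i = true ↔ i ∈ S

theorem IsCode.bitCount {n : ℕ} {S : Finset (Fin 8)} (h : IsCode n S) : bitCount n = S.card := by
  rw [← card_filter_testBit]
  congr 1
  ext i
  simp [h.2 i]

theorem exists_isCode {k : ℕ} {S : Finset (Fin 8)} (hS : S.card = k) :
    ∃ n ∈ subsetCodes k, IsCode n S := by
  obtain ⟨n, hn⟩ := exists_testBit_iff S
  refine ⟨n, List.mem_filter.2 ⟨List.mem_range.2 hn.1, ?_⟩, hn⟩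
  rw [Nat.beq_eq, IsCode.bitCount hn, hS]

theorem IsCode.mem_iff {n : ℕ} {S : Finset (Fin 8)} (h : IsCode n S) {i : Fin 8} :
    i ∈ S ↔ (i : ℕ) ∈ bitList n := by
  rw [mem_bitList, h.2]
  simp [i.2]

theorem coveredBy_iff {κ : Bool} {l : List ℕ} {n : ℕ} {S : Finset (Fin 8)} (h : IsCode n S) :
    coveredBy κ.toNat l n = true ↔ ∃ s ∈ {s | (⟨κ, s⟩ : Block) ∈ decode l}, S ⊆ s := by
  have key : ∀ m, Nat.land m n = n ↔ S ⊆ (decodeBlock m).points := by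
    intro m
    change m &&& n = n ↔ _
    constructor
    · intro hm i hi
      rw [← h.2, ← hm, Nat.testBit_and, Bool.and_eq_true] at hi
      exact mem_points_decodeBlock.2 hi.1
    · intro hs
      refine Nat.eq_of_testBit_eq fun i => ?_
      rw [Nat.testBit_and]
      by_cases hi : i < 8
      · have h1 := h.2 ⟨i, hi⟩
        by_cases hiS : (⟨i, hi⟩ : Fin 8) ∈ S
        · have h2 : m.testBit i = true := mem_points_decodeBlock.1 (hs hiS)
          rw [h2, Bool.true_and]
        · have h2 : n.testBit i = false := Bool.eq_false_iff.2 fun h3 => hiS (h1.1 h3)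
          rw [h2, Bool.and_false]
      · have h2 : n.testBit i = false := Nat.testBit_lt_two_pow
          (h.1.trans_le (Nat.pow_le_pow_right (by norm_num) (by omega)))
        rw [h2, Bool.and_false]
  simp only [coveredBy, List.any_eq_true, Bool.and_eq_true, Nat.beq_eq, key,
    ← toNat_isConic_decodeBlock, Set.mem_ofPred_eq, mem_decode]
  constructor
  · rintro ⟨m, hm, hκ, hs⟩
    have h1 : (decodeBlock m).isConic = κ := by
      cases h2 : (decodeBlock m).isConic <;> cases κ <;> simp [h2] at hκ ⊢
    exact ⟨_, ⟨m, hm, Block.ext h1 rfl⟩, hs⟩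
  · rintro ⟨s, ⟨m, hm, hb⟩, hs⟩
    exact ⟨m, hm, by rw [hb], by rw [hb]; exact hs⟩

theorem hasLine_iff {l : List ℕ} {n : ℕ} {S : Finset (Fin 8)} (h : IsCode n S) :
    hasLine l n = true ↔ ∃ I ∈ (toPair (decode l)).1, I ⊆ S := by
  have key : ∀ m, bitCount (Nat.land m n) = ((decodeBlock m).points ∩ S).card := by
    intro m
    rw [← card_points_inter]
    congr 2
    ext i
    rw [mem_points_decodeBlock, h.2]
  simp only [hasLine, List.any_eq_true, Bool.and_eq_true, Nat.beq_eq, Nat.ble_eq, key,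
    mem_toPair_fst, ← toNat_isConic_decodeBlock, Set.mem_ofPred_eq, mem_decode,
    Bool.toNat_eq_zero]
  constructor
  · rintro ⟨m, hm, hκ, hc⟩
    obtain ⟨I, hI, hcI⟩ := Finset.exists_subset_card_eq hc
    exact ⟨I, ⟨hcI, _, ⟨m, hm, Block.ext hκ rfl⟩, hI.trans Finset.inter_subset_left⟩,
      hI.trans Finset.inter_subset_right⟩
  · rintro ⟨I, ⟨hcI, s, ⟨m, hm, hb⟩, hI⟩, hIS⟩
    refine ⟨m, hm, by rw [hb], ?_⟩
    rw [← hcI]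
    exact Finset.card_le_card (Finset.subset_inter (by rw [hb]; exact hI) hIS)

theorem linearIndependent_of_minor {K : Type} [Field K] {u w : Fin 3 → K}
    (h : ¬ (u 1 * w 2 - u 2 * w 1 = 0 ∧ u 2 * w 0 - u 0 * w 2 = 0 ∧
      u 0 * w 1 - u 1 * w 0 = 0)) : LinearIndependent K ![u, w] := by
  rw [LinearIndependent.pair_iff]
  intro a b hab
  have e : ∀ i, a * u i + b * w i = 0 := fun i => by simpa using congrFun hab i
  have key : ∀ i j, u i * w j - u j * w i ≠ 0 → a = 0 ∧ b = 0 := by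
    intro i j hm
    constructor
    · apply (mul_eq_zero.1 (?_ : a * (u i * w j - u j * w i) = 0)).resolve_right hm
      linear_combination w j * e i - w i * e j
    · apply (mul_eq_zero.1 (?_ : b * (u i * w j - u j * w i) = 0)).resolve_right hm
      linear_combination u i * e j - u j * e i
  by_contra hne
  exact h ⟨not_not.1 fun h => hne (key _ _ h), not_not.1 fun h => hne (key _ _ h),
    not_not.1 fun h => hne (key _ _ h)⟩

section
variable {R : Type} [CommRing R] [DecidableEq R] {K : Type} [Field K] [CharZero K]

/-- Brackets are integer polynomials in the coordinates, and an injective ring homomorphism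
preserves both their vanishing and their nonvanishing. One check over `R` therefore serves every
field containing `R`. -/
theorem representable_of_checkRealization (φ : R →+* K) (hφ : Function.Injective φ) {l : List ℕ}
    {v : ℕ → Fin 3 → R} (h : checkRealization l v = true) :
    Representable K (toPair (decode l)) := by
  rw [checkRealization, Bool.and_eq_true, Bool.and_eq_true, List.all_eq_true, List.all_eq_true,
    List.all_eq_true] at h
  obtain ⟨⟨h2, h3⟩, h6⟩ := h
  let w : Fin 8 → Fin 3 → K := fun i c => φ (v i c)
  have hw : ∀ i j k : Fin 8, bracket (w i) (w j) (w k) = φ (bracket (v i) (v j) (v k)) := by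
    intro i j k
    simp [bracket, w]
  have hc : ∀ i j k l m n : Fin 8, conicBracket (w i) (w j) (w k) (w l) (w m) (w n) =
      φ (conicBracket (v i) (v j) (v k) (v l) (v m) (v n)) := by
    intro i j k l m n
    simp only [conicBracket, dualCoord, cremona, hw]
    simp [bracket]
  obtain ⟨p, hp⟩ := exists_isCoord (v := w) (by
    intro i j hij
    obtain ⟨n, hn, hcode⟩ := exists_isCode (Finset.card_pair hij.ne)
    have hchk := h2 n hn
    unfold checkPair at hchk
    split at hchk
    · rename_i a b hab
      -- The positions are listed in increasing order, which matches the two list entries with `i <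
      -- j`.
      have hsort : ((bitList n).Pairwise (· < ·)) := List.pairwise_lt_range.filter _
      have hi : (i : ℕ) ∈ bitList n := hcode.mem_iff.1 (by simp)
      have hj : (j : ℕ) ∈ bitList n := hcode.mem_iff.1 (by simp)
      rw [hab] at hi hj hsort
      have hlt : (i : ℕ) < j := hij
      have hab' : a < b := by simpa using hsort
      simp only [List.mem_cons, List.not_mem_nil, or_false] at hi hj
      obtain ⟨rfl, rfl⟩ : a = i ∧ b = j := by omega
      refine linearIndependent_of_minor ?_
      simp only [Bool.not_eq_true', Bool.and_eq_false_iff, decide_eq_false_iff_not] at hchk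
      simp only [w, ← map_mul, ← map_sub, map_eq_zero_iff φ hφ]
      tauto
    · exact absurd hchk (by simp))
  have hline : ∀ I : Finset (Fin 8), I.card = 3 →
      (I ∈ (toPair (decode l)).1 ↔ LineThrough p I) := by
    intro I hI
    obtain ⟨n, hn, hcode⟩ := exists_isCode hI
    have hchk := h3 n hn
    rw [mem_toPair_fst, and_iff_right hI, ← coveredBy_iff hcode]
    change coveredBy 0 l n = true ↔ _
    unfold checkTriple at hchk
    split at hchk
    · rename_i a b c habc
      have hlt : ∀ x ∈ [a, b, c], x < 8 := fun x hx => (mem_bitList.1 (habc ▸ hx)).1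
      simp only [List.forall_mem_cons, List.not_mem_nil, false_imp_iff, implies_true,
        and_true] at hlt
      obtain ⟨ha, hb, hc⟩ := hlt
      have : I = {⟨a, ha⟩, ⟨b, hb⟩, ⟨c, hc⟩} := by
        ext x
        rw [hcode.mem_iff, habc]
        simp [Fin.ext_iff]
      rw [this, lineThrough_iff hp, hw, map_eq_zero_iff φ hφ, beq_iff_eq.1 hchk,
        decide_eq_true_iff]
    · exact absurd hchk (by simp)
  refine ⟨p, isPair_toPair _, hline, ?_⟩
  intro J hJ
  obtain ⟨n, hn, hcode⟩ := exists_isCode hJ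
  have hchk := h6 n hn
  rw [mem_toPair_snd, and_iff_right hJ, ← coveredBy_iff hcode]
  change coveredBy 1 l n = true ↔ _
  by_cases hL : hasLine l n = true
  · rw [hL, cond_true, Bool.not_eq_true'] at hchk
    rw [hchk]
    refine iff_of_false (by simp) fun hcon => ?_
    obtain ⟨I, hI, hIJ⟩ := (hasLine_iff hcode).1 hL
    have hI3 := (mem_toPair_fst.1 hI).1
    have hIl := (hline I hI3).1 hI
    obtain ⟨x, y, z, hxy, hxz, hyz, rfl⟩ := Finset.card_eq_three.1 hI3
    exact not_lineThrough_of_conicThrough hcon (hIJ (by simp)) (hIJ (by simp)) (hIJ (by simp))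
      hxy hxz hyz hIl
  · rw [Bool.not_eq_true _ |>.mp hL, cond_false] at hchk
    unfold checkSextuple at hchk
    split at hchk
    · rename_i a b c d e f habc
      have hlt : ∀ x ∈ [a, b, c, d, e, f], x < 8 := fun x hx => (mem_bitList.1 (habc ▸ hx)).1
      have hnd : [a, b, c, d, e, f].Nodup := habc ▸ nodup_bitList n
      let s : Fin 6 → Fin 8 := fun i => ⟨[a, b, c, d, e, f][i], hlt _ (List.getElem_mem _)⟩
      have hs : Function.Injective s := by
        intro i j hij
        have := congrArg Fin.val hij
        exact Fin.ext ((List.Nodup.getElem_inj_iff hnd).1 this)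
      have hJs : J = Finset.univ.image s := by
        ext x
        rw [hcode.mem_iff, habc]
        simp only [Finset.mem_image, Finset.mem_univ, true_and]
        constructor
        · intro hx
          obtain ⟨i, hi, he⟩ := List.getElem_of_mem hx
          exact ⟨⟨i, hi⟩, Fin.ext he⟩
        · rintro ⟨i, rfl⟩
          exact List.getElem_mem _
      rw [hJs, conicThrough_iff hp hs, hc, map_eq_zero_iff φ hφ, beq_iff_eq.1 hchk,
        decide_eq_true_iff, and_iff_right]
      · rfl
      · intro i j k hij hjk hl
        apply hL
        have h3c : ({s i, s j, s k} : Finset (Fin 8)).card = 3 := Finset.card_eq_three.2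
          ⟨s i, s j, s k, hs.ne hij.ne, hs.ne (hij.trans hjk).ne, hs.ne hjk.ne, rfl⟩
        refine (hasLine_iff hcode).2 ⟨_, (hline _ h3c).2 hl, ?_⟩
        rw [hJs]
        intro x hx
        simp only [Finset.mem_insert, Finset.mem_singleton] at hx
        rcases hx with rfl | rfl | rfl <;> exact Finset.mem_image_of_mem _ (Finset.mem_univ _)
    · exact absurd hchk (by simp)

end
end Quatroid

/-! ### The four exceptional orbits -/

namespace Quatroid

theorem mem_toPair_decode_fst {l : List ℕ} {n : ℕ} {S : Finset (Fin 8)} (h : IsCode n S)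
    (hS : S.card = 3) : S ∈ (toPair (decode l)).1 ↔ coveredBy 0 l n = true := by
  rw [mem_toPair_fst, and_iff_right hS, ← coveredBy_iff h]
  rfl

theorem mem_toPair_decode_snd {l : List ℕ} {n : ℕ} {S : Finset (Fin 8)} (h : IsCode n S)
    (hS : S.card = 6) : S ∈ (toPair (decode l)).2 ↔ coveredBy 1 l n = true := by
  rw [mem_toPair_snd, and_iff_right hS, ← coveredBy_iff h]
  rfl

/-- The code of a triple. -/
def tripleCode (i j k : ℕ) : ℕ := 2 ^ i + 2 ^ j + 2 ^ k

theorem isCode_triple : ∀ i j k : Fin 8, i < j → j < k → IsCode (tripleCode i j k) {i, j, k} := by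
  unfold IsCode
  decide +kernel

theorem triple_mem_iff {l : List ℕ} {i j k : Fin 8} (hij : i < j) (hjk : j < k) :
    {i, j, k} ∈ (toPair (decode l)).1 ↔ coveredBy 0 l (tripleCode i j k) = true :=
  mem_toPair_decode_fst (isCode_triple i j k hij hjk)
    (Finset.card_eq_three.2 ⟨i, j, k, hij.ne, (hij.trans hjk).ne, hjk.ne, rfl⟩)

section
variable {K : Type} [Field K]

/-- The collinear triples of `p` are the ones of the family with the given codes. -/
def HasLines (p : Config K) (l : List ℕ) : Prop :=
  ∀ I : Finset (Fin 8), I.card = 3 → (I ∈ (toPair (decode l)).1 ↔ LineThrough p I)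

theorem HasLines.lineThrough_iff {p : Config K} {l : List ℕ} (h : HasLines p l) {i j k : Fin 8}
    (hij : i < j) (hjk : j < k) :
    LineThrough p {i, j, k} ↔ coveredBy 0 l (tripleCode i j k) = true := by
  rw [← triple_mem_iff hij hjk]
  exact (h _ (Finset.card_eq_three.2 ⟨i, j, k, hij.ne, (hij.trans hjk).ne, hjk.ne, rfl⟩)).symm

theorem HasLines.bracket_iff {p : Config K} {l : List ℕ} (h : HasLines p l) {i j k : Fin 8}
    (hij : i < j) (hjk : j < k) : bracket (p i).rep (p j).rep (p k).rep = 0 ↔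
      coveredBy 0 l (tripleCode i j k) = true := by
  rw [← h.lineThrough_iff hij hjk, Quatroid.lineThrough_iff (isCoord_rep p)]

theorem HasLines.bracket_eq_zero {p : Config K} {l : List ℕ} (h : HasLines p l) (i j k : Fin 8)
    (hijk : i < j ∧ j < k ∧ coveredBy 0 l (tripleCode i j k) = true) :
    bracket (p i).rep (p j).rep (p k).rep = 0 :=
  (h.bracket_iff hijk.1 hijk.2.1).2 hijk.2.2

theorem HasLines.bracket_ne_zero {p : Config K} {l : List ℕ} (h : HasLines p l) (i j k : Fin 8)
    (hijk : i < j ∧ j < k ∧ coveredBy 0 l (tripleCode i j k) = false) :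
    bracket (p i).rep (p j).rep (p k).rep ≠ 0 := by
  rw [ne_eq, h.bracket_iff hijk.1 hijk.2.1, hijk.2.2]
  exact Bool.false_ne_true

theorem blocks_classAt_119 : (classAt 119).blocks = [7, 25, 42, 52, 76, 82, 97] := by
  decide +kernel

theorem blocks_classAt_122 : (classAt 122).blocks = [7, 25, 42, 52, 478, 493, 499] := by
  decide +kernel

theorem blocks_classAt_125 : (classAt 125).blocks = [135, 25, 42, 52, 76, 82, 97] := by
  decide +kernel

theorem blocks_classAt_127 :
    (classAt 127).blocks = [7, 25, 42, 76, 112, 146, 164, 193] := by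
  decide +kernel

theorem blocks_classAt_45 : (classAt 45).blocks = [7, 25, 42, 52] := by
  decide +kernel

/-- The codes 7 and 135 differ only in whether the label `7` lies on the line `012`. The argument
uses no triple containing that label, so it covers both cases. -/
theorem not_hasLines_fano [CharZero K] (p : Config K) (a : ℕ) (ha : a = 7 ∨ a = 135) :
    ¬ HasLines p [a, 25, 42, 52, 76, 82, 97] := by
  intro h
  have hz := h.bracket_eq_zero
  have hn := h.bracket_ne_zero
  rcases ha with rfl | rfl <;>
  exact not_fano (fun i => (p i).rep) (hz 0 1 2 (by decide)) (hz 0 3 4 (by decide))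
    (hz 1 3 5 (by decide)) (hz 2 4 5 (by decide)) (hz 2 3 6 (by decide)) (hz 1 4 6 (by decide))
    (hz 0 5 6 (by decide)) (hn 1 2 3 (by decide)) (hn 0 1 4 (by decide)) (hn 0 3 5 (by decide))
    (hn 1 3 6 (by decide)) (hn 0 3 6 (by decide)) (hn 0 1 6 (by decide))

theorem not_hasLines_moebiusKantor (hK : ∀ r : K, r ^ 2 - r + 1 ≠ 0) (p : Config K) :
    ¬ HasLines p [7, 25, 42, 76, 112, 146, 164, 193] := by
  intro h
  have hz := h.bracket_eq_zero
  have hn := h.bracket_ne_zero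
  exact not_moebiusKantor hK (fun i => (p i).rep) (hz 0 1 2 (by decide)) (hz 0 3 4 (by decide))
    (hz 1 3 5 (by decide)) (hz 2 3 6 (by decide)) (hz 4 5 6 (by decide)) (hz 1 4 7 (by decide))
    (hz 2 5 7 (by decide)) (hz 0 6 7 (by decide)) (hn 1 2 3 (by decide)) (hn 0 1 4 (by decide))
    (hn 0 3 5 (by decide)) (hn 1 3 6 (by decide)) (hn 0 1 7 (by decide))

theorem not_representable_classFamily_122 [CharZero K] :
    ¬ Representable K (toPair (classFamily 122)) := by
  rintro ⟨p, -, hL, hC⟩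
  have e : classFamily 122 = decode [7, 25, 42, 52, 478, 493, 499] := by
    rw [← blocks_classAt_122]
    rfl
  rw [e] at hL hC
  have h : HasLines p [7, 25, 42, 52, 478, 493, 499] := hL
  have key : ∀ i j k : Fin 8, i < j → j < k →
      (coveredBy 0 [7, 25, 42, 52, 478, 493, 499] (tripleCode i j k) = true ↔
        (i, j, k) ∈ [((0 : Fin 8), (1 : Fin 8), (2 : Fin 8)), (0, 3, 4), (1, 3, 5), (2, 4, 5)]) :=
    by decide +kernel
  have hconic : ∀ (n : ℕ) (S : Finset (Fin 8)), IsCode n S → S.card = 6 →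
      coveredBy 1 [7, 25, 42, 52, 478, 493, 499] n = true → ConicThrough p S :=
    fun n S hn hS hc => (hC S hS).1 ((mem_toPair_decode_snd hn hS).2 hc)
  -- The codes 222, 237, 243 are 478, 493, 499 without the conic bit 256.
  refine not_quadrilateral_of_conics p ?_ ?_ (hconic 222 _ ?_ rfl rfl) (hconic 237 _ ?_ rfl rfl)
    (hconic 243 _ ?_ rfl rfl)
  · intro i j k hijk
    have hlt : i < j ∧ j < k := by
      have : ∀ t ∈ [((0 : Fin 8), (1 : Fin 8), (2 : Fin 8)), (0, 3, 4), (1, 3, 5), (2, 4, 5)],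
        t.1 < t.2.1 ∧ t.2.1 < t.2.2 := by decide +kernel
      exact this _ hijk
    exact (h.lineThrough_iff hlt.1 hlt.2).2 ((key i j k hlt.1 hlt.2).2 hijk)
  · intro i j k hij hjk hn
    rwa [h.lineThrough_iff hij hjk, key i j k hij hjk]
  all_goals exact ⟨by norm_num, by decide⟩

end

theorem not_matroidal_classFamily_119 : ¬ Matroidal (toPair (classFamily 119)) := by
  rintro ⟨p, hp⟩
  refine not_hasLines_fano p 7 (by simp) ?_
  rw [← blocks_classAt_119]
  exact hp

theorem not_matroidal_classFamily_125 : ¬ Matroidal (toPair (classFamily 125)) := by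
  rintro ⟨p, hp⟩
  refine not_hasLines_fano p 135 (by simp) ?_
  rw [← blocks_classAt_125]
  exact hp

theorem not_representable_classFamily_127 {K : Type} [Field K]
    (hK : ∀ r : K, r ^ 2 - r + 1 ≠ 0) : ¬ Representable K (toPair (classFamily 127)) := by
  rintro ⟨p, -, hp, -⟩
  refine not_hasLines_moebiusKantor hK p ?_
  rw [← blocks_classAt_127]
  exact hp

theorem representable_classFamily {K : Type} [Field K] [CharZero K] (i : Fin 128)
    (hi : (i : ℕ) ∉ exceptional) : Representable K (toPair (classFamily i)) := by
  have h := List.all_eq_true.1 checkRealization_classTable i (List.mem_range.2 i.2)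
  rw [Bool.or_eq_true, List.any_eq_true] at h
  refine representable_of_checkRealization (Int.castRingHom K) Int.cast_injective
    (h.resolve_left ?_)
  rintro ⟨j, hj, hij⟩
  rw [Nat.beq_eq] at hij
  exact hi (hij ▸ hj)

/-- Being matroidal only concerns the lines, which are those of the representative 45: the same
quadrilateral without conics, which has integer coordinates. -/
theorem matroidal_classFamily_122 : Matroidal (toPair (classFamily 122)) := by
  obtain ⟨p, hp⟩ := (representable_classFamily (K := ℂ) 45 (by decide)).matroidal
  refine ⟨p, fun I hI => ?_⟩
  rw [← hp I hI]
  obtain ⟨n, hn, hcode⟩ := exists_isCode hI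
  have key : ∀ m ∈ subsetCodes 3, coveredBy 0 [7, 25, 42, 52, 478, 493, 499] m =
      coveredBy 0 [7, 25, 42, 52] m := by decide +kernel
  change I ∈ (toPair (decode (classAt 122).blocks)).1 ↔ I ∈ (toPair (decode (classAt 45).blocks)).1
  rw [mem_toPair_decode_fst hcode hI, mem_toPair_decode_fst hcode hI, blocks_classAt_122,
    blocks_classAt_45, key n hn]

/-- The Möbius-Kantor configuration, over the ring generated by a square root of `-3`. -/
def moebiusKantorCoord (k : ℕ) : Fin 3 → ℤ√(-3) :=
  -- The last three points are doubled to clear the denominators of `(-1 + √-3) / 2` and of the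
  -- primitive sixth root of unity `(1 + √-3) / 2`.
  [![⟨1, 0⟩, 0, 0], ![0, ⟨1, 0⟩, 0], ![⟨1, 0⟩, ⟨1, 0⟩, 0], ![0, 0, ⟨1, 0⟩], ![⟨1, 0⟩, 0, ⟨1, 0⟩],
    ![0, ⟨2, 0⟩, ⟨-1, 1⟩], ![⟨2, 0⟩, ⟨2, 0⟩, ⟨1, 1⟩], ![⟨1, 1⟩, ⟨2, 0⟩, ⟨1, 1⟩]].getD k 0

theorem checkRealization_moebiusKantor :
    checkRealization [7, 25, 42, 76, 112, 146, 164, 193] moebiusKantorCoord = true := by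
  decide +kernel

theorem representable_classFamily_127 : Representable ℂ (toPair (classFamily 127)) := by
  have e : classFamily 127 = decode [7, 25, 42, 76, 112, 146, 164, 193] := by
    rw [← blocks_classAt_127]
    rfl
  rw [e]
  have h3 : ((√3 : ℝ) : ℂ) ^ 2 = 3 := by
    rw [← Complex.ofReal_pow, Real.sq_sqrt (by norm_num)]
    norm_num
  let s : { r : ℂ // r * r = ((-3 : ℤ) : ℂ) } := ⟨(√3 : ℝ) * Complex.I, by
    push_cast
    linear_combination (-1 : ℂ) * h3 + ((√3 : ℝ) : ℂ) ^ 2 * Complex.I_sq⟩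
  refine representable_of_checkRealization (Zsqrtd.lift s)
    (Zsqrtd.lift_injective s fun n => ?_) checkRealization_moebiusKantor
  -- The lift is injective because `-3` is not the square of an integer.
  nlinarith [mul_self_nonneg n]

theorem strongCriteria_classFamily_iff (i : Fin 128) :
    StrongCriteria (toPair (classFamily i)) ↔
      ((classAt i).blocks.all fun n => Nat.beq (bitCount n) (3 + 3 * conicBit n)) = true := by
  rw [(isClique_classFamily i).strongCriteria_iff, List.all_eq_true, classFamily]
  simp only [mem_decode, forall_exists_index, and_imp, forall_apply_eq_imp_iff₂,
    card_points_decodeBlock, freePoints_add_one, toNat_isConic_decodeBlock, Nat.beq_eq]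

end Quatroid

/-! ### Counting pairs and orbits -/

namespace Quatroid

section Orbits
variable {S : Set Pair} {A : Finset (Fin 128)}

/-- `A` holds the indices of the orbits of `S`. -/
structure IsClassified (S : Set Pair) (A : Finset (Fin 128)) : Prop where
  pair : ∀ Q ∈ S, IsPair Q ∧ WeakCriteria Q
  smul : ∀ (σ : Equiv.Perm (Fin 8)) (Q : Pair), σ • Q ∈ S ↔ Q ∈ S
  mem : ∀ i, toPair (classFamily i) ∈ S ↔ i ∈ A

/-- The weak criteria turn a pair into a clique, the classification carries the clique to a
representative, and invariance of `S` carries membership along. -/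
theorem IsClassified.mem_iff (h : IsClassified S A) {Q : Pair} : Q ∈ S ↔
    ∃ i ∈ A, ∃ σ : Equiv.Perm (Fin 8), σ • toPair (classFamily i) = Q := by
  constructor
  · intro hQ
    obtain ⟨X, hX, rfl⟩ := exists_clique_toPair (h.pair Q hQ).1 (h.pair Q hQ).2
    obtain ⟨i, σ, rfl⟩ := exists_smul_classFamily hX
    rw [toPair_smul, h.smul, h.mem] at hQ
    exact ⟨i, hQ, σ, (toPair_smul _ _).symm⟩
  · rintro ⟨i, hi, σ, rfl⟩
    rwa [h.smul, h.mem]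

theorem toPair_classFamily_injective (i j : Fin 128) (σ : Equiv.Perm (Fin 8))
    (h : σ • toPair (classFamily i) = toPair (classFamily j)) : i = j := by
  rw [← toPair_smul] at h
  exact classFamily_injective i j σ
    (toPair_injOn (isClique_smul σ (isClique_classFamily i)) (isClique_classFamily j) h)

theorem IsClassified.ncard_eq (h : IsClassified S A) :
    S.ncard = ∑ i ∈ A, (classAt i).size := by
  classical
  have hS : S = toPair '' (A.biUnion fun i =>
      orbitFinset (Equiv.Perm (Fin 8)) (classFamily i) : Finset (Finset Block)) := by
    ext Q
    rw [h.mem_iff]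
    simp only [Set.mem_image, Finset.mem_coe, Finset.mem_biUnion, mem_orbitFinset]
    constructor
    · rintro ⟨i, hi, σ, rfl⟩
      exact ⟨_, ⟨i, hi, σ, rfl⟩, toPair_smul _ _⟩
    · rintro ⟨_, ⟨i, hi, σ, rfl⟩, rfl⟩
      exact ⟨i, hi, σ, (toPair_smul _ _).symm⟩
  rw [hS, Set.InjOn.ncard_image, Set.ncard_coe_finset, Finset.card_biUnion]
  · exact Finset.sum_congr rfl fun i _ => card_orbit_classFamily i
  · intro i _ j _ hij
    refine Finset.disjoint_left.2 fun X hi hj => hij ?_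
    obtain ⟨σ, rfl⟩ := mem_orbitFinset.1 hi
    obtain ⟨τ, hτ⟩ := mem_orbitFinset.1 ((smul_mem_orbitFinset σ).1 hj)
    exact (classFamily_injective j i τ hτ).symm
  · refine toPair_injOn.mono fun X hX => ?_
    obtain ⟨i, _, hi⟩ := Finset.mem_biUnion.1 hX
    obtain ⟨σ, rfl⟩ := mem_orbitFinset.1 hi
    exact isClique_smul σ (isClique_classFamily i)

theorem IsClassified.orbitCount_eq (h : IsClassified S A) : orbitCount S = A.card := by
  have : (fun Q : Pair => MulAction.orbit (Equiv.Perm (Fin 8)) Q) '' S =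
      (fun i => MulAction.orbit (Equiv.Perm (Fin 8)) (toPair (classFamily i))) '' A := by
    ext O
    constructor
    · rintro ⟨Q, hQ, rfl⟩
      obtain ⟨i, hi, σ, rfl⟩ := h.mem_iff.1 hQ
      exact ⟨i, hi, (MulAction.orbit_smul σ _).symm⟩
    · rintro ⟨i, hi, rfl⟩
      exact ⟨_, (h.mem i).2 hi, rfl⟩
  rw [orbitCount, this, Set.ncard_image_of_injective, Set.ncard_coe_finset]
  intro i j hij
  obtain ⟨σ, hσ⟩ := MulAction.orbit_eq_iff.1 hij
  exact (toPair_classFamily_injective j i σ hσ).symm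

end Orbits

section Counting

/-- Proved through cliques, whose defining bounds are visibly invariant under relabelling. -/
theorem weakCriteria_smul_iff (σ : Equiv.Perm (Fin 8)) (Q : Pair) (hQ : IsPair Q) :
    WeakCriteria (σ • Q) ↔ WeakCriteria Q := by
  have key : ∀ (τ : Equiv.Perm (Fin 8)) (P : Pair), IsPair P → WeakCriteria P →
      WeakCriteria (τ • P) := by
    intro τ P hP hW
    obtain ⟨X, hX, rfl⟩ := exists_clique_toPair hP hW
    rw [← toPair_smul]
    exact (isClique_smul τ hX).weakCriteria
  refine ⟨fun h => ?_, key σ Q hQ⟩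
  have := key σ⁻¹ (σ • Q) ((isPair_smul_iff σ Q).2 hQ) h
  rwa [inv_smul_smul] at this

theorem strongCriteria_smul_iff (σ : Equiv.Perm (Fin 8)) (Q : Pair) :
    StrongCriteria (σ • Q) ↔ StrongCriteria Q := by
  simp only [StrongCriteria, Prod.smul_fst, Prod.smul_snd, Finset.mem_smul_finset,
    forall_exists_index, and_imp, forall_apply_eq_imp_iff₂, ← Finset.smul_finset_inter,
    Finset.card_smul_finset, ne_eq, smul_left_cancel_iff]

theorem smul_mem_candidates_iff (σ : Equiv.Perm (Fin 8)) (Q : Pair) :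
    σ • Q ∈ candidates ↔ Q ∈ candidates := by
  change _ ∧ _ ∧ _ ↔ _ ∧ _ ∧ _
  rw [isPair_smul_iff, matroidal_smul_iff]
  exact and_congr_right fun hQ => and_congr_right fun _ => weakCriteria_smul_iff σ Q hQ

theorem eq_of_mem_exceptional {i : Fin 128} (h : (i : ℕ) ∈ exceptional) :
    i = 119 ∨ i = 122 ∨ i = 125 ∨ i = 127 := by
  simpa [exceptional, Fin.ext_iff] using h

theorem not_mem_exceptional_of_subset {l : List ℕ} (hl : l ⊆ exceptional) {i : ℕ}
    (hi : i ∉ exceptional) : i ∉ l := fun h => hi (hl h)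

theorem mem_candidates_classFamily_iff (i : Fin 128) :
    toPair (classFamily i) ∈ candidates ↔ (i : ℕ) ∉ [119, 125] := by
  have h : toPair (classFamily i) ∈ candidates ↔ Matroidal (toPair (classFamily i)) :=
    ⟨fun h => h.2.1, fun h => ⟨isPair_toPair _, h, (isClique_classFamily i).weakCriteria⟩⟩
  rw [h]
  by_cases hi : (i : ℕ) ∈ exceptional
  · rcases eq_of_mem_exceptional hi with rfl | rfl | rfl | rfl
    · exact iff_of_false not_matroidal_classFamily_119 (by decide)
    · exact iff_of_true matroidal_classFamily_122 (by decide)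
    · exact iff_of_false not_matroidal_classFamily_125 (by decide)
    · exact iff_of_true representable_classFamily_127.matroidal (by decide)
  · exact iff_of_true (representable_classFamily i hi).matroidal
      (not_mem_exceptional_of_subset (by decide) hi)

theorem representable_complex_classFamily_iff (i : Fin 128) :
    Representable ℂ (toPair (classFamily i)) ↔ (i : ℕ) ∉ [119, 122, 125] := by
  by_cases hi : (i : ℕ) ∈ exceptional
  · rcases eq_of_mem_exceptional hi with rfl | rfl | rfl | rfl
    · exact iff_of_false (fun h => not_matroidal_classFamily_119 h.matroidal) (by decide)
    · exact iff_of_false not_representable_classFamily_122 (by decide)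
    · exact iff_of_false (fun h => not_matroidal_classFamily_125 h.matroidal) (by decide)
    · exact iff_of_true representable_classFamily_127 (by decide)
  · exact iff_of_true (representable_classFamily i hi)
      (not_mem_exceptional_of_subset (by decide) hi)

/-- Without a root of `r ^ 2 - r + 1` all four exceptional orbits drop out, the Fano ones already as
candidates; the others have integer coordinates. -/
theorem mem_candidates_and_representable_classFamily_iff {K : Type} [Field K] [CharZero K]
    (hK : ∀ r : K, r ^ 2 - r + 1 ≠ 0) (i : Fin 128) :
    toPair (classFamily i) ∈ candidates ∧ Representable K (toPair (classFamily i)) ↔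
      (i : ℕ) ∉ exceptional := by
  refine ⟨fun ⟨h1, h2⟩ hi => ?_, fun hi =>
    ⟨(representable_classFamily (K := ℂ) i hi).mem_candidates, representable_classFamily i hi⟩⟩
  rcases eq_of_mem_exceptional hi with rfl | rfl | rfl | rfl
  · exact not_matroidal_classFamily_119 h1.2.1
  · exact not_representable_classFamily_122 h2
  · exact not_matroidal_classFamily_125 h1.2.1
  · exact not_representable_classFamily_127 hK h2

theorem bezoutian_classFamily_iff (i : Fin 128) :
    Representable ℂ (toPair (classFamily i)) ∧ Bezoutian (toPair (classFamily i)) ↔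
      (i : ℕ) ∉ [119, 122, 125] ∧
      ((classAt i).blocks.all fun n => Nat.beq (bitCount n) (3 + 3 * conicBit n)) = true := by
  rw [representable_complex_classFamily_iff, ← strongCriteria_classFamily_iff]
  exact and_congr_right fun _ => ⟨fun h => h.2.2,
    fun h => ⟨isPair_toPair _, (isClique_classFamily i).weakCriteria, h⟩⟩

/-- Is the index absent from the list? -/
def avoids (l : List ℕ) (i : ℕ) : Bool := !l.any (Nat.beq i)

theorem avoids_iff {l : List ℕ} {i : ℕ} : avoids l i = true ↔ i ∉ l := by
  rw [avoids, Bool.not_eq_true', ← Bool.not_eq_true, List.any_eq_true]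
  simp only [Nat.beq_eq, exists_eq_right']

/-- The number of elements and the number of orbits of a set of pairs. -/
theorem ncard_and_orbitCount {S : Set Pair} (h1 : ∀ Q ∈ S, IsPair Q ∧ WeakCriteria Q)
    (h2 : ∀ (σ : Equiv.Perm (Fin 8)) (Q : Pair), σ • Q ∈ S ↔ Q ∈ S) (f : ℕ → Bool)
    (h3 : ∀ i : Fin 128, toPair (classFamily i) ∈ S ↔ f i = true) {a b : ℕ}
    (ha : ((List.range 128).foldr
      (fun i t => cond (f i) (Nat.add (classAt i).size t) t) 0) = a)
    (hb : ((List.range 128).foldr (fun i t => cond (f i) (Nat.add 1 t) t) 0) = b) :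
    S.ncard = a ∧ orbitCount S = b := by
  have hfold : ∀ (g : ℕ → ℕ) (l : List ℕ),
      l.foldr (fun i t => cond (f i) (g i + t) t) 0 =
        (l.map fun i => if f i = true then g i else 0).sum := by
    intro g l
    induction l with
    | nil => rfl
    | cons i l ih => cases hi : f i <;> simp [hi, ih]
  have hsum : ∀ g : ℕ → ℕ, ∑ i : Fin 128, (if f i = true then g i else 0) =
      (List.range 128).foldr (fun i t => cond (f i) (g i + t) t) 0 := by
    intro g
    rw [hfold, Fin.sum_univ_eq_sum_range fun i => if f i = true then g i else 0]
    rfl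
  have h : IsClassified S (Finset.univ.filter fun i => f i = true) :=
    ⟨h1, h2, fun i => by rw [h3]; simp⟩
  rw [h.ncard_eq, h.orbitCount_eq, Finset.sum_filter, Finset.card_filter,
    hsum (fun i => (classAt i).size), hsum (fun _ => 1)]
  exact ⟨ha, hb⟩

theorem ncard_and_orbitCount_candidates :
    candidates.ncard = 780617 ∧ orbitCount candidates = 126 :=
  ncard_and_orbitCount (fun _ h => ⟨h.1, h.2.2⟩) smul_mem_candidates_iff (avoids [119, 125])
    (fun i => (mem_candidates_classFamily_iff i).trans avoids_iff.symm)
    (by decide +kernel) (by decide +kernel)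

theorem ncard_and_orbitCount_complex :
    {Q ∈ candidates | Representable ℂ Q}.ncard = 779777 ∧
      orbitCount {Q ∈ candidates | Representable ℂ Q} = 125 :=
  ncard_and_orbitCount (fun _ h => ⟨h.1.1, h.1.2.2⟩)
    (fun σ Q => and_congr (smul_mem_candidates_iff σ Q) (representable_smul_iff σ Q))
    (avoids [119, 122, 125])
    (fun i => Iff.trans ⟨And.right, fun h => And.intro h.mem_candidates h⟩
      ((representable_complex_classFamily_iff i).trans avoids_iff.symm))
    (by decide +kernel) (by decide +kernel)

theorem ncard_and_orbitCount_of_no_root {K : Type} [Field K] [CharZero K]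
    (hK : ∀ r : K, r ^ 2 - r + 1 ≠ 0) :
    {Q ∈ candidates | Representable K Q}.ncard = 778937 ∧
      orbitCount {Q ∈ candidates | Representable K Q} = 124 :=
  ncard_and_orbitCount (fun _ h => ⟨h.1.1, h.1.2.2⟩)
    (fun σ Q => and_congr (smul_mem_candidates_iff σ Q) (representable_smul_iff σ Q))
    (avoids exceptional)
    (fun i => (mem_candidates_and_representable_classFamily_iff hK i).trans avoids_iff.symm)
    (by decide +kernel) (by decide +kernel)

theorem bezoutian_smul_iff (σ : Equiv.Perm (Fin 8)) (Q : Pair) :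
    Bezoutian (σ • Q) ↔ Bezoutian Q := by
  unfold Bezoutian
  rw [isPair_smul_iff, strongCriteria_smul_iff]
  exact and_congr_right fun hQ => and_congr_left fun _ => weakCriteria_smul_iff σ Q hQ

theorem ncard_and_orbitCount_bezoutian :
    {Q | Representable ℂ Q ∧ Bezoutian Q}.ncard = 544748 ∧
      orbitCount {Q | Representable ℂ Q ∧ Bezoutian Q} = 76 :=
  ncard_and_orbitCount (fun _ h => ⟨h.2.1, h.2.2.1⟩)
    (fun σ Q => and_congr (representable_smul_iff σ Q) (bezoutian_smul_iff σ Q))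
    (fun i => avoids [119, 122, 125] i &&
      (classAt i).blocks.all fun n => Nat.beq (bitCount n) (3 + 3 * conicBit n))
    (fun i => by
      rw [Bool.and_eq_true, avoids_iff]
      exact bezoutian_classFamily_iff i)
    (by decide +kernel) (by decide +kernel)

end Counting

/-! ### Strata and quatroids -/

section Strata

theorem exists_represents (p : Config ℂ) : ∃ Q, Represents p Q := by
  classical
  refine ⟨(Finset.univ.filter fun I => I.card = 3 ∧ LineThrough p I,
    Finset.univ.filter fun J => J.card = 6 ∧ ConicThrough p J), ⟨?_, ?_⟩, ?_, ?_⟩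
  · exact fun I hI => (Finset.mem_filter.1 hI).2.1
  · exact fun I hI => (Finset.mem_filter.1 hI).2.1
  · intro I hI
    simp [hI]
  · intro I hI
    simp [hI]

theorem Represents.mem_locus {p : Config ℂ} {Q : Pair} (h : Represents p Q) : p ∈ locus Q :=
  ⟨fun I hI => (h.2.1 I (h.1.1 I hI)).1 hI, fun J hJ => (h.2.2 J (h.1.2 J hJ)).1 hJ⟩

theorem Represents.subset_of_mem_locus {p : Config ℂ} {P Q : Pair} (h : Represents p P)
    (hQ : IsPair Q) (hp : p ∈ locus Q) : Q.1 ⊆ P.1 ∧ Q.2 ⊆ P.2 :=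
  ⟨fun I hI => (h.2.1 I (hQ.1 I hI)).2 (hp.1 I hI),
    fun J hJ => (h.2.2 J (hQ.2 J hJ)).2 (hp.2 J hJ)⟩

theorem locus_subset {P Q : Pair} (h1 : Q.1 ⊆ P.1) (h2 : Q.2 ⊆ P.2) : locus P ⊆ locus Q :=
  fun _ hp => ⟨fun I hI => hp.1 I (h1 hI), fun J hJ => hp.2 J (h2 hJ)⟩

theorem Represents.unique {p : Config ℂ} {P Q : Pair} (hP : Represents p P)
    (hQ : Represents p Q) : P = Q := by
  obtain ⟨a, b⟩ := hP.subset_of_mem_locus hQ.1 hQ.mem_locus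
  obtain ⟨c, d⟩ := hQ.subset_of_mem_locus hP.1 hP.mem_locus
  exact Prod.ext (c.antisymm a) (d.antisymm b)

/-- The pair represented by `p` contains `Q`, so its locus lies in that of `Q`. Were the inclusion
proper, this locus would have been removed from the stratum, and `p` with it. -/
theorem Represents.locus_eq {p : Config ℂ} {P Q : Pair} (h : Represents p P)
    (hQ : IsPair Q) (hp : p ∈ stratum Q) : locus P = locus Q := by
  obtain ⟨a, b⟩ := h.subset_of_mem_locus hQ hp.1
  by_contra hne
  exact hp.2 (Set.mem_biUnion (show P ∈ {Q' : Pair | IsPair Q' ∧ locus Q' ⊂ locus Q} from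
    ⟨h.1, (locus_subset a b).ssubset_of_ne hne⟩) h.mem_locus)

/-- The configurations in the stratum of a quatroid are the ones that represent it. -/
theorem mem_stratum_iff {Q : Pair} (hQ : Representable ℂ Q) {p : Config ℂ} :
    p ∈ stratum Q ↔ Represents p Q := by
  constructor
  · intro hp
    obtain ⟨q, hq⟩ := hQ
    obtain ⟨P, hP⟩ := exists_represents p
    -- The loci of `P` and `Q` agree, so a configuration `q` representing `Q` satisfies the
    -- conditions of `P`. This gives the inclusion of `P` in `Q`, the reverse of the one coming from
    -- `p`.
    have hqP : q ∈ locus P := by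
      rw [hP.locus_eq hq.1 hp]
      exact hq.mem_locus
    obtain ⟨a, b⟩ := hP.subset_of_mem_locus hq.1 hp.1
    obtain ⟨c, d⟩ := hq.subset_of_mem_locus hP.1 hqP
    rwa [show Q = P from Prod.ext (a.antisymm c) (b.antisymm d)]
  · refine fun hp => ⟨hp.mem_locus, fun hcon => ?_⟩
    obtain ⟨P, ⟨hP, hlt⟩, hpP⟩ := Set.mem_iUnion₂.1 hcon
    obtain ⟨a, b⟩ := hp.subset_of_mem_locus hP hpP
    exact hlt.2 (locus_subset a b)

/-- Any configuration in the stratum represents the pair and so determines it. -/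
theorem stratum_injOn : Set.InjOn stratum {Q | Representable ℂ Q} := by
  intro P hP Q hQ h
  obtain ⟨p, hp⟩ := id hP
  have : p ∈ stratum Q := h ▸ (mem_stratum_iff hP).2 hp
  exact hp.unique ((mem_stratum_iff hQ).1 this)

/-- A stratum depends only on the locus, and the locus equals that of the pair represented by any
point of the stratum. -/
theorem strata_eq_image : strata = stratum '' {Q | Representable ℂ Q} := by
  ext S
  constructor
  · rintro ⟨⟨p, hp⟩, Q, hQ, rfl⟩
    obtain ⟨P, hP⟩ := exists_represents p
    refine ⟨P, ⟨p, hP⟩, ?_⟩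
    rw [stratum, stratum, hP.locus_eq hQ hp]
  · rintro ⟨Q, hQ, rfl⟩
    obtain ⟨p, hp⟩ := id hQ
    exact ⟨⟨p, (mem_stratum_iff hQ).2 hp⟩, Q, hQ.isPair, rfl⟩

theorem bezoutianStrata_eq_image :
    bezoutianStrata = stratum '' {Q | Representable ℂ Q ∧ Bezoutian Q} := by
  ext S
  constructor
  · rintro ⟨-, Q, hQ, hB, rfl⟩
    exact ⟨Q, ⟨hQ, hB⟩, rfl⟩
  · rintro ⟨Q, ⟨hQ, hB⟩, rfl⟩
    refine ⟨?_, Q, hQ, hB, rfl⟩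
    rw [strata_eq_image]
    exact ⟨Q, hQ, rfl⟩

theorem ncard_strata : strata.ncard = 779777 := by
  rw [strata_eq_image, stratum_injOn.ncard_image,
    ← ncard_and_orbitCount_complex.1]
  congr 1
  ext Q
  exact ⟨fun h => ⟨h.mem_candidates, h⟩, fun h => h.2⟩

theorem ncard_bezoutianStrata : bezoutianStrata.ncard = 544748 := by
  rw [bezoutianStrata_eq_image, (stratum_injOn.mono fun _ h => h.1).ncard_image,
    ncard_and_orbitCount_bezoutian.1]

theorem relabel_stratum {Q : Pair} (hQ : Representable ℂ Q) (σ : Equiv.Perm (Fin 8)) :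
    relabel σ (stratum Q) = stratum (σ • Q) := by
  ext p
  rw [mem_stratum_iff ((representable_smul_iff σ Q).2 hQ), ← represents_relabel]
  exact mem_stratum_iff hQ

theorem range_relabel_stratum {Q : Pair} (hQ : Representable ℂ Q) :
    (Set.range fun σ : Equiv.Perm (Fin 8) => relabel σ (stratum Q)) =
      stratum '' MulAction.orbit (Equiv.Perm (Fin 8)) Q := by
  simp only [relabel_stratum hQ, MulAction.orbit, ← Set.range_comp]
  rfl

/-- Relabelling a stratum is relabelling its quatroid, and `stratum` is injective on quatroids, so
orbits of strata correspond to orbits of quatroids. -/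
theorem strataOrbitCount_bezoutianStrata : strataOrbitCount bezoutianStrata = 76 := by
  rw [← ncard_and_orbitCount_bezoutian.2, orbitCount, strataOrbitCount, bezoutianStrata_eq_image,
    Set.image_image, Set.image_congr fun Q hQ => range_relabel_stratum hQ.1,
    ← Set.image_image (stratum '' ·), Set.InjOn.ncard_image]
  rintro _ ⟨P, hP, rfl⟩ _ ⟨Q, hQ, rfl⟩ h
  have hsub : ∀ R, Representable ℂ R → MulAction.orbit (Equiv.Perm (Fin 8)) R ⊆
      {Q | Representable ℂ Q} := by
    rintro R hR _ ⟨σ, rfl⟩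
    exact (representable_smul_iff σ R).2 hR
  exact (stratum_injOn.image_eq_image_iff (hsub P hP.1) (hsub Q hQ.1)).1 h

end Strata
end Quatroid

theorem mainTheorem6 :
    -- the candidate quatroids
    (Quatroid.candidates.ncard = 780617 ∧ Quatroid.orbitCount Quatroid.candidates = 126) ∧
    -- those representable over the complex numbers
    ({Q ∈ Quatroid.candidates | Quatroid.Representable ℂ Q}.ncard = 779777 ∧
      Quatroid.orbitCount {Q ∈ Quatroid.candidates | Quatroid.Representable ℂ Q} = 125) ∧
    -- those representable over the real numbers
    ({Q ∈ Quatroid.candidates | Quatroid.Representable ℝ Q}.ncard = 778937 ∧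
      Quatroid.orbitCount {Q ∈ Quatroid.candidates | Quatroid.Representable ℝ Q} = 124) ∧
    -- those representable over the rational numbers
    ({Q ∈ Quatroid.candidates | Quatroid.Representable ℚ Q}.ncard = 778937 ∧
      Quatroid.orbitCount {Q ∈ Quatroid.candidates | Quatroid.Representable ℚ Q} = 124) ∧
    -- the strata, and the Bézoutian ones among them
    Quatroid.strata.ncard = 779777 ∧
    Quatroid.bezoutianStrata.ncard = 544748 ∧
    Quatroid.strataOrbitCount Quatroid.bezoutianStrata = 76 ∧
    -- the Bézoutian quatroids
    ({Q | Quatroid.Representable ℂ Q ∧ Quatroid.Bezoutian Q}.ncard = 544748 ∧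
      Quatroid.orbitCount {Q | Quatroid.Representable ℂ Q ∧ Quatroid.Bezoutian Q} = 76) := by
  refine ⟨Quatroid.ncard_and_orbitCount_candidates, Quatroid.ncard_and_orbitCount_complex,
    Quatroid.ncard_and_orbitCount_of_no_root fun r => ?_,
    Quatroid.ncard_and_orbitCount_of_no_root fun r => ?_, Quatroid.ncard_strata,
    Quatroid.ncard_bezoutianStrata, Quatroid.strataOrbitCount_bezoutianStrata,
    Quatroid.ncard_and_orbitCount_bezoutian⟩
  -- In an ordered field `4 * (r ^ 2 - r + 1) = (2 * r - 1) ^ 2 + 3` is positive.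
  all_goals nlinarith [sq_nonneg (2 * r - 1)]
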